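/- Let $\gamma>1$, $\mu\ge 0$, $\lambda\ge 0$ and $p(u)=u^{-\gamma}/\gamma$. Let $C^1_b(\mathbb R)$ be the set of bounded continuously differentiable functions on $\mathbb R$ with bounded derivative. For $\varepsilon>0$ and $\varphi,\psi\in C^1_b(\mathbb R)$ consider the Cauchy problem $$u_t-v_x=0,\qquad v_t+p(u)_x=-\frac{\lambda}{(1+t)^{\mu}}\,v,\qquad (u,v)(0,x)=(1+\varepsilon\varphi(x),\ \varepsilon\psi(x)),\qquad x\in\mathbb R,\ t\ge 0,$$ for $C^1$ solutions with $u>0$. The lifespan $T^*\in[0,\infty]$ is the supremum of all $T>0$ such that a $C^1$ solution exists on $[0,T)\times\mathbb R$ with $$\sup_{t\in[0,T)}\Big(\|(u,v)(t)\|_{L^\infty}+\|(u_t,v_t)(t)\|_{L^\infty}+\|(u_x,v_x)(t)\|_{L^\infty}+\|p'(u(t))\|_{L^\infty}\Big)<\infty .$$ (The supremum of the empty set is understood to lie below every positive number.) **Theorem.** Suppose that $\lim_{x\to-\infty}(\varphi(x),\psi(x))=(\varphi_-,\psi_-)$ for some $(\varphi_-,\psi_-)\in\mathbb R^2$. Then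 there exist $\varepsilon_0>0$ and $C>0$, depending on $\gamma,\mu,\lambda,\varphi,\psi$ but not on $\varepsilon$, such that for all $0<\varepsilon\le\varepsilon_0$: - $T^*\ge C\varepsilon^{-1}$ if $\mu>1$ (and $\lambda\ge0$); - $T^*\ge C\varepsilon^{-2/(2-\lambda)}$ if $\mu=1$ and $0\le\lambda<2$; - $T^*\ge e^{C/\varepsilon}$ if $\mu=1$ and $\lambda=2$; - $T^*=\infty$ if $0\le\mu<1$ and $\lambda>0$, or if $\mu=1$ and $\lambda>2$. -/

import Mathlib

open Set Filter Topology

namespace DampedEuler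

noncomputable section

/-- The class `C¹_b(ℝ)`: continuously differentiable, bounded, with bounded derivative. -/
def IsC1b (f : ℝ → ℝ) : Prop :=
  ContDiff ℝ 1 f ∧ (∃ M : ℝ, ∀ x, |f x| ≤ M) ∧ ∃ M : ℝ, ∀ x, |deriv f x| ≤ M

/-- The pressure law `p(u) = u^{-γ} / γ` (used for `u > 0` only). -/
def pressure (γ u : ℝ) : ℝ := u ^ (-γ) / γ

/-- The partial derivative `f_t(t, x)` of a function on `[0, T) × ℝ`; it is one-sided at `t = 0`. -/
def dt (T : ℝ) (f : ℝ → ℝ → ℝ) (t x : ℝ) : ℝ := derivWithin (fun τ => f τ x) (Ico 0 T) t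

/-- The partial derivative `f_x(t, x)`. -/
def dx (f : ℝ → ℝ → ℝ) (t x : ℝ) : ℝ := deriv (fun y => f t y) x

/-- `(u, v)` is a classical solution, on `[0, T) × ℝ`, of the Cauchy problem
`u_t - v_x = 0`, `v_t + p(u)_x = - lam / (1 + t)^mu * v`, `(u, v)(0, ·) = (u₀, v₀)`:
it is `C¹` up to `t = 0`, the specific volume `u` is positive, and the equations hold pointwise. -/
structure IsSolution (γ mu lam : ℝ) (u₀ v₀ : ℝ → ℝ) (T : ℝ) (u v : ℝ → ℝ → ℝ) : Prop where
  contDiffOn_u : ContDiffOn ℝ 1 (fun z : ℝ × ℝ => u z.1 z.2) (Ico (0 : ℝ) T ×ˢ univ)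
  contDiffOn_v : ContDiffOn ℝ 1 (fun z : ℝ × ℝ => v z.1 z.2) (Ico (0 : ℝ) T ×ˢ univ)
  pos : ∀ t ∈ Ico (0 : ℝ) T, ∀ x, 0 < u t x
  mass : ∀ t ∈ Ico (0 : ℝ) T, ∀ x, dt T u t x - dx v t x = 0
  momentum : ∀ t ∈ Ico (0 : ℝ) T, ∀ x,
    dt T v t x + dx (fun τ y => pressure γ (u τ y)) t x = -(lam / (1 + t) ^ mu) * v t x
  init_u : ∀ x, u 0 x = u₀ x
  init_v : ∀ x, v 0 x = v₀ x

/-- On `[0, T)` the sup norms of `u`, `v`, of their first partial derivatives, and of `p'(u)`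
are bounded uniformly in time. -/
def IsBoundedOn (γ T : ℝ) (u v : ℝ → ℝ → ℝ) : Prop :=
  ∃ M : ℝ, ∀ t ∈ Ico (0 : ℝ) T, ∀ x,
    |u t x| ≤ M ∧ |v t x| ≤ M ∧
    |dt T u t x| ≤ M ∧ |dt T v t x| ≤ M ∧
    |dx u t x| ≤ M ∧ |dx v t x| ≤ M ∧
    |deriv (pressure γ) (u t x)| ≤ M

/-- The lifespan `T*`: the supremum of all `T > 0` such that the solution exists on `[0, T) × ℝ`
with the norms of `IsBoundedOn` bounded there; `⊤` means that the solution is global. -/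
def lifespan (γ mu lam : ℝ) (u₀ v₀ : ℝ → ℝ) : EReal :=
  sSup {S : EReal | ∃ T : ℝ, S = (T : EReal) ∧ 0 < T ∧
    ∃ u v : ℝ → ℝ → ℝ, IsSolution γ mu lam u₀ v₀ T u v ∧ IsBoundedOn γ T u v}

end

end DampedEuler

/-! The proof works in characteristic coordinates `(ξ, β)`, where the unknowns satisfy a semilinear
system of ordinary differential equations along the two coordinate directions. Besides `u` and `t`,
the unknowns are the slopes `p = v_x + c u_x`, `q = v_x - c u_x` and the densities `N = t_ξ`, `Q =
t_β`. After truncation of the nonlinearities this system has a global solution on the whole plane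
(`exists_characteristic_solution`), so no local existence theorem and no continuation criterion is
needed. Wherever no truncation is active, the remaining equations follow from equality of mixed
derivatives (`hasDerivAt_potential_fst`, `exists_charSol`).

A priori bounds show that the truncations stay inactive up to a time `T`. The Riemann invariants `v
± eta u` do not grow, because damping acts on their mean `v`; hence `u - 1` remains of order `ε`.
The modified slope `Y = u ^ (-m) p + (a / 2) θ(u)` satisfies, along a left-going characteristic, `Y'
= -m u ^ (-m - 1) p² - (a / 2) Y + (a² / 4 + a' / 2) θ(u)`: the factor `u ^ (-m)` removes the
product `p q`, and the `θ` term removes the linear coupling with `q`. A supersolution `n` of the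
scalar Riccati inequality therefore bounds both slopes (`CharSol.slope_lt`), and the densities stay
between positive constants. The bounds obtained are strict, so the set where they hold on the whole
triangle of dependence is closed and, up to time `T`, relatively open.

On this set `(ξ, β) ↦ (t, x)` is injective and locally invertible, and it covers the strip `[0, T) ×
ℝ`; composition with its inverse is the classical solution (`CharSol.exists_isSolution`). Thus `T ≤
T*` as soon as a supersolution exists on `[0, T]` (`exists_lifespan_criterion`).

What remains is a problem about ordinary differential inequalities. With `E` growing no faster than
the integrating factor `exp (∫ a / 2)`, the quadratic term is harmless as long as `ε ∫ 1 / E` is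
small. Taking `E = 1`, `(1 + t) ^ (lam / 2)` and `1 + t` produces the three finite bounds. In the
global cases a multiple of `ε (b + t) ^ (-mu)` is a supersolution for all times, the damping term
dominating both the quadratic term and the derivative. -/

namespace DampedEuler

noncomputable section

/-! ### Weighted Picard iteration for the characteristic Cauchy problem. -/

section

/-- The exponential of a weight integrates to at most the weight divided by its rate. -/
theorem abs_integral_exp_abs_le {K : ℝ} (hK : 0 < K) (β ξ : ℝ) :
    |∫ s in (-β)..ξ, Real.exp (K * |s + β|)| ≤ Real.exp (K * |ξ + β|) / K := by
  have key : ∀ L : ℝ, 0 ≤ L → ∫ s in (0:ℝ)..L, Real.exp (K * s) ≤ Real.exp (K * L) / K := by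
    intro L hL
    rw [intervalIntegral.integral_comp_mul_left _ hK.ne', integral_exp]
    simp only [mul_zero, Real.exp_zero, smul_eq_mul]
    rw [div_eq_inv_mul]
    have : 0 < K⁻¹ := by positivity
    nlinarith
  have nn : ∀ a b : ℝ, a ≤ b → ∀ f : ℝ → ℝ, (∀ x, 0 ≤ f x) → 0 ≤ ∫ x in a..b, f x :=
    fun a b h f hf => intervalIntegral.integral_nonneg h fun x _ => hf x
  have shift : ∫ s in (-β)..ξ, Real.exp (K * |s + β|)
      = ∫ s in (0:ℝ)..(ξ + β), Real.exp (K * |s|) := by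
    rw [intervalIntegral.integral_comp_add_right (fun s => Real.exp (K * |s|)) β]
    simp
  rw [shift]
  rcases le_total 0 (ξ + β) with h | h
  · rw [abs_of_nonneg (nn _ _ h _ fun x => (Real.exp_pos _).le)]
    have : ∫ s in (0:ℝ)..(ξ + β), Real.exp (K * |s|) = ∫ s in (0:ℝ)..(ξ + β), Real.exp (K * s) := by
      refine intervalIntegral.integral_congr fun s hs => ?_
      rw [uIcc_of_le h] at hs
      simp only [abs_of_nonneg hs.1]
    rw [this, abs_of_nonneg h]
    exact key _ h
  · rw [intervalIntegral.integral_symm, abs_neg,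
      abs_of_nonneg (nn _ _ h _ fun x => (Real.exp_pos _).le), abs_of_nonpos h]
    have : ∫ s in (ξ + β)..0, Real.exp (K * |s|) = ∫ s in (0:ℝ)..(-(ξ + β)), Real.exp (K * s) := by
      rw [← neg_zero, ← intervalIntegral.integral_comp_neg (fun s => Real.exp (K * s))]
      simp only [neg_zero]
      refine intervalIntegral.integral_congr fun s hs => ?_
      rw [uIcc_of_le h] at hs
      simp only [abs_of_nonpos hs.2]
    rw [this]
    exact key _ (by linarith)

section Goursat

open BoundedContinuousFunction

variable {E₁ E₂ : Type*} [NormedAddCommGroup E₁] [NormedSpace ℝ E₁]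
  [NormedAddCommGroup E₂] [NormedSpace ℝ E₂]

theorem continuous_integral_fst {H : ℝ × ℝ → E₁} (hH : Continuous H) :
    Continuous fun z : ℝ × ℝ => ∫ s in (-z.2)..z.1, H (s, z.2) := by
  have h0 : ∀ e : ℝ × ℝ → ℝ, Continuous e →
      Continuous fun z : ℝ × ℝ => ∫ s in (0:ℝ)..e z, H (s, z.2) := fun e he =>
    intervalIntegral.continuous_parametric_intervalIntegral_of_continuous
      (f := fun (z : ℝ × ℝ) s => H (s, z.2)) (by fun_prop) he
  have : (fun z : ℝ × ℝ => ∫ s in (-z.2)..z.1, H (s, z.2)) = fun z =>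
      (∫ s in (0:ℝ)..z.1, H (s, z.2)) - ∫ s in (0:ℝ)..(-z.2), H (s, z.2) := by
    funext z
    rw [intervalIntegral.integral_interval_sub_left] <;>
    exact Continuous.intervalIntegrable (by fun_prop) _ _
  rw [this]
  exact (h0 _ continuous_fst).sub (h0 _ continuous_snd.neg)

theorem continuous_integral_snd {H : ℝ × ℝ → E₁} (hH : Continuous H) :
    Continuous fun z : ℝ × ℝ => ∫ b in (-z.1)..z.2, H (z.1, b) :=
  (continuous_integral_fst (H := fun z => H (z.2, z.1)) (by fun_prop)).comp continuous_swap

/-- One component of the weighted Picard map. -/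
theorem norm_integral_le_of_weight {K C : ℝ} (hK : 0 < K) {h : ℝ → E₁} {β ξ : ℝ}
    (hC : ∀ s, ‖h s‖ ≤ C * Real.exp (K * |s + β|)) :
    ‖∫ s in (-β)..ξ, h s‖ ≤ C / K * Real.exp (K * |ξ + β|) := by
  have hC0 : 0 ≤ C := by
    have := (norm_nonneg _).trans (hC 0)
    exact nonneg_of_mul_nonneg_left this (Real.exp_pos _)
  calc ‖∫ s in (-β)..ξ, h s‖ ≤ |∫ s in (-β)..ξ, C * Real.exp (K * |s + β|)| := by
        refine intervalIntegral.norm_integral_le_abs_of_norm_le (.of_forall fun s => hC s) ?_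
        exact Continuous.intervalIntegrable (by fun_prop) _ _
    _ = C * |∫ s in (-β)..ξ, Real.exp (K * |s + β|)| := by
        rw [intervalIntegral.integral_const_mul, abs_mul, abs_of_nonneg hC0]
    _ ≤ C * (Real.exp (K * |ξ + β|) / K) := by
        gcongr
        exact abs_integral_exp_abs_le hK β ξ
    _ = _ := by ring

/-- Global solvability of the characteristic Cauchy problem `U_ξ = F(U, V)`, `V_β = G(U, V)` with
data on the line `ξ + β = 0`, for bounded and globally Lipschitz nonlinearities. -/
theorem exists_characteristic_solution [CompleteSpace E₁] [CompleteSpace E₂]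
    {F : E₁ × E₂ → E₁} {G : E₁ × E₂ → E₂} {k : NNReal} {M : ℝ}
    (hF : LipschitzWith k F) (hG : LipschitzWith k G)
    (hFM : ∀ x, ‖F x‖ ≤ M) (hGM : ∀ x, ‖G x‖ ≤ M)
    {U₀ : ℝ → E₁} {V₀ : ℝ → E₂} (hU₀ : Continuous U₀) (hV₀ : Continuous V₀) :
    ∃ (U : ℝ × ℝ → E₁) (V : ℝ × ℝ → E₂), Continuous U ∧ Continuous V ∧
      (∀ z, U z = U₀ z.2 + ∫ s in (-z.2)..z.1, F (U (s, z.2), V (s, z.2))) ∧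
      (∀ z, V z = V₀ z.1 + ∫ b in (-z.1)..z.2, G (U (z.1, b), V (z.1, b))) := by
  -- Integration against the weight `exp (K |ξ + β|)` gains a factor `1 / K`. This value makes the
  -- contraction constant `k / K` at most `1 / 2` and also gives `1 ≤ K`, so that the bound `M` is
  -- preserved.
  set K : ℝ := 2 * (k + 1) with hKdef
  have hK : 0 < K := by positivity
  have hK1 : 1 ≤ K := by rw [hKdef]; nlinarith [k.coe_nonneg]
  have hM0 : 0 ≤ M := (norm_nonneg _).trans (hFM 0)
  let wt : ℝ × ℝ → ℝ := fun z => Real.exp (K * |z.1 + z.2|)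
  have hwt : Continuous wt := by fun_prop
  have hwt0 : ∀ z, 0 < wt z := fun z => Real.exp_pos _
  -- The iteration acts on the deviation from the data divided by the weight. This quotient is
  -- bounded even if the data are not, because the nonlinearities are.
  let W : ((ℝ × ℝ) →ᵇ (E₁ × E₂)) → ℝ × ℝ → E₁ × E₂ := fun f z => (U₀ z.2, V₀ z.1) + wt z • f z
  have hW : ∀ f, Continuous (W f) := fun f => by
    have := f.continuous
    fun_prop
  have hWd : ∀ f g z, ‖W f z - W g z‖ ≤ dist f g * wt z := by
    intro f g z
    have : W f z - W g z = wt z • (f z - g z) := by simp only [W, smul_sub]; abel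
    rw [this, norm_smul, Real.norm_eq_abs, abs_of_pos (hwt0 z), mul_comm, ← dist_eq_norm]
    gcongr
    exact dist_coe_le_dist z
  let I₁ : ((ℝ × ℝ) →ᵇ (E₁ × E₂)) → ℝ × ℝ → E₁ := fun f z => ∫ s in (-z.2)..z.1, F (W f (s, z.2))
  let I₂ : ((ℝ × ℝ) →ᵇ (E₁ × E₂)) → ℝ × ℝ → E₂ := fun f z => ∫ b in (-z.1)..z.2, G (W f (z.1, b))
  have hI₁ : ∀ f, Continuous (I₁ f) := fun f =>
    continuous_integral_fst (H := fun z => F (W f z)) (hF.continuous.comp (hW f))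
  have hI₂ : ∀ f, Continuous (I₂ f) := fun f =>
    continuous_integral_snd (H := fun z => G (W f z)) (hG.continuous.comp (hW f))
  have one_le : ∀ x : ℝ, 1 ≤ Real.exp (K * |x|) := fun x => Real.one_le_exp (by positivity)
  have bI₁ : ∀ f z, ‖I₁ f z‖ ≤ M * wt z := by
    intro f z
    refine (norm_integral_le_of_weight hK (C := M) fun s => ?_).trans ?_
    · exact (hFM _).trans (le_mul_of_one_le_right hM0 (one_le _))
    · exact mul_le_mul_of_nonneg_right (div_le_self hM0 hK1) (hwt0 z).le
  have bI₂ : ∀ f z, ‖I₂ f z‖ ≤ M * wt z := by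
    intro f z
    refine (norm_integral_le_of_weight hK (C := M) fun s => ?_).trans ?_
    · exact (hGM _).trans (le_mul_of_one_le_right hM0 (one_le _))
    · rw [add_comm z.2 z.1]
      exact mul_le_mul_of_nonneg_right (div_le_self hM0 hK1) (hwt0 z).le
  have kK : ∀ d : ℝ, 0 ≤ d → (k * d) / K ≤ d / 2 := by
    intro d hd
    rw [div_le_div_iff₀ hK two_pos, hKdef]
    nlinarith [k.coe_nonneg]
  have dI₁ : ∀ f g z, ‖I₁ f z - I₁ g z‖ ≤ dist f g / 2 * wt z := by
    intro f g z
    have c : ∀ f, Continuous fun s => F (W f (s, z.2)) := fun f =>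
      hF.continuous.comp ((hW f).comp (by fun_prop))
    have : I₁ f z - I₁ g z = ∫ s in (-z.2)..z.1, (F (W f (s, z.2)) - F (W g (s, z.2))) :=
      (intervalIntegral.integral_sub ((c f).intervalIntegrable _ _)
        ((c g).intervalIntegrable _ _)).symm
    rw [this]
    refine (norm_integral_le_of_weight hK (C := k * dist f g) fun s => ?_).trans ?_
    · refine (hF.norm_sub_le _ _).trans ?_
      rw [mul_assoc]
      exact mul_le_mul_of_nonneg_left (hWd f g (s, z.2)) k.coe_nonneg
    · exact mul_le_mul_of_nonneg_right (kK _ dist_nonneg) (hwt0 z).le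
  have dI₂ : ∀ f g z, ‖I₂ f z - I₂ g z‖ ≤ dist f g / 2 * wt z := by
    intro f g z
    have c : ∀ f, Continuous fun b => G (W f (z.1, b)) := fun f =>
      hG.continuous.comp ((hW f).comp (by fun_prop))
    have : I₂ f z - I₂ g z = ∫ b in (-z.1)..z.2, (G (W f (z.1, b)) - G (W g (z.1, b))) :=
      (intervalIntegral.integral_sub ((c f).intervalIntegrable _ _)
        ((c g).intervalIntegrable _ _)).symm
    rw [this]
    refine (norm_integral_le_of_weight hK (C := k * dist f g) fun s => ?_).trans ?_
    · refine (hG.norm_sub_le _ _).trans ?_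
      rw [mul_assoc, add_comm s]
      exact mul_le_mul_of_nonneg_left (hWd f g (z.1, s)) k.coe_nonneg
    · rw [add_comm z.2 z.1]
      exact mul_le_mul_of_nonneg_right (kK _ dist_nonneg) (hwt0 z).le
  let T : ((ℝ × ℝ) →ᵇ (E₁ × E₂)) → ((ℝ × ℝ) →ᵇ (E₁ × E₂)) := fun f =>
    ofNormedAddCommGroup (fun z => (wt z)⁻¹ • (I₁ f z, I₂ f z))
      ((hwt.inv₀ fun z => (hwt0 z).ne').smul ((hI₁ f).prodMk (hI₂ f))) M (by
        intro z
        rw [norm_smul, norm_inv, Real.norm_eq_abs, abs_of_pos (hwt0 z),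
          inv_mul_le_iff₀ (hwt0 z), mul_comm]
        exact max_le (bI₁ f z) (bI₂ f z))
  have hT : ContractingWith (1 / 2) T := by
    refine ⟨by norm_num, LipschitzWith.of_dist_le_mul fun f g => ?_⟩
    rw [dist_le (by positivity)]
    intro z
    have : T f z - T g z = (wt z)⁻¹ • (I₁ f z - I₁ g z, I₂ f z - I₂ g z) := by
      simp only [T, coe_ofNormedAddCommGroup, ← smul_sub, Prod.mk_sub_mk]
    rw [dist_eq_norm, this, norm_smul, norm_inv, Real.norm_eq_abs, abs_of_pos (hwt0 z),
      inv_mul_le_iff₀ (hwt0 z)]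
    refine max_le ((dI₁ f g z).trans (le_of_eq ?_)) ((dI₂ f g z).trans (le_of_eq ?_)) <;>
    · push_cast
      ring
  obtain ⟨f, hf⟩ : ∃ f, T f = f := ⟨hT.fixedPoint T, hT.fixedPoint_isFixedPt⟩
  have hfix : ∀ z, wt z • f z = (I₁ f z, I₂ f z) := by
    intro z
    conv_lhs => rw [← hf]
    simp only [T, coe_ofNormedAddCommGroup]
    rw [smul_smul, mul_inv_cancel₀ (hwt0 z).ne', one_smul]
  refine ⟨fun z => (W f z).1, fun z => (W f z).2, (hW f).fst, (hW f).snd, fun z => ?_, fun z => ?_⟩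
  · have : (W f z).1 = U₀ z.2 + I₁ f z := by simp only [W, hfix, Prod.fst_add]
    exact this
  · have : (W f z).2 = V₀ z.1 + I₂ f z := by simp only [W, hfix, Prod.snd_add]
    exact this

end Goursat

end

/-! ### Potentials of closed forms in the characteristic plane. -/

section

/-- An open set of the characteristic plane containing, with each point, the segment that joins it
to the line `ξ + β = 0` in the direction of `β`. -/
structure IsSegmentDomain (D : Set (ℝ × ℝ)) : Prop where
  isOpen : IsOpen D
  segment : ∀ ξ β, (ξ, β) ∈ D → ∀ b ∈ uIcc (-ξ) β, (ξ, b) ∈ D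

/-- The interval shrinks to a point as `s → ξ`, so the dependence of the integrand on `s`
contributes only to second order: continuity of `A` at the limit point suffices, and no derivative
of `A` is needed. -/
theorem hasDerivAt_integral_moving_left {A : ℝ × ℝ → ℝ} (hA : Continuous A) (ξ : ℝ) :
    HasDerivAt (fun s => ∫ b in (-s)..(-ξ), A (s, b)) (A (ξ, -ξ)) ξ := by
  rw [hasDerivAt_iff_isLittleO, Asymptotics.isLittleO_iff]
  intro ε hε
  obtain ⟨δ, hδ, h⟩ := Metric.continuousAt_iff.1 (hA.continuousAt (x := (ξ, -ξ))) ε hε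
  filter_upwards [Metric.ball_mem_nhds ξ hδ] with s hs
  rw [Metric.mem_ball, Real.dist_eq] at hs
  have hb : ∀ b ∈ uIoc (-s) (-ξ), ‖A (s, b) - A (ξ, -ξ)‖ ≤ ε := by
    intro b hb
    have hb' : |b + ξ| ≤ |s - ξ| := by
      have := abs_sub_left_of_mem_uIcc (uIoc_subset_uIcc (uIoc_comm (-s) (-ξ) ▸ hb))
      rwa [show b - -ξ = b + ξ by ring, show -s - -ξ = -(s - ξ) by ring, abs_neg] at this
    rw [← dist_eq_norm]
    refine (h ?_).le
    rw [Prod.dist_eq, Real.dist_eq, Real.dist_eq, sub_neg_eq_add]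
    exact max_lt hs (hb'.trans_lt hs)
  have hI : (∫ b in (-s)..(-ξ), A (s, b)) - (∫ b in (-ξ)..(-ξ), A (ξ, b)) - (s - ξ) • A (ξ, -ξ)
      = ∫ b in (-s)..(-ξ), (A (s, b) - A (ξ, -ξ)) := by
    rw [intervalIntegral.integral_sub (Continuous.intervalIntegrable (by fun_prop) _ _)
      (Continuous.intervalIntegrable (by fun_prop) _ _), intervalIntegral.integral_same,
      intervalIntegral.integral_const]
    simp only [smul_eq_mul]
    ring
  rw [hI]
  refine (intervalIntegral.norm_integral_le_of_norm_le_const hb).trans_eq ?_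
  rw [Real.norm_eq_abs, show -ξ - -s = s - ξ by ring]

/-- The function with given datum on `ξ + β = 0` and given derivative `A` in the direction `β`. -/
def potential (f₀ : ℝ → ℝ) (A : ℝ × ℝ → ℝ) (z : ℝ × ℝ) : ℝ :=
  f₀ (-z.1) + ∫ b in (-z.1)..z.2, A (z.1, b)

theorem continuous_potential {f₀ : ℝ → ℝ} {A : ℝ × ℝ → ℝ} (hf₀ : Continuous f₀)
    (hA : Continuous A) : Continuous (potential f₀ A) :=
  (hf₀.comp continuous_fst.neg).add (continuous_integral_snd hA)

theorem potential_diag (f₀ : ℝ → ℝ) (A : ℝ × ℝ → ℝ) (x : ℝ) : potential f₀ A (-x, x) = f₀ x := by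
  simp [potential]

theorem hasDerivAt_integral_right {E : Type*} [NormedAddCommGroup E] [NormedSpace ℝ E]
    [CompleteSpace E] {h : ℝ → E} (hh : Continuous h) (e : E) (a b : ℝ) :
    HasDerivAt (fun s => e + ∫ x in a..s, h x) (h b) b :=
  (intervalIntegral.integral_hasDerivAt_right (hh.intervalIntegrable _ _)
    (hh.stronglyMeasurableAtFilter _ _) hh.continuousAt).const_add e

theorem hasDerivAt_potential_snd (f₀ : ℝ → ℝ) {A : ℝ × ℝ → ℝ} (hA : Continuous A) (ξ β : ℝ) :
    HasDerivAt (fun b => potential f₀ A (ξ, b)) (A (ξ, β)) β :=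
  hasDerivAt_integral_right (h := fun b => A (ξ, b)) (by fun_prop) (f₀ (-ξ)) (-ξ) β

/-- If `A_ξ = B_β`, then the function with `β`-derivative `A` has `ξ`-derivative `B`, provided that
this is so along the line `ξ + β = 0`. -/
theorem hasDerivAt_potential_fst {D : Set (ℝ × ℝ)} (hD : IsSegmentDomain D) {f₀ : ℝ → ℝ}
    {A B H : ℝ × ℝ → ℝ} (hA : Continuous A) (hH : Continuous H)
    (hf₀ : ∀ x, HasDerivAt f₀ (A (-x, x) - B (-x, x)) x)
    (hAH : ∀ ξ β, (ξ, β) ∈ D → HasDerivAt (fun s => A (s, β)) (H (ξ, β)) ξ)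
    (hBH : ∀ ξ β, (ξ, β) ∈ D → HasDerivAt (fun b => B (ξ, b)) (H (ξ, β)) β)
    {ξ β : ℝ} (h : (ξ, β) ∈ D) :
    HasDerivAt (fun s => potential f₀ A (s, β)) (B (ξ, β)) ξ := by
  -- Differentiation under the integral needs the derivative of `A` on full segments for all nearby
  -- `s`; compactness of the segment provides a tube inside `D`.
  have htube : ∀ᶠ s in 𝓝 ξ, ∀ b ∈ uIcc (-ξ) β, (s, b) ∈ D := by
    refine isCompact_uIcc.eventually_forall_of_forall_eventually fun b hb => ?_
    exact hD.isOpen.mem_nhds (hD.segment ξ β h b hb)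
  obtain ⟨δ, hδ, hball⟩ := Metric.eventually_nhds_iff_ball.1 htube
  obtain ⟨C, hC⟩ := ((isCompact_closedBall ξ δ).prod (isCompact_uIcc (a := -ξ) (b := β))).exists_bound_of_continuousOn
    hH.continuousOn
  have h1 : HasDerivAt (fun s => ∫ b in (-ξ)..β, A (s, b)) (∫ b in (-ξ)..β, H (ξ, b)) ξ := by
    refine (intervalIntegral.hasDerivAt_integral_of_dominated_loc_of_deriv_le
      (F' := fun s b => H (s, b)) (bound := fun _ => C) (Metric.ball_mem_nhds ξ hδ)
      (.of_forall fun s => Continuous.aestronglyMeasurable (by fun_prop))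
      (Continuous.intervalIntegrable (by fun_prop) _ _)
      (Continuous.aestronglyMeasurable (by fun_prop))
      (.of_forall fun b hb s hs => ?_) (Continuous.intervalIntegrable (by fun_prop) _ _)
      (.of_forall fun b hb s hs => ?_)).2
    · exact hC (s, b) ⟨Metric.ball_subset_closedBall hs, uIoc_subset_uIcc hb⟩
    · exact hAH s b (hball s hs b (uIoc_subset_uIcc hb))
  have h2 : ∫ b in (-ξ)..β, H (ξ, b) = B (ξ, β) - B (ξ, -ξ) :=
    intervalIntegral.integral_eq_sub_of_hasDerivAt
      (fun b hb => hBH ξ b (hD.segment ξ β h b hb))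
      (Continuous.intervalIntegrable (by fun_prop) _ _)
  have h3 := hasDerivAt_integral_moving_left hA ξ
  have h4 : HasDerivAt (fun s => f₀ (-s)) (-(A (ξ, -ξ) - B (ξ, -ξ))) ξ := by
    have := (hf₀ (-ξ)).comp ξ (hasDerivAt_neg ξ)
    simpa [Function.comp_def] using this
  -- Cutting at the frozen endpoint `-ξ` separates the moving endpoint from the differentiation
  -- under the integral. The boundary terms then cancel against the derivative of the datum and
  -- leave `B (ξ, β)`.
  have h5 : (fun s => potential f₀ A (s, β)) = fun s =>
      f₀ (-s) + ((∫ b in (-s)..(-ξ), A (s, b)) + ∫ b in (-ξ)..β, A (s, b)) := by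
    funext s
    rw [intervalIntegral.integral_add_adjacent_intervals] <;>
    first | rfl | exact Continuous.intervalIntegrable (by fun_prop) _ _
  rw [h5]
  refine (h4.add (h3.add h1)).congr_deriv ?_
  rw [h2]
  ring

/-- The continuous linear form `(h, k) ↦ a h + b k` on the plane. -/
def planeForm (a b : ℝ) : ℝ × ℝ →L[ℝ] ℝ :=
  a • ContinuousLinearMap.fst ℝ ℝ ℝ + b • ContinuousLinearMap.snd ℝ ℝ ℝ

@[simp] theorem planeForm_apply (a b : ℝ) (z : ℝ × ℝ) : planeForm a b z = a * z.1 + b * z.2 := by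
  simp [planeForm]

/-- Continuity of the partial derivatives upgrades them to a strict derivative, the form required by
the inverse function theorem. -/
theorem hasStrictFDerivAt_of_partials {D : Set (ℝ × ℝ)} (hD : IsOpen D) {f A B : ℝ × ℝ → ℝ}
    (hA : Continuous A) (hB : Continuous B)
    (h1 : ∀ ξ β, (ξ, β) ∈ D → HasDerivAt (fun s => f (s, β)) (B (ξ, β)) ξ)
    (h2 : ∀ ξ β, (ξ, β) ∈ D → HasDerivAt (fun b => f (ξ, b)) (A (ξ, β)) β)
    {z : ℝ × ℝ} (hz : z ∈ D) : HasStrictFDerivAt f (planeForm (B z) (A z)) z := by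
  have key := hasStrictFDerivAt_uncurry_coprod (𝕜 := ℝ) (u := z) (f := fun a b => f (a, b))
    (f₁ := fun a b => ContinuousLinearMap.toSpanSingleton ℝ (B (a, b)))
    (f₂ := fun a b => ContinuousLinearMap.toSpanSingleton ℝ (A (a, b)))
    (by filter_upwards [hD.mem_nhds hz] with v hv
        exact (h1 v.1 v.2 hv).hasFDerivAt)
    (by filter_upwards [hD.mem_nhds hz] with v hv
        exact (h2 v.1 v.2 hv).hasFDerivAt)
    (by
      refine Continuous.continuousAt ?_
      exact (ContinuousLinearMap.toSpanSingletonCLE (𝕜 := ℝ) (E := ℝ)).continuous.comp hB)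
    (by
      refine Continuous.continuousAt ?_
      exact (ContinuousLinearMap.toSpanSingletonCLE (𝕜 := ℝ) (E := ℝ)).continuous.comp hA)
  have hL : planeForm (B z) (A z) = (ContinuousLinearMap.toSpanSingleton ℝ (B z)).coprod
      (ContinuousLinearMap.toSpanSingleton ℝ (A z)) := by
    ext <;> simp
  rw [hL]
  exact key

end

/-! ### Truncated nonlinearities and the system in characteristic coordinates. -/

section

section BoundedLipschitz

/-- Truncation of a real number to the interval `[l, h]`. -/
def clip (l h x : ℝ) : ℝ := max l (min h x)

theorem continuous_clip (l h : ℝ) : Continuous (clip l h) :=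
  continuous_const.max (continuous_const.min continuous_id)

theorem lipschitzWith_clip (l h : ℝ) : LipschitzWith 1 (clip l h) :=
  (LipschitzWith.id.const_min h).const_max l

theorem le_clip (l h x : ℝ) : l ≤ clip l h x := le_max_left _ _

theorem clip_le {l h : ℝ} (hlh : l ≤ h) (x : ℝ) : clip l h x ≤ h := max_le hlh (min_le_left _ _)

theorem clip_of_mem {l h x : ℝ} (h1 : l ≤ x) (h2 : x ≤ h) : clip l h x = x := by
  rw [clip, min_eq_right h2, max_eq_right h1]

theorem clip_eq_of_mem_Ioo {l h x : ℝ} (hx : clip l h x ∈ Ioo l h) : clip l h x = x := by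
  have h1 := lt_max_iff.1 hx.1
  have h1' : l < min h x := h1.resolve_left (lt_irrefl _)
  have h2 : min h x < h := (le_max_right _ _).trans_lt hx.2
  have h2' : x < h := (min_lt_iff.1 h2).resolve_left (lt_irrefl _)
  exact clip_of_mem (h1'.trans_le (min_le_right _ _)).le h2'.le

/-- A truncated value strictly inside the interval forces the truncation to be inactive at nearby
points as well, by continuity. -/
theorem HasDerivAt.clip {f : ℝ → ℝ} {f' s l h : ℝ} (hf : HasDerivAt f f' s)
    (hs : clip l h (f s) ∈ Ioo l h) : HasDerivAt (fun x => clip l h (f x)) f' s := by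
  have hc : ContinuousAt (fun x => DampedEuler.clip l h (f x)) s :=
    (continuous_clip l h).continuousAt.comp hf.continuousAt
  refine hf.congr_of_eventuallyEq ?_
  filter_upwards [hc.eventually (Ioo_mem_nhds hs.1 hs.2)] with x hx
  exact clip_eq_of_mem_Ioo hx

/-- Bounded and globally Lipschitz real functions. -/
def BddLip {α : Type*} [PseudoMetricSpace α] (f : α → ℝ) : Prop :=
  (∃ K, LipschitzWith K f) ∧ ∃ M, ∀ x, |f x| ≤ M

variable {α : Type*} [PseudoMetricSpace α] {f g : α → ℝ}

theorem BddLip.neg (hf : BddLip f) : BddLip fun x => -f x := by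
  obtain ⟨⟨K, hK⟩, M, hM⟩ := hf
  exact ⟨⟨K, hK.neg⟩, M, fun x => by rw [abs_neg]; exact hM x⟩

theorem BddLip.add (hf : BddLip f) (hg : BddLip g) : BddLip fun x => f x + g x := by
  obtain ⟨⟨K, hK⟩, M, hM⟩ := hf
  obtain ⟨⟨K', hK'⟩, M', hM'⟩ := hg
  exact ⟨⟨_, hK.add hK'⟩, M + M', fun x => (abs_add_le _ _).trans (add_le_add (hM x) (hM' x))⟩

theorem BddLip.sub (hf : BddLip f) (hg : BddLip g) : BddLip fun x => f x - g x := by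
  simpa only [sub_eq_add_neg] using hf.add hg.neg

theorem BddLip.mul (hf : BddLip f) (hg : BddLip g) : BddLip fun x => f x * g x := by
  obtain ⟨⟨K, hK⟩, M, hM⟩ := hf
  obtain ⟨⟨K', hK'⟩, M', hM'⟩ := hg
  have hM0 : ∀ x : α, 0 ≤ M := fun x => (abs_nonneg _).trans (hM x)
  have hM0' : ∀ x : α, 0 ≤ M' := fun x => (abs_nonneg _).trans (hM' x)
  refine ⟨⟨M.toNNReal * K' + M'.toNNReal * K, LipschitzWith.of_dist_le_mul fun x y => ?_⟩, M * M',
    fun x => ?_⟩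
  · have h1 := hK.dist_le_mul x y
    have h2 := hK'.dist_le_mul x y
    rw [Real.dist_eq] at h1 h2 ⊢
    have e : f x * g x - f y * g y = f x * (g x - g y) + g y * (f x - f y) := by ring
    rw [e]
    refine (abs_add_le _ _).trans ?_
    rw [abs_mul, abs_mul]
    push_cast
    rw [Real.coe_toNNReal _ (hM0 x), Real.coe_toNNReal _ (hM0' x), add_mul, mul_assoc, mul_assoc]
    gcongr
    · exact hM0 x
    · exact hM x
    · exact hM0' x
    · exact hM' y
  · rw [abs_mul]
    exact mul_le_mul (hM x) (hM' x) (abs_nonneg _) (hM0 x)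

theorem BddLip.const (r : ℝ) : BddLip fun _ : α => r :=
  ⟨⟨0, LipschitzWith.const r⟩, |r|, fun _ => le_rfl⟩

theorem BddLip.clip {l h : ℝ} (hlh : l ≤ h) {K : NNReal} (hf : LipschitzWith K f) :
    BddLip fun x => clip l h (f x) := by
  refine ⟨⟨_, (lipschitzWith_clip l h).comp hf⟩, max |l| |h|, fun x => ?_⟩
  exact abs_le_max_abs_abs (le_clip _ _ _) (clip_le hlh _)

theorem BddLip.inv_clip {l h : ℝ} (hl : 0 < l) {K : NNReal} (hf : LipschitzWith K f) :
    BddLip fun x => (DampedEuler.clip l h (f x))⁻¹ := by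
  have hpos : ∀ x, 0 < DampedEuler.clip l h x := fun x => hl.trans_le (le_clip _ _ _)
  have hinv : LipschitzWith (l⁻¹ * l⁻¹).toNNReal fun x : ℝ => (DampedEuler.clip l h x)⁻¹ := by
    refine LipschitzWith.of_dist_le_mul fun x y => ?_
    have h1 := (lipschitzWith_clip l h).dist_le_mul x y
    rw [Real.coe_toNNReal _ (by positivity)]
    simp only [NNReal.coe_one, one_mul, Real.dist_eq] at h1 ⊢
    have hx := hpos x
    have hy := hpos y
    rw [inv_sub_inv hx.ne' hy.ne', abs_div, abs_of_pos (mul_pos hx hy), abs_sub_comm,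
      div_eq_inv_mul, mul_inv]
    have hx' := inv_anti₀ hl (le_clip l h x)
    have hy' := inv_anti₀ hl (le_clip l h y)
    have := inv_pos.2 hx
    have := inv_pos.2 hy
    gcongr
  refine ⟨⟨_, hinv.comp hf⟩, l⁻¹, fun x => ?_⟩
  rw [abs_inv, abs_of_pos (hpos _)]
  exact inv_anti₀ hl (le_clip _ _ _)

end BoundedLipschitz

/-- The speed of sound in terms of the specific volume, `c(u) = u ^ (-2m)` with `m = (γ + 1) / 4`. -/
def speed (m u : ℝ) : ℝ := u ^ (-(2 * m))

theorem speed_pos (m : ℝ) {u : ℝ} (hu : 0 < u) : 0 < speed m u := Real.rpow_pos_of_pos hu _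

theorem hasDerivAt_speed (m : ℝ) {u : ℝ} (hu : 0 < u) :
    HasDerivAt (speed m) (2 * (-m / u) * speed m u) u := by
  refine (Real.hasDerivAt_rpow_const (p := -(2 * m)) (Or.inl hu.ne')).congr_deriv ?_
  rw [Real.rpow_sub_one hu.ne', speed]
  field_simp

/-- Solutions of the damped Euler equations in characteristic coordinates, on a region `D`.
The coordinates `(ξ, β)` label the right-going characteristic issuing from `x = -ξ` and the
left-going one issuing from `x = β`; `p` and `q` stand for the `x`-derivatives of the Riemann
invariants, `N = t_ξ`, `Q = t_β`. -/
structure CharSol (m : ℝ) (a u₀ v₀ p₀ q₀ : ℝ → ℝ) (D : Set (ℝ × ℝ)) where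
  (p q N Q u t X v : ℝ × ℝ → ℝ)
  cont_p : Continuous p
  cont_q : Continuous q
  cont_N : Continuous N
  cont_Q : Continuous Q
  cont_u : Continuous u
  cont_t : Continuous t
  cont_X : Continuous X
  cont_v : Continuous v
  u_pos : ∀ z, 0 < u z
  p_diag : ∀ x, p (-x, x) = p₀ x
  q_diag : ∀ x, q (-x, x) = q₀ x
  N_diag : ∀ x, N (-x, x) = 1 / (2 * speed m (u₀ x))
  Q_diag : ∀ x, Q (-x, x) = 1 / (2 * speed m (u₀ x))
  u_diag : ∀ x, u (-x, x) = u₀ x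
  t_diag : ∀ x, t (-x, x) = 0
  X_diag : ∀ x, X (-x, x) = x
  v_diag : ∀ x, v (-x, x) = v₀ x
  p_fst : ∀ ξ β, (ξ, β) ∈ D → HasDerivAt (fun s => p (s, β))
    (N (ξ, β) * (-m / u (ξ, β) * (p (ξ, β) ^ 2 - p (ξ, β) * q (ξ, β))
      - a (t (ξ, β)) / 2 * (p (ξ, β) + q (ξ, β)))) ξ
  q_snd : ∀ ξ β, (ξ, β) ∈ D → HasDerivAt (fun s => q (ξ, s))
    (Q (ξ, β) * (-m / u (ξ, β) * (q (ξ, β) ^ 2 - p (ξ, β) * q (ξ, β))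
      - a (t (ξ, β)) / 2 * (p (ξ, β) + q (ξ, β)))) β
  Q_fst : ∀ ξ β, (ξ, β) ∈ D → HasDerivAt (fun s => Q (s, β))
    (m / u (ξ, β) * (p (ξ, β) + q (ξ, β)) * N (ξ, β) * Q (ξ, β)) ξ
  N_snd : ∀ ξ β, (ξ, β) ∈ D → HasDerivAt (fun s => N (ξ, s))
    (m / u (ξ, β) * (p (ξ, β) + q (ξ, β)) * N (ξ, β) * Q (ξ, β)) β
  u_fst : ∀ ξ β, (ξ, β) ∈ D → HasDerivAt (fun s => u (s, β)) (q (ξ, β) * N (ξ, β)) ξ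
  u_snd : ∀ ξ β, (ξ, β) ∈ D → HasDerivAt (fun s => u (ξ, s)) (p (ξ, β) * Q (ξ, β)) β
  t_fst : ∀ ξ β, (ξ, β) ∈ D → HasDerivAt (fun s => t (s, β)) (N (ξ, β)) ξ
  t_snd : ∀ ξ β, (ξ, β) ∈ D → HasDerivAt (fun s => t (ξ, s)) (Q (ξ, β)) β
  X_fst : ∀ ξ β, (ξ, β) ∈ D →
    HasDerivAt (fun s => X (s, β)) (-(speed m (u (ξ, β)) * N (ξ, β))) ξ
  X_snd : ∀ ξ β, (ξ, β) ∈ D → HasDerivAt (fun s => X (ξ, s)) (speed m (u (ξ, β)) * Q (ξ, β)) β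
  v_fst : ∀ ξ β, (ξ, β) ∈ D → HasDerivAt (fun s => v (s, β))
    (-(a (t (ξ, β)) * v (ξ, β) * N (ξ, β)) - speed m (u (ξ, β)) * q (ξ, β) * N (ξ, β)) ξ
  v_snd : ∀ ξ β, (ξ, β) ∈ D → HasDerivAt (fun s => v (ξ, s))
    (-(a (t (ξ, β)) * v (ξ, β) * Q (ξ, β)) + speed m (u (ξ, β)) * p (ξ, β) * Q (ξ, β)) β

/-- The reflection `x ↦ -x` exchanges the two families of characteristics. -/
def CharSol.swap {m : ℝ} {a u₀ v₀ p₀ q₀ : ℝ → ℝ} {D : Set (ℝ × ℝ)}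
    (S : CharSol m a u₀ v₀ p₀ q₀ D) :
    CharSol m a (fun x => u₀ (-x)) (fun x => -v₀ (-x)) (fun x => q₀ (-x)) (fun x => p₀ (-x))
      (Prod.swap ⁻¹' D) where
  p z := S.q z.swap
  q z := S.p z.swap
  N z := S.Q z.swap
  Q z := S.N z.swap
  u z := S.u z.swap
  t z := S.t z.swap
  X z := -S.X z.swap
  v z := -S.v z.swap
  cont_p := S.cont_q.comp continuous_swap
  cont_q := S.cont_p.comp continuous_swap
  cont_N := S.cont_Q.comp continuous_swap
  cont_Q := S.cont_N.comp continuous_swap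
  cont_u := S.cont_u.comp continuous_swap
  cont_t := S.cont_t.comp continuous_swap
  cont_X := (S.cont_X.comp continuous_swap).neg
  cont_v := (S.cont_v.comp continuous_swap).neg
  u_pos z := S.u_pos z.swap
  p_diag x := by simpa using S.q_diag (-x)
  q_diag x := by simpa using S.p_diag (-x)
  N_diag x := by simpa using S.Q_diag (-x)
  Q_diag x := by simpa using S.N_diag (-x)
  u_diag x := by simpa using S.u_diag (-x)
  t_diag x := by simpa using S.t_diag (-x)
  X_diag x := by simpa using congrArg Neg.neg (S.X_diag (-x))
  v_diag x := by simpa using congrArg Neg.neg (S.v_diag (-x))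
  p_fst ξ β h := (S.q_snd β ξ h).congr_deriv (by simp only [Prod.swap_prod_mk]; ring)
  q_snd ξ β h := (S.p_fst β ξ h).congr_deriv (by simp only [Prod.swap_prod_mk]; ring)
  Q_fst ξ β h := (S.N_snd β ξ h).congr_deriv (by simp only [Prod.swap_prod_mk]; ring)
  N_snd ξ β h := (S.Q_fst β ξ h).congr_deriv (by simp only [Prod.swap_prod_mk]; ring)
  u_fst ξ β h := S.u_snd β ξ h
  u_snd ξ β h := S.u_fst β ξ h
  t_fst ξ β h := S.t_snd β ξ h
  t_snd ξ β h := S.t_fst β ξ h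
  X_fst ξ β h := (S.X_snd β ξ h).neg
  X_snd ξ β h := (S.X_fst β ξ h).neg.congr_deriv (by simp only [Prod.swap_prod_mk]; ring)
  v_fst ξ β h := (S.v_snd β ξ h).neg.congr_deriv (by simp only [Prod.swap_prod_mk]; ring)
  v_snd ξ β h := (S.v_fst β ξ h).neg.congr_deriv (by simp only [Prod.swap_prod_mk]; ring)

end

/-! ### Segment domains and global solution of the truncated system. -/

section

/-- The points whose segment to the line `ξ + β = 0` in the direction of `β` lies in `O`. -/
def segmentDomain (O : Set (ℝ × ℝ)) : Set (ℝ × ℝ) :=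
  {z | ∀ k ∈ Icc (0:ℝ) 1, (z.1, -z.1 + k * (z.1 + z.2)) ∈ O}

theorem segmentDomain_subset (O : Set (ℝ × ℝ)) : segmentDomain O ⊆ O := by
  intro z hz
  have := hz 1 (by simp)
  rwa [one_mul, neg_add_cancel_left] at this

theorem mem_segmentDomain_of_forall {O : Set (ℝ × ℝ)} {z : ℝ × ℝ}
    (h : ∀ b ∈ uIcc (-z.1) z.2, (z.1, b) ∈ O) : z ∈ segmentDomain O := by
  intro k hk
  refine h _ ?_
  rcases le_total (-z.1) z.2 with hz | hz
  · rw [uIcc_of_le hz]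
    constructor <;> nlinarith [hk.1, hk.2]
  · rw [uIcc_of_ge hz]
    constructor <;> nlinarith [hk.1, hk.2]

/-- Openness is the tube lemma for the parameter interval `[0, 1]`; a segment of a segment is
obtained by multiplying the two parameters. -/
theorem isSegmentDomain_segmentDomain {O : Set (ℝ × ℝ)} (hO : IsOpen O) :
    IsSegmentDomain (segmentDomain O) where
  isOpen := by
    rw [isOpen_iff_mem_nhds]
    intro z hz
    refine isCompact_Icc.eventually_forall_of_forall_eventually (x₀ := z)
      (P := fun z k => (z.1, -z.1 + k * (z.1 + z.2)) ∈ O) fun k hk => ?_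
    have hc : Continuous fun w : (ℝ × ℝ) × ℝ => (w.1.1, -w.1.1 + w.2 * (w.1.1 + w.1.2)) := by
      fun_prop
    exact hc.continuousAt.eventually (hO.mem_nhds (hz k hk))
  segment := by
    intro ξ β h b hb k hk
    obtain ⟨j, hj, rfl⟩ : ∃ j ∈ Icc (0:ℝ) 1, -ξ + j * (ξ + β) = b := by
      rw [← segment_eq_uIcc, segment_eq_image'] at hb
      obtain ⟨j, hj, rfl⟩ := hb
      exact ⟨j, hj, by simp only [smul_eq_mul]; ring⟩
    have := h (k * j) ⟨mul_nonneg hk.1 hj.1, mul_le_one₀ hk.2 hj.1 hj.2⟩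
    simp only at this ⊢
    rwa [show -ξ + k * (ξ + (-ξ + j * (ξ + β))) = -ξ + k * j * (ξ + β) by ring]

/-- The values for which no truncation is active. -/
def Untruncated (B p q N Q u : ℝ) : Prop :=
  p ∈ Ioo (-2) 2 ∧ q ∈ Ioo (-2) 2 ∧ N ∈ Ioo (-B) B ∧ Q ∈ Ioo (-B) B ∧ u ∈ Ioo (1 / 4) 4

theorem lipschitzWith_prodMk_max {α β γ : Type*} [PseudoEMetricSpace α] [PseudoEMetricSpace β]
    [PseudoEMetricSpace γ] {f : α → β} {g : α → γ} (hf : ∃ K, LipschitzWith K f)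
    (hg : ∃ K, LipschitzWith K g) : ∃ K, LipschitzWith K fun x => (f x, g x) := by
  obtain ⟨_, hf⟩ := hf
  obtain ⟨_, hg⟩ := hg
  exact ⟨_, hf.prodMk hg⟩

/-- Of the overdetermined system only one equation per unknown is imposed: `p` and `Q` are
propagated in `ξ`, and `q`, `N`, `u`, `t` in `β`. Truncating all of them except `t`, which enters
only through the bounded Lipschitz function `a`, makes the nonlinearities bounded and globally
Lipschitz. -/
theorem exists_truncated_solution (m : ℝ) {B : ℝ} (hB : 0 ≤ B) {a : ℝ → ℝ} (ha : BddLip a)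
    {p₀ q₀ u₀ N₀ : ℝ → ℝ} (hp₀ : Continuous p₀) (hq₀ : Continuous q₀) (hu₀ : Continuous u₀)
    (hN₀ : Continuous N₀) :
    ∃ p q N Q u t : ℝ × ℝ → ℝ, Continuous p ∧ Continuous q ∧ Continuous N ∧ Continuous Q ∧
      Continuous u ∧ Continuous t ∧
      ∃ p' q' N' Q' u' : ℝ × ℝ → ℝ, p' = (fun z => clip (-2) 2 (p z)) ∧
      q' = (fun z => clip (-2) 2 (q z)) ∧ N' = (fun z => clip (-B) B (N z)) ∧
      Q' = (fun z => clip (-B) B (Q z)) ∧ u' = (fun z => clip (1 / 4) 4 (u z)) ∧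
      (∀ z, p z = p₀ z.2 + ∫ s in (-z.2)..z.1, (fun w => N' w * (-m / u' w * (p' w ^ 2 - p' w * q' w)
        - a (t w) / 2 * (p' w + q' w))) (s, z.2)) ∧
      (∀ z, Q z = N₀ z.2 + ∫ s in (-z.2)..z.1, (fun w => m / u' w * (p' w + q' w) * N' w * Q' w)
        (s, z.2)) ∧
      (∀ z, q z = q₀ (-z.1) + ∫ s in (-z.1)..z.2, (fun w => Q' w * (-m / u' w *
        (q' w ^ 2 - p' w * q' w) - a (t w) / 2 * (p' w + q' w))) (z.1, s)) ∧
      (∀ z, N z = N₀ (-z.1) + ∫ s in (-z.1)..z.2, (fun w => m / u' w * (p' w + q' w) * N' w * Q' w)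
        (z.1, s)) ∧
      (∀ z, u z = u₀ (-z.1) + ∫ s in (-z.1)..z.2, (fun w => p' w * Q' w) (z.1, s)) ∧
      (∀ z, t z = 0 + ∫ s in (-z.1)..z.2, (fun w => Q' w) (z.1, s)) := by
  let S := (ℝ × ℝ) × (ℝ × ℝ × ℝ × ℝ)
  let p' : S → ℝ := fun x => clip (-2) 2 x.1.1
  let Q' : S → ℝ := fun x => clip (-B) B x.1.2
  let q' : S → ℝ := fun x => clip (-2) 2 x.2.1
  let N' : S → ℝ := fun x => clip (-B) B x.2.2.1
  let i' : S → ℝ := fun x => (clip (1 / 4) 4 x.2.2.2.1)⁻¹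
  let a' : S → ℝ := fun x => a x.2.2.2.2
  have l1 : LipschitzWith (1 * 1) fun x : S => x.1.1 := LipschitzWith.prod_fst.comp LipschitzWith.prod_fst
  have l2 : LipschitzWith (1 * 1) fun x : S => x.1.2 := LipschitzWith.prod_snd.comp LipschitzWith.prod_fst
  have l3 : LipschitzWith (1 * 1) fun x : S => x.2.1 := LipschitzWith.prod_fst.comp LipschitzWith.prod_snd
  have l4 : LipschitzWith (1 * 1) fun x : S => x.2.2 := LipschitzWith.prod_snd.comp LipschitzWith.prod_snd
  have l5 : LipschitzWith (1 * (1 * 1)) fun x : S => x.2.2.1 := LipschitzWith.prod_fst.comp l4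
  have l6 : LipschitzWith (1 * (1 * 1)) fun x : S => x.2.2.2 := LipschitzWith.prod_snd.comp l4
  have l7 : LipschitzWith (1 * (1 * (1 * 1))) fun x : S => x.2.2.2.1 := LipschitzWith.prod_fst.comp l6
  have l8 : LipschitzWith (1 * (1 * (1 * 1))) fun x : S => x.2.2.2.2 := LipschitzWith.prod_snd.comp l6
  have hp' : BddLip p' := BddLip.clip (by norm_num) l1
  have hQ' : BddLip Q' := BddLip.clip (by linarith) l2
  have hq' : BddLip q' := BddLip.clip (by norm_num) l3
  have hN' : BddLip N' := BddLip.clip (by linarith) l5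
  have hi' : BddLip i' := BddLip.inv_clip (by norm_num) l7
  have ha' : BddLip a' := by
    obtain ⟨⟨K, hK⟩, M, hM⟩ := ha
    exact ⟨⟨_, hK.comp l8⟩, M, fun x => hM _⟩
  have f1 : BddLip fun x => N' x * (-(m * i' x) * (p' x * p' x - p' x * q' x)
      - a' x * (1 / 2) * (p' x + q' x)) :=
    hN'.mul (((((BddLip.const m).mul hi').neg).mul ((hp'.mul hp').sub (hp'.mul hq'))).sub
      ((ha'.mul (BddLip.const (1 / 2))).mul (hp'.add hq')))
  have f2 : BddLip fun x => m * i' x * (p' x + q' x) * N' x * Q' x :=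
    ((((BddLip.const m).mul hi').mul (hp'.add hq')).mul hN').mul hQ'
  have g1 : BddLip fun x => Q' x * (-(m * i' x) * (q' x * q' x - p' x * q' x)
      - a' x * (1 / 2) * (p' x + q' x)) :=
    hQ'.mul (((((BddLip.const m).mul hi').neg).mul ((hq'.mul hq').sub (hp'.mul hq'))).sub
      ((ha'.mul (BddLip.const (1 / 2))).mul (hp'.add hq')))
  have g2 : BddLip fun x => p' x * Q' x := hp'.mul hQ'
  obtain ⟨KF, hF⟩ := lipschitzWith_prodMk_max f1.1 f2.1
  obtain ⟨KG, hG⟩ := lipschitzWith_prodMk_max g1.1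
    (lipschitzWith_prodMk_max f2.1 (lipschitzWith_prodMk_max g2.1 hQ'.1))
  obtain ⟨M1, hM1⟩ := f1.2
  obtain ⟨M2, hM2⟩ := f2.2
  obtain ⟨M3, hM3⟩ := g1.2
  obtain ⟨M4, hM4⟩ := g2.2
  obtain ⟨M5, hM5⟩ := hQ'.2
  set M := max M1 (max M2 (max M3 (max M4 M5))) with hM
  have hb1 : M1 ≤ M := le_max_left _ _
  have hb2 : M2 ≤ M := (le_max_left _ _).trans (le_max_right _ _)
  have hb3 : M3 ≤ M := ((le_max_left _ _).trans (le_max_right _ _)).trans (le_max_right _ _)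
  have hb4 : M4 ≤ M :=
    (((le_max_left _ _).trans (le_max_right _ _)).trans (le_max_right _ _)).trans (le_max_right _ _)
  have hb5 : M5 ≤ M :=
    (((le_max_right _ _).trans (le_max_right _ _)).trans (le_max_right _ _)).trans (le_max_right _ _)
  obtain ⟨U, V, hU, hV, hUe, hVe⟩ := exists_characteristic_solution
    (k := max KF KG) (M := M) (hF.weaken (le_max_left _ _)) (hG.weaken (le_max_right _ _))
    (fun x => max_le ((hM1 x).trans hb1) ((hM2 x).trans hb2))
    (fun x => max_le ((hM3 x).trans hb3) (max_le ((hM2 x).trans hb2)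
      (max_le ((hM4 x).trans hb4) ((hM5 x).trans hb5))))
    -- The components of `V` are labelled by `ξ`, and the line `ξ + β = 0` carries the initial point
    -- `x = -ξ`; hence the reflected data.
    (U₀ := fun x => (p₀ x, N₀ x)) (V₀ := fun x => (q₀ (-x), N₀ (-x), u₀ (-x), 0))
    (by fun_prop) (by fun_prop)
  have hUV : Continuous fun z => (U z, V z) := hU.prodMk hV
  have keyU : ∀ (L : ℝ × ℝ →L[ℝ] ℝ) z, L (U z) = L (p₀ z.2, N₀ z.2) +
      ∫ s in (-z.2)..z.1, L (_, _) := fun L z => by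
    have hc : Continuous fun s => (U (s, z.2), V (s, z.2)) :=
      hUV.comp (by fun_prop : Continuous fun s => (s, z.2))
    rw [L.intervalIntegral_comp_comm ((hF.continuous.comp hc).intervalIntegrable _ _), ← map_add]
    exact congrArg L (hUe z)
  have keyV : ∀ (L : ℝ × ℝ × ℝ × ℝ →L[ℝ] ℝ) z, L (V z) = L (q₀ (-z.1), N₀ (-z.1), u₀ (-z.1), 0) +
      ∫ s in (-z.1)..z.2, L (_, _) := fun L z => by
    have hc : Continuous fun s => (U (z.1, s), V (z.1, s)) :=
      hUV.comp (by fun_prop : Continuous fun s => (z.1, s))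
    rw [L.intervalIntegral_comp_comm ((hG.continuous.comp hc).intervalIntegrable _ _), ← map_add]
    exact congrArg L (hVe z)
  let π₁ : ℝ × ℝ × ℝ × ℝ →L[ℝ] ℝ × ℝ × ℝ := .snd _ _ _
  let π₂ : ℝ × ℝ × ℝ →L[ℝ] ℝ × ℝ := .snd _ _ _
  refine ⟨fun z => (U z).1, fun z => (V z).1, fun z => (V z).2.1, fun z => (U z).2,
    fun z => (V z).2.2.1, fun z => (V z).2.2.2, by fun_prop, by fun_prop, by fun_prop, by fun_prop,
    by fun_prop, by fun_prop, _, _, _, _, _, rfl, rfl, rfl, rfl, rfl, ?_, ?_, ?_, ?_, ?_, ?_⟩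
  all_goals intro z
  · refine (keyU (.fst _ _ _) z).trans (congrArg (p₀ z.2 + ·) ?_)
    refine intervalIntegral.integral_congr fun s _ => ?_
    simp only [Function.comp_apply, ContinuousLinearMap.coe_fst', p', q', N', i', a']
    ring
  · refine (keyU (.snd _ _ _) z).trans (congrArg (N₀ z.2 + ·) ?_)
    refine intervalIntegral.integral_congr fun s _ => ?_
    simp only [Function.comp_apply, ContinuousLinearMap.coe_snd', p', q', N', i', Q']
    ring
  · refine (keyV (.fst _ _ _) z).trans (congrArg (q₀ (-z.1) + ·) ?_)
    refine intervalIntegral.integral_congr fun s _ => ?_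
    simp only [Function.comp_apply, ContinuousLinearMap.coe_fst', p', q', Q', i', a']
    ring
  · refine (keyV ((ContinuousLinearMap.fst ℝ ℝ (ℝ × ℝ)).comp π₁) z).trans
      (congrArg (N₀ (-z.1) + ·) ?_)
    refine intervalIntegral.integral_congr fun s _ => ?_
    simp only [Function.comp_apply, ContinuousLinearMap.comp_apply, ContinuousLinearMap.coe_fst',
      ContinuousLinearMap.coe_snd', π₁, p', q', N', i', Q']
    ring
  · exact keyV (((ContinuousLinearMap.fst ℝ ℝ ℝ).comp π₂).comp π₁) z
  · exact keyV (((ContinuousLinearMap.snd ℝ ℝ ℝ).comp π₂).comp π₁) z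

end

/-! ### Recovery of the full system where no truncation is active. -/

section

theorem Untruncated.isOpen {B : ℝ} {p q N Q u : ℝ × ℝ → ℝ} (hp : Continuous p)
    (hq : Continuous q) (hN : Continuous N) (hQ : Continuous Q) (hu : Continuous u) :
    IsOpen {z | Untruncated B (p z) (q z) (N z) (Q z) (u z)} :=
  (isOpen_Ioo.preimage hp).inter ((isOpen_Ioo.preimage hq).inter ((isOpen_Ioo.preimage hN).inter
    ((isOpen_Ioo.preimage hQ).inter (isOpen_Ioo.preimage hu))))

theorem continuous_speed_clip (m : ℝ) {u : ℝ × ℝ → ℝ} (hu : Continuous u) :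
    Continuous fun z => speed m (clip (1 / 4) 4 (u z)) :=
  ((continuous_clip _ _).comp hu).rpow_const fun _ =>
    Or.inl (lt_of_lt_of_le (by norm_num) (le_clip _ _ _)).ne'

theorem hasDerivAt_of_eq_clip {f' f : ℝ × ℝ → ℝ} {l h d s : ℝ}
    (e : f' = fun z => clip l h (f z)) (c : ℝ → ℝ × ℝ) (hd : HasDerivAt (fun x => f (c x)) d s)
    (hm : f' (c s) ∈ Ioo l h) : HasDerivAt (fun x => f' (c x)) d s := by
  subst e
  exact HasDerivAt.clip hd hm

/-- Solutions in characteristic coordinates exist as long as no truncation is active. -/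
theorem exists_charSol (m : ℝ) {B : ℝ} {a A : ℝ → ℝ} (ha : BddLip a)
    (hA : ∀ s, HasDerivAt A (a s) s) (hA0 : A 0 = 0) {u₀ v₀ u₀' v₀' p₀ q₀ : ℝ → ℝ}
    (hu₀ : ∀ x, HasDerivAt u₀ (u₀' x) x) (hv₀ : ∀ x, HasDerivAt v₀ (v₀' x) x)
    (hu₀' : Continuous u₀') (hv₀' : Continuous v₀')
    (hp₀ : ∀ x, p₀ x = v₀' x + speed m (u₀ x) * u₀' x)
    (hq₀ : ∀ x, q₀ x = v₀' x - speed m (u₀ x) * u₀' x)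
    (hdata : ∀ x, Untruncated B (p₀ x) (q₀ x) (1 / (2 * speed m (u₀ x)))
      (1 / (2 * speed m (u₀ x))) (u₀ x)) :
    ∃ (D : Set (ℝ × ℝ)) (S : CharSol m a u₀ v₀ p₀ q₀ D), IsOpen D ∧
      ∀ z, (∀ b ∈ uIcc (-z.1) z.2, Untruncated B (S.p (z.1, b)) (S.q (z.1, b)) (S.N (z.1, b))
        (S.Q (z.1, b)) (S.u (z.1, b))) → z ∈ D := by
  have hB : 0 ≤ B := by
    have := (hdata 0).2.2.1
    linarith [this.1, this.2]
  have hac : Continuous a := ha.1.choose_spec.continuous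
  have hAc : Continuous A := continuous_iff_continuousAt.2 fun s => (hA s).continuousAt
  have hu₀c : Continuous u₀ := continuous_iff_continuousAt.2 fun s => (hu₀ s).continuousAt
  have hv₀c : Continuous v₀ := continuous_iff_continuousAt.2 fun s => (hv₀ s).continuousAt
  have hu₀pos : ∀ x, 0 < u₀ x := fun x => lt_trans (by norm_num) (hdata x).2.2.2.2.1
  have hsc : Continuous fun x => speed m (u₀ x) := hu₀c.rpow_const fun x => Or.inl (hu₀pos x).ne'
  have hs0 : ∀ x, 0 < speed m (u₀ x) := fun x => speed_pos m (hu₀pos x)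
  have hN₀c : Continuous fun x => 1 / (2 * speed m (u₀ x)) :=
    continuous_const.div (by fun_prop) fun x => (mul_pos two_pos (hs0 x)).ne'
  obtain rfl : p₀ = fun x => v₀' x + speed m (u₀ x) * u₀' x := funext hp₀
  obtain rfl : q₀ = fun x => v₀' x - speed m (u₀ x) * u₀' x := funext hq₀
  obtain ⟨p, q, N, Q, u, t, cp, cq, cN, cQ, cu, ct, p', q', N', Q', u', ep, eq, eN, eQ, eu,
    Ip, IQ, Iq, IN, Iu, It⟩ := exists_truncated_solution m hB ha
      (p₀ := fun x => v₀' x + speed m (u₀ x) * u₀' x)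
      (q₀ := fun x => v₀' x - speed m (u₀ x) * u₀' x) (u₀ := u₀) (by fun_prop) (by fun_prop) hu₀c hN₀c
  have cp' : Continuous p' := ep ▸ (continuous_clip _ _).comp cp
  have cq' : Continuous q' := eq ▸ (continuous_clip _ _).comp cq
  have cN' : Continuous N' := eN ▸ (continuous_clip _ _).comp cN
  have cQ' : Continuous Q' := eQ ▸ (continuous_clip _ _).comp cQ
  have cu' : Continuous u' := eu ▸ (continuous_clip _ _).comp cu
  have ccu : Continuous fun z => speed m (u' z) := by rw [eu]; exact continuous_speed_clip m cu
  have pu' : ∀ z, 0 < u' z := fun z => by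
    rw [eu]
    exact lt_of_lt_of_le (by norm_num) (le_clip _ _ _)
  have ciu : Continuous fun z => m / u' z := continuous_const.div cu' fun z => (pu' z).ne'
  have ciu' : Continuous fun z => -m / u' z := continuous_const.div cu' fun z => (pu' z).ne'
  -- The truncated functions themselves become the components of the solution: they are continuous
  -- with `u' ≥ 1 / 4` on the whole plane, and on `O` they obey the equations.
  set O : Set (ℝ × ℝ) := {z | Untruncated B (p' z) (q' z) (N' z) (Q' z) (u' z)} with hO
  have hOo : IsOpen O := Untruncated.isOpen cp' cq' cN' cQ' cu'
  have hD := isSegmentDomain_segmentDomain hOo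
  set D := segmentDomain O with hDdef
  have hDO : ∀ ξ β, (ξ, β) ∈ D → (ξ, β) ∈ O := fun ξ β h => segmentDomain_subset O h
  have dp : ∀ x, p' (-x, x) = v₀' x + speed m (u₀ x) * u₀' x := fun x => by
    rw [ep]
    simp only [Ip, intervalIntegral.integral_same, add_zero]
    exact clip_of_mem (hdata x).1.1.le (hdata x).1.2.le
  have dq : ∀ x, q' (-x, x) = v₀' x - speed m (u₀ x) * u₀' x := fun x => by
    rw [eq]
    simp only [Iq, neg_neg, intervalIntegral.integral_same, add_zero]
    exact clip_of_mem (hdata x).2.1.1.le (hdata x).2.1.2.le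
  have dN : ∀ x, N' (-x, x) = 1 / (2 * speed m (u₀ x)) := fun x => by
    rw [eN]
    simp only [IN, neg_neg, intervalIntegral.integral_same, add_zero]
    exact clip_of_mem (hdata x).2.2.1.1.le (hdata x).2.2.1.2.le
  have dQ : ∀ x, Q' (-x, x) = 1 / (2 * speed m (u₀ x)) := fun x => by
    rw [eQ]
    simp only [IQ, intervalIntegral.integral_same, add_zero]
    exact clip_of_mem (hdata x).2.2.2.1.1.le (hdata x).2.2.2.1.2.le
  have du : ∀ x, u' (-x, x) = u₀ x := fun x => by
    rw [eu]
    simp only [Iu, neg_neg, intervalIntegral.integral_same, add_zero]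
    exact clip_of_mem (hdata x).2.2.2.2.1.le (hdata x).2.2.2.2.2.le
  have dt : ∀ x, t (-x, x) = 0 := fun x => by
    simp only [It, neg_neg, intervalIntegral.integral_same, add_zero]
  have cF₁ : Continuous fun w => N' w * (-m / u' w * (p' w ^ 2 - p' w * q' w)
      - a (t w) / 2 * (p' w + q' w)) := by fun_prop
  have cF₂ : Continuous fun w => m / u' w * (p' w + q' w) * N' w * Q' w := by fun_prop
  have cG₁ : Continuous fun w => Q' w * (-m / u' w * (q' w ^ 2 - p' w * q' w)
      - a (t w) / 2 * (p' w + q' w)) := by fun_prop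
  have fp : ∀ ξ β, (ξ, β) ∈ O → HasDerivAt (fun s => p' (s, β))
      (N' (ξ, β) * (-m / u' (ξ, β) * (p' (ξ, β) ^ 2 - p' (ξ, β) * q' (ξ, β))
        - a (t (ξ, β)) / 2 * (p' (ξ, β) + q' (ξ, β)))) ξ := fun ξ β h => by
    refine hasDerivAt_of_eq_clip ep (fun s => (s, β)) ?_ h.1
    rw [funext Ip]
    exact hasDerivAt_integral_right (h := fun s => (fun w => N' w * (-m / u' w *
      (p' w ^ 2 - p' w * q' w) - a (t w) / 2 * (p' w + q' w))) (s, β)) (cF₁.comp (by fun_prop : Continuous fun s => (s, β))) (v₀' β + speed m (u₀ β) * u₀' β) (-β) ξ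
  have fQ : ∀ ξ β, (ξ, β) ∈ O → HasDerivAt (fun s => Q' (s, β))
      (m / u' (ξ, β) * (p' (ξ, β) + q' (ξ, β)) * N' (ξ, β) * Q' (ξ, β)) ξ := fun ξ β h => by
    refine hasDerivAt_of_eq_clip eQ (fun s => (s, β)) ?_ h.2.2.2.1
    rw [funext IQ]
    exact hasDerivAt_integral_right (h := fun s => (fun w => m / u' w *
      (p' w + q' w) * N' w * Q' w) (s, β)) (cF₂.comp (by fun_prop : Continuous fun s => (s, β))) (1 / (2 * speed m (u₀ β))) (-β) ξ
  have fq : ∀ ξ β, (ξ, β) ∈ O → HasDerivAt (fun s => q' (ξ, s))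
      (Q' (ξ, β) * (-m / u' (ξ, β) * (q' (ξ, β) ^ 2 - p' (ξ, β) * q' (ξ, β))
        - a (t (ξ, β)) / 2 * (p' (ξ, β) + q' (ξ, β)))) β := fun ξ β h => by
    refine hasDerivAt_of_eq_clip eq (fun s => (ξ, s)) ?_ h.2.1
    rw [funext Iq]
    exact hasDerivAt_integral_right (h := fun s => (fun w => Q' w * (-m / u' w *
      (q' w ^ 2 - p' w * q' w) - a (t w) / 2 * (p' w + q' w))) (ξ, s)) (cG₁.comp (by fun_prop : Continuous fun s => (ξ, s))) (v₀' (-ξ) - speed m (u₀ (-ξ)) * u₀' (-ξ)) (-ξ) β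
  have fN : ∀ ξ β, (ξ, β) ∈ O → HasDerivAt (fun s => N' (ξ, s))
      (m / u' (ξ, β) * (p' (ξ, β) + q' (ξ, β)) * N' (ξ, β) * Q' (ξ, β)) β := fun ξ β h => by
    refine hasDerivAt_of_eq_clip eN (fun s => (ξ, s)) ?_ h.2.2.1
    rw [funext IN]
    exact hasDerivAt_integral_right (h := fun s => (fun w => m / u' w *
      (p' w + q' w) * N' w * Q' w) (ξ, s)) (cF₂.comp (by fun_prop : Continuous fun s => (ξ, s))) (1 / (2 * speed m (u₀ (-ξ)))) (-ξ) β
  have tpot : t = potential (fun _ => 0) Q' := funext It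
  have upot : u = potential u₀ (fun w => p' w * Q' w) := funext Iu
  have ft2 : ∀ ξ β, HasDerivAt (fun s => t (ξ, s)) (Q' (ξ, β)) β := fun ξ β => by
    rw [tpot]
    exact hasDerivAt_potential_snd _ cQ' ξ β
  have ft1 : ∀ ξ β, (ξ, β) ∈ D → HasDerivAt (fun s => t (s, β)) (N' (ξ, β)) ξ := fun ξ β h => by
    rw [tpot]
    refine hasDerivAt_potential_fst hD (B := N')
      (H := fun w => m / u' w * (p' w + q' w) * N' w * Q' w) cQ' (by fun_prop) (fun x => ?_)
      (fun ξ β h => fQ ξ β (hDO ξ β h)) (fun ξ β h => fN ξ β (hDO ξ β h)) h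
    rw [dN, dQ, sub_self]
    exact hasDerivAt_const _ _
  have fu2 : ∀ ξ β, (ξ, β) ∈ D → HasDerivAt (fun s => u' (ξ, s)) (p' (ξ, β) * Q' (ξ, β)) β :=
      fun ξ β h => by
    refine hasDerivAt_of_eq_clip eu (fun s => (ξ, s)) ?_ (hDO ξ β h).2.2.2.2
    rw [upot]
    exact hasDerivAt_potential_snd _ (cp'.mul cQ') ξ β
  -- Compatibility `(p Q)_ξ = (q N)_β`: both sides equal the same expression `H`. The same mechanism
  -- serves `t`, `X` and `v`.
  have fu1 : ∀ ξ β, (ξ, β) ∈ D → HasDerivAt (fun s => u' (s, β)) (q' (ξ, β) * N' (ξ, β)) ξ :=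
      fun ξ β h => by
    refine hasDerivAt_of_eq_clip eu (fun s => (s, β)) ?_ (hDO ξ β h).2.2.2.2
    rw [upot]
    refine hasDerivAt_potential_fst hD (A := fun w => p' w * Q' w) (B := fun w => q' w * N' w)
      (H := fun w => N' w * Q' w * (2 * (m / u' w) * p' w * q' w - a (t w) / 2 * (p' w + q' w)))
      (cp'.mul cQ') (by fun_prop) (fun x => ?_) (fun ξ β h => ?_) (fun ξ β h => ?_) h
    · refine (hu₀ x).congr_deriv ?_
      simp only [dp, dQ, dq, dN]
      have := (hs0 x).ne'
      field_simp
      ring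
    · exact ((fp ξ β (hDO ξ β h)).mul (fQ ξ β (hDO ξ β h))).congr_deriv (by ring)
    · exact ((fq ξ β (hDO ξ β h)).mul (fN ξ β (hDO ξ β h))).congr_deriv (by ring)
  have fc1 : ∀ ξ β, (ξ, β) ∈ D → HasDerivAt (fun s => speed m (u' (s, β)))
      (2 * (-m / u' (ξ, β)) * speed m (u' (ξ, β)) * (q' (ξ, β) * N' (ξ, β))) ξ := fun ξ β h =>
    HasDerivAt.comp (h₂ := speed m) (h := fun s => u' (s, β)) ξ
      (hasDerivAt_speed m (pu' (ξ, β))) (fu1 ξ β h)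
  have fc2 : ∀ ξ β, (ξ, β) ∈ D → HasDerivAt (fun s => speed m (u' (ξ, s)))
      (2 * (-m / u' (ξ, β)) * speed m (u' (ξ, β)) * (p' (ξ, β) * Q' (ξ, β))) β := fun ξ β h =>
    HasDerivAt.comp (h₂ := speed m) (h := fun s => u' (ξ, s)) β
      (hasDerivAt_speed m (pu' (ξ, β))) (fu2 ξ β h)
  set X : ℝ × ℝ → ℝ := potential id (fun w => speed m (u' w) * Q' w) with hX
  have fX1 : ∀ ξ β, (ξ, β) ∈ D →
      HasDerivAt (fun s => X (s, β)) (-(speed m (u' (ξ, β)) * N' (ξ, β))) ξ := fun ξ β h => by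
    refine hasDerivAt_potential_fst hD (A := fun w => speed m (u' w) * Q' w)
      (B := fun w => -(speed m (u' w) * N' w))
      (H := fun w => speed m (u' w) * (m / u' w) * (p' w - q' w) * N' w * Q' w)
      (ccu.mul cQ') (by fun_prop) (fun x => ?_) (fun ξ β h => ?_) (fun ξ β h => ?_) h
    · refine (hasDerivAt_id x).congr_deriv ?_
      simp only [dQ, dN, du]
      have := (hs0 x).ne'
      field_simp
      ring
    · exact ((fc1 ξ β h).mul (fQ ξ β (hDO ξ β h))).congr_deriv (by ring)
    · exact ((fc2 ξ β h).mul (fN ξ β (hDO ξ β h))).neg.congr_deriv (by ring)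
  -- The function `w` stands for `exp (A (t)) v`. The integrating factor removes `v` from its own
  -- equation, so `w` is a plain potential and `v` need not take part in the Picard iteration.
  set w : ℝ × ℝ → ℝ := potential v₀ (fun w => Real.exp (A (t w)) * (speed m (u' w) * (p' w * Q' w)))
    with hw
  have ce : Continuous fun z => Real.exp (A (t z)) := Real.continuous_exp.comp (hAc.comp ct)
  have fe1 : ∀ ξ β, (ξ, β) ∈ D → HasDerivAt (fun s => Real.exp (A (t (s, β))))
      (Real.exp (A (t (ξ, β))) * (a (t (ξ, β)) * N' (ξ, β))) ξ := fun ξ β h =>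
    ((hA _).comp ξ (ft1 ξ β h)).exp
  have fe2 : ∀ ξ β, HasDerivAt (fun s => Real.exp (A (t (ξ, s))))
      (Real.exp (A (t (ξ, β))) * (a (t (ξ, β)) * Q' (ξ, β))) β := fun ξ β =>
    ((hA _).comp β (ft2 ξ β)).exp
  have fw1 : ∀ ξ β, (ξ, β) ∈ D → HasDerivAt (fun s => w (s, β))
      (-(Real.exp (A (t (ξ, β))) * (speed m (u' (ξ, β)) * (q' (ξ, β) * N' (ξ, β))))) ξ :=
      fun ξ β h => by
    refine hasDerivAt_potential_fst hD
      (B := fun w => -(Real.exp (A (t w)) * (speed m (u' w) * (q' w * N' w))))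
      (H := fun w => Real.exp (A (t w)) * speed m (u' w) * N' w * Q' w * (a (t w) / 2) *
        (p' w - q' w))
      (by fun_prop) (by fun_prop) (fun x => ?_) (fun ξ β h => ?_) (fun ξ β h => ?_) h
    · refine (hv₀ x).congr_deriv ?_
      simp only [dQ, dN, du, dp, dq, dt, hA0, Real.exp_zero]
      have := (hs0 x).ne'
      field_simp
      ring
    · exact ((fe1 ξ β h).mul ((fc1 ξ β h).mul ((fp ξ β (hDO ξ β h)).mul
        (fQ ξ β (hDO ξ β h))))).congr_deriv (by simp only [Pi.mul_apply]; ring)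
    · exact ((fe2 ξ β).mul ((fc2 ξ β h).mul ((fq ξ β (hDO ξ β h)).mul
        (fN ξ β (hDO ξ β h))))).neg.congr_deriv (by simp only [Pi.mul_apply]; ring)
  have fw2 : ∀ ξ β, HasDerivAt (fun s => w (ξ, s))
      (Real.exp (A (t (ξ, β))) * (speed m (u' (ξ, β)) * (p' (ξ, β) * Q' (ξ, β)))) β :=
    fun ξ β => hasDerivAt_potential_snd v₀
      (A := fun w => Real.exp (A (t w)) * (speed m (u' w) * (p' w * Q' w))) (by fun_prop) ξ β
  have cw : Continuous w := continuous_potential hv₀c (by fun_prop)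
  have hexp : ∀ s, Real.exp (-s) * Real.exp s = 1 := fun s => by rw [← Real.exp_add]; simp
  refine ⟨D, ⟨p', q', N', Q', u', t, X, fun z => Real.exp (-A (t z)) * w z, cp', cq', cN', cQ', cu',
    ct, continuous_potential continuous_id (ccu.mul cQ'), by fun_prop, pu', dp, dq, dN, dQ, du, dt,
    fun x => potential_diag _ _ x, fun x => ?_, fun ξ β h => fp ξ β (hDO ξ β h),
    fun ξ β h => fq ξ β (hDO ξ β h), fun ξ β h => fQ ξ β (hDO ξ β h),
    fun ξ β h => fN ξ β (hDO ξ β h), fu1, fu2, ft1, fun ξ β _ => ft2 ξ β, fX1,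
    fun ξ β _ => hasDerivAt_potential_snd id (ccu.mul cQ') ξ β, fun ξ β h => ?_, fun ξ β h => ?_⟩,
    hD.isOpen, fun z hz => mem_segmentDomain_of_forall hz⟩
  · simp only [dt, hA0, neg_zero, Real.exp_zero, one_mul]
    exact potential_diag _ _ x
  · refine ((((hA _).comp ξ (ft1 ξ β h)).neg.exp).mul (fw1 ξ β h)).congr_deriv ?_
    simp only [Function.comp_apply, Pi.neg_apply]
    linear_combination -(speed m (u' (ξ, β)) * (q' (ξ, β) * N' (ξ, β))) * hexp (A (t (ξ, β)))
  · refine ((((hA _).comp β (ft2 ξ β)).neg.exp).mul (fw2 ξ β)).congr_deriv ?_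
    simp only [Function.comp_apply, Pi.neg_apply]
    linear_combination (speed m (u' (ξ, β)) * (p' (ξ, β) * Q' (ξ, β))) * hexp (A (t (ξ, β)))

end

/-! ### Monotonicity lemmas, primitives of the speed of sound, and triangles of dependence. -/

section

theorem le_of_hasDerivAt_nonneg {f f' : ℝ → ℝ} {a b : ℝ} (hab : a ≤ b)
    (hc : ContinuousOn f (Icc a b)) (hd : ∀ s ∈ Ioo a b, HasDerivAt f (f' s) s)
    (hn : ∀ s ∈ Ioo a b, 0 ≤ f' s) : f a ≤ f b := by
  refine monotoneOn_of_deriv_nonneg (convex_Icc a b) hc ?_ ?_ (left_mem_Icc.2 hab)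
    (right_mem_Icc.2 hab) hab
  · rw [interior_Icc]
    exact fun s hs => (hd s hs).differentiableAt.differentiableWithinAt
  · rw [interior_Icc]
    intro s hs
    rw [(hd s hs).deriv]
    exact hn s hs

theorem lt_of_hasDerivAt_pos {f f' : ℝ → ℝ} {a b : ℝ} (hab : a < b)
    (hc : ContinuousOn f (Icc a b)) (hd : ∀ s ∈ Ioo a b, HasDerivAt f (f' s) s)
    (hn : ∀ s ∈ Ioo a b, 0 < f' s) : f a < f b := by
  refine strictMonoOn_of_deriv_pos (convex_Icc a b) hc ?_ (left_mem_Icc.2 hab.le)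
    (right_mem_Icc.2 hab.le) hab
  rw [interior_Icc]
  intro s hs
  rw [(hd s hs).deriv]
  exact hn s hs

section Primitives

/-- The primitive of `u ^ (-m)`, the square root of the speed of sound. -/
def theta (m u : ℝ) : ℝ := ∫ s in (1:ℝ)..u, s ^ (-m)

/-- The primitive of the speed of sound; `v ± eta u` are the Riemann invariants. -/
def eta (m u : ℝ) : ℝ := theta (2 * m) u

theorem hasDerivAt_theta (m : ℝ) {u : ℝ} (hu : 0 < u) : HasDerivAt (theta m) (u ^ (-m)) u := by
  have hpos : ∀ s ∈ uIcc 1 u, (0:ℝ) < s := fun s hs =>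
    lt_of_lt_of_le (lt_min one_pos hu) hs.1
  refine intervalIntegral.integral_hasDerivAt_right ?_ ?_ ?_
  · refine ContinuousOn.intervalIntegrable fun s hs => ?_
    exact (Real.continuousAt_rpow_const _ _ (Or.inl (hpos s hs).ne')).continuousWithinAt
  · refine ContinuousOn.stronglyMeasurableAtFilter isOpen_Ioi (fun s hs => ?_) u hu
    exact (Real.continuousAt_rpow_const _ _ (Or.inl (ne_of_gt hs))).continuousWithinAt
  · exact Real.continuousAt_rpow_const _ _ (Or.inl hu.ne')

theorem hasDerivAt_eta (m : ℝ) {u : ℝ} (hu : 0 < u) : HasDerivAt (eta m) (speed m u) u :=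
  hasDerivAt_theta (2 * m) hu

theorem theta_one (m : ℝ) : theta m 1 = 0 := intervalIntegral.integral_same

theorem rpow_le_two_rpow {m u : ℝ} (hm : 0 ≤ m) (hu : u ∈ Icc (1 / 2 : ℝ) 2) :
    u ^ m ≤ 2 ^ m ∧ u ^ (-m) ≤ 2 ^ m ∧ (2 ^ m)⁻¹ ≤ u ^ (-m) := by
  have h0 : 0 < u := lt_of_lt_of_le (by norm_num) hu.1
  have h1 : u ^ m ≤ 2 ^ m := Real.rpow_le_rpow h0.le hu.2 hm
  have h2 : u⁻¹ ^ m ≤ 2 ^ m := by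
    refine Real.rpow_le_rpow (by positivity) ?_ hm
    rw [inv_le_comm₀ h0 two_pos, ← one_div]
    exact hu.1
  rw [Real.inv_rpow h0.le, ← Real.rpow_neg h0.le] at h2
  refine ⟨h1, h2, ?_⟩
  rw [Real.rpow_neg h0.le]
  exact inv_anti₀ (Real.rpow_pos_of_pos h0 _) h1

theorem four_rpow (m : ℝ) : (4:ℝ) ^ m = 2 ^ (2 * m) := by
  rw [Real.rpow_mul (by norm_num)]
  norm_num

theorem speed_bounds {m u : ℝ} (hm : 0 ≤ m) (hu : u ∈ Icc (1 / 2 : ℝ) 2) :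
    speed m u ≤ 4 ^ m ∧ (4 ^ m)⁻¹ ≤ speed m u := by
  rw [four_rpow]
  exact (rpow_le_two_rpow (by linarith) hu).2

/-- `theta` is bi-Lipschitz near `1`. -/
theorem abs_theta_bounds {m u : ℝ} (hm : 0 ≤ m) (hu : u ∈ Icc (1 / 2 : ℝ) 2) :
    |theta m u| ≤ 2 ^ m * |u - 1| ∧ |u - 1| ≤ 2 ^ m * |theta m u| := by
  have h2 : (0:ℝ) < 2 ^ m := Real.rpow_pos_of_pos two_pos _
  have hpos : ∀ s : ℝ, 1 / 2 ≤ s → 0 < s := fun s hs => lt_of_lt_of_le (by norm_num) hs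
  have hcont : ∀ a b : ℝ, 1 / 2 ≤ a → ContinuousOn (theta m) (Icc a b) := fun a b ha s hs =>
    (hasDerivAt_theta m (hpos s (ha.trans hs.1))).continuousAt.continuousWithinAt
  have key : ∀ a b : ℝ, 1 / 2 ≤ a → b ≤ 2 → a ≤ b →
      theta m b - theta m a ≤ 2 ^ m * (b - a) ∧ b - a ≤ 2 ^ m * (theta m b - theta m a) := by
    intro a b ha hb hab
    constructor
    · have := le_of_hasDerivAt_nonneg (f := fun s => 2 ^ m * s - theta m s)
        (f' := fun s => 2 ^ m * 1 - s ^ (-m)) hab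
        ((continuousOn_const.mul continuousOn_id).sub (hcont a b ha))
        (fun s hs => ((hasDerivAt_id s).const_mul _).sub
          (hasDerivAt_theta m (hpos s (ha.trans hs.1.le))))
        (fun s hs => by
          have := (rpow_le_two_rpow hm ⟨ha.trans hs.1.le, hs.2.le.trans hb⟩).2.1
          linarith)
      linarith
    · have := le_of_hasDerivAt_nonneg (f := fun s => 2 ^ m * theta m s - s)
        (f' := fun s => 2 ^ m * s ^ (-m) - 1) hab
        ((continuousOn_const.mul (hcont a b ha)).sub continuousOn_id)
        (fun s hs => ((hasDerivAt_theta m (hpos s (ha.trans hs.1.le))).const_mul _).sub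
          (hasDerivAt_id s))
        (fun s hs => by
          have := (rpow_le_two_rpow hm ⟨ha.trans hs.1.le, hs.2.le.trans hb⟩).2.2
          rw [inv_le_iff_one_le_mul₀' h2] at this
          linarith)
      linarith
  rcases le_total 1 u with h | h
  · obtain ⟨k1, k2⟩ := key 1 u (by norm_num) hu.2 h
    rw [theta_one, sub_zero] at k1 k2
    have : 0 ≤ theta m u := by
      by_contra hneg
      nlinarith
    rw [abs_of_nonneg this, abs_of_nonneg (by linarith)]
    exact ⟨k1, k2⟩
  · obtain ⟨k1, k2⟩ := key u 1 hu.1 (by norm_num) h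
    rw [theta_one, zero_sub] at k1 k2
    have : theta m u ≤ 0 := by
      by_contra hneg
      nlinarith
    rw [abs_of_nonpos this, abs_of_nonpos (by linarith)]
    constructor <;> linarith

theorem abs_sub_one_le_eta {m u : ℝ} (hm : 0 ≤ m) (hu : u ∈ Icc (1 / 2 : ℝ) 2) :
    |u - 1| ≤ 4 ^ m * |eta m u| := by
  rw [four_rpow]
  exact (abs_theta_bounds (by linarith) hu).2

end Primitives

section Triangle

/-- A parametrization by the unit square of the triangle with vertices `(ξ, β)`, `(-β, β)` and
`(ξ, -ξ)`. -/
def triangle (z k : ℝ × ℝ) : ℝ × ℝ :=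
  (-z.2 + k.1 * (z.1 + z.2),
    -(-z.2 + k.1 * (z.1 + z.2)) + k.2 * (z.2 + (-z.2 + k.1 * (z.1 + z.2))))

theorem continuous_triangle : Continuous fun w : (ℝ × ℝ) × (ℝ × ℝ) => triangle w.1 w.2 := by
  unfold triangle
  fun_prop

/-- The unit square. -/
def square : Set (ℝ × ℝ) := Icc (0:ℝ) 1 ×ˢ Icc (0:ℝ) 1

theorem isCompact_square : IsCompact square := isCompact_Icc.prod isCompact_Icc

theorem triangle_mem {z k : ℝ × ℝ} (hz : 0 ≤ z.1 + z.2) (hk : k ∈ square) :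
    (triangle z k).1 ≤ z.1 ∧ (triangle z k).2 ≤ z.2 ∧ 0 ≤ (triangle z k).1 + (triangle z k).2 := by
  obtain ⟨⟨h1, h2⟩, h3, h4⟩ := hk
  have e : 0 ≤ z.2 + (-z.2 + k.1 * (z.1 + z.2)) := by
    have := mul_nonneg h1 hz
    linarith
  simp only [triangle]
  refine ⟨?_, ?_, ?_⟩
  · nlinarith
  · nlinarith
  · have := mul_nonneg h3 e
    linarith

theorem exists_triangle_eq {z : ℝ × ℝ} {s b : ℝ} (hs : s ≤ z.1) (hb : b ≤ z.2) (hsb : 0 ≤ s + b) :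
    ∃ k ∈ square, triangle z k = (s, b) := by
  have e : ∀ x y : ℝ, 0 ≤ x → x ≤ y → ∃ k ∈ Icc (0:ℝ) 1, k * y = x := by
    intro x y hx hxy
    rcases (hx.trans hxy).eq_or_lt with h | h
    · exact ⟨0, by simp, by linarith⟩
    · exact ⟨x / y, ⟨by positivity, (div_le_one h).2 hxy⟩, div_mul_cancel₀ _ h.ne'⟩
  obtain ⟨k₁, hk₁, e₁⟩ := e (s + z.2) (z.1 + z.2) (by linarith) (by linarith)
  obtain ⟨k₂, hk₂, e₂⟩ := e (b + s) (z.2 + s) (by linarith) (by linarith)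
  refine ⟨(k₁, k₂), ⟨hk₁, hk₂⟩, ?_⟩
  have hs' : -z.2 + k₁ * (z.1 + z.2) = s := by linarith
  simp only [triangle, hs', e₂]
  congr 1
  ring

/-- The points of the half plane `ξ + β ≥ 0` whose triangle of dependence lies in `G`. -/
def dependenceRegion (G : Set (ℝ × ℝ)) : Set (ℝ × ℝ) :=
  {z | 0 ≤ z.1 + z.2 ∧ ∀ s b, s ≤ z.1 → b ≤ z.2 → 0 ≤ s + b → (s, b) ∈ G}

theorem mem_dependenceRegion_iff {G : Set (ℝ × ℝ)} {z : ℝ × ℝ} :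
    z ∈ dependenceRegion G ↔ 0 ≤ z.1 + z.2 ∧ ∀ k ∈ square, triangle z k ∈ G := by
  refine ⟨fun h => ⟨h.1, fun k hk => ?_⟩, fun h => ⟨h.1, fun s b hs hb hsb => ?_⟩⟩
  · obtain ⟨h1, h2, h3⟩ := triangle_mem h.1 hk
    exact h.2 _ _ h1 h2 h3
  · obtain ⟨k, hk, e⟩ := exists_triangle_eq hs hb hsb
    exact e ▸ h.2 k hk

/-- With the triangle parametrized by the fixed unit square, the condition is an intersection of
closed conditions, one for each parameter. -/
theorem isClosed_dependenceRegion {G : Set (ℝ × ℝ)} (hG : IsClosed G) :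
    IsClosed (dependenceRegion G) := by
  have : dependenceRegion G = {z | 0 ≤ z.1 + z.2} ∩ ⋂ k ∈ square, {z | triangle z k ∈ G} := by
    ext z
    simp only [mem_dependenceRegion_iff, mem_inter_iff, mem_ofPred_eq, mem_iInter]
  rw [this]
  refine (isClosed_le continuous_const (by fun_prop)).inter (isClosed_biInter fun k _ => ?_)
  exact hG.preimage (continuous_triangle.comp (by fun_prop : Continuous fun z : ℝ × ℝ => (z, k)))

/-- Triangles depend continuously on their vertex and are images of the compact unit square, so the
tube lemma applies. -/
theorem eventually_mem_dependenceRegion {G : Set (ℝ × ℝ)} {z : ℝ × ℝ}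
    (hz : ∀ s b, s ≤ z.1 → b ≤ z.2 → 0 ≤ s + b → G ∈ 𝓝 (s, b)) (hz0 : 0 ≤ z.1 + z.2) :
    ∀ᶠ w in 𝓝 z, 0 ≤ w.1 + w.2 → w ∈ dependenceRegion G := by
  have : ∀ᶠ w in 𝓝 z, ∀ k ∈ square, triangle w k ∈ G := by
    refine isCompact_square.eventually_forall_of_forall_eventually
      (P := fun w k => triangle w k ∈ G) fun k hk => ?_
    obtain ⟨h1, h2, h3⟩ := triangle_mem hz0 hk
    exact continuous_triangle.continuousAt.eventually (hz _ _ h1 h2 h3)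
  filter_upwards [this] with w hw h0
  exact mem_dependenceRegion_iff.2 ⟨h0, hw⟩

theorem dependenceRegion_mono_point {G : Set (ℝ × ℝ)} {z : ℝ × ℝ} (hz : z ∈ dependenceRegion G)
    {s b : ℝ} (hs : s ≤ z.1) (hb : b ≤ z.2) (hsb : 0 ≤ s + b) : (s, b) ∈ dependenceRegion G :=
  ⟨hsb, fun s' b' hs' hb' h' => hz.2 s' b' (hs'.trans hs) (hb'.trans hb) h'⟩

theorem dependenceRegion_subset {G : Set (ℝ × ℝ)} : dependenceRegion G ⊆ G :=
  fun z hz => hz.2 z.1 z.2 le_rfl le_rfl hz.1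

end Triangle

end

/-! ### The bootstrap: Riemann invariants, slopes and densities. -/

section

/-- The modified slope `u ^ (-m) p + (a / 2) θ(u)`, which satisfies a scalar Riccati equation. -/
def slope (m α p u : ℝ) : ℝ := u ^ (-m) * p + α / 2 * theta m u

/-- The closed bootstrap conditions. -/
def Controlled (m B : ℝ) (a n : ℝ → ℝ) (p q N Q u t : ℝ) : Prop :=
  (|p| ≤ 1 ∧ |q| ≤ 1) ∧ u ∈ Icc (1 / 2 : ℝ) 2 ∧ (N ∈ Icc B⁻¹ B ∧ Q ∈ Icc B⁻¹ B) ∧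
    |slope m (a t) p u| ≤ n t ∧ |slope m (a t) q u| ≤ n t

/-- The open version of the bootstrap conditions. -/
def StrictlyControlled (m B : ℝ) (a n : ℝ → ℝ) (p q N Q u t : ℝ) : Prop :=
  (|p| < 1 ∧ |q| < 1) ∧ u ∈ Ioo (1 / 2 : ℝ) 2 ∧ (N ∈ Ioo B⁻¹ B ∧ Q ∈ Ioo B⁻¹ B) ∧
    |slope m (a t) p u| < n t ∧ |slope m (a t) q u| < n t

theorem StrictlyControlled.controlled {m B : ℝ} {a n : ℝ → ℝ} {p q N Q u t : ℝ}
    (h : StrictlyControlled m B a n p q N Q u t) : Controlled m B a n p q N Q u t :=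
  ⟨⟨h.1.1.le, h.1.2.le⟩, Ioo_subset_Icc_self h.2.1, ⟨Ioo_subset_Icc_self h.2.2.1.1,
    Ioo_subset_Icc_self h.2.2.1.2⟩, h.2.2.2.1.le, h.2.2.2.2.le⟩

theorem Controlled.symm {m B : ℝ} {a n : ℝ → ℝ} {p q N Q u t : ℝ}
    (h : Controlled m B a n p q N Q u t) : Controlled m B a n q p Q N u t :=
  ⟨h.1.symm, h.2.1, h.2.2.1.symm, h.2.2.2.symm⟩

/-- The data of the bootstrap argument: a damping coefficient `a` with primitive `A`, a bound `M₀`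
for the Riemann invariants, and a supersolution `n` of the Riccati equation of the slopes. -/
structure Bootstrap (m B T M₀ Θ : ℝ) (a a' A n n' u₀ v₀ p₀ q₀ : ℝ → ℝ) : Prop where
  m_nonneg : 0 ≤ m
  T_pos : 0 < T
  a_nonneg : ∀ t, 0 ≤ a t
  cont_a : Continuous a
  cont_n : Continuous n
  hasDerivAt_A : ∀ t, HasDerivAt A (a t) t
  A_zero : A 0 = 0
  hasDerivAt_a : ∀ t ∈ Ioo 0 T, HasDerivAt a (a' t) t
  hasDerivAt_n : ∀ t ∈ Ioo 0 T, HasDerivAt n (n' t) t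
  super : ∀ t ∈ Ioo 0 T, 2 * m * 2 ^ m * (n t + a t * Θ / 2) ^ 2
    + |a t ^ 2 / 4 + a' t / 2| * Θ ≤ n' t + a t / 2 * n t
  small : ∀ t ∈ Icc 0 T, 2 ^ m * (n t + a t * Θ / 2) < 1
  M₀_small : 4 ^ m * M₀ < 1 / 2
  Θ_eq : Θ = 2 ^ m * (4 ^ m * M₀)
  B_large : 2 * 4 ^ m * Real.exp (4 * m * T) < B
  u₀_mem : ∀ x, u₀ x ∈ Icc (1 / 2 : ℝ) 2
  invariant_add : ∀ x, |v₀ x + eta m (u₀ x)| ≤ M₀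
  invariant_sub : ∀ x, |v₀ x - eta m (u₀ x)| ≤ M₀
  slope_p : ∀ x, |slope m (a 0) (p₀ x) (u₀ x)| < n 0
  slope_q : ∀ x, |slope m (a 0) (q₀ x) (u₀ x)| < n 0

section

variable {m B T M₀ Θ : ℝ} {a a' A n n' u₀ v₀ p₀ q₀ : ℝ → ℝ} {D : Set (ℝ × ℝ)}

theorem Bootstrap.swap (h : Bootstrap m B T M₀ Θ a a' A n n' u₀ v₀ p₀ q₀) :
    Bootstrap m B T M₀ Θ a a' A n n' (fun x => u₀ (-x)) (fun x => -v₀ (-x)) (fun x => q₀ (-x))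
      (fun x => p₀ (-x)) :=
  { h with
    u₀_mem := fun x => h.u₀_mem _
    invariant_add := fun x => by
      rw [← abs_neg]
      convert h.invariant_sub (-x) using 2
      ring
    invariant_sub := fun x => by
      rw [← abs_neg]
      convert h.invariant_add (-x) using 2
      ring
    slope_p := fun x => h.slope_q _
    slope_q := fun x => h.slope_p _ }

/-- The points at which the bootstrap conditions hold. -/
def CharSol.controlled (S : CharSol m a u₀ v₀ p₀ q₀ D) (B : ℝ) (n : ℝ → ℝ) : Set (ℝ × ℝ) :=
  {z | Controlled m B a n (S.p z) (S.q z) (S.N z) (S.Q z) (S.u z) (S.t z)}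

/-- The points at which the bootstrap conditions hold in the whole triangle of dependence. -/
def CharSol.region (S : CharSol m a u₀ v₀ p₀ q₀ D) (B : ℝ) (n : ℝ → ℝ) : Set (ℝ × ℝ) :=
  dependenceRegion (S.controlled B n)

variable (S : CharSol m a u₀ v₀ p₀ q₀ D)

/-- The bootstrap conditions are symmetric under the reflection. An estimate along left-going
characteristics thus yields its right-going counterpart by applying it to `S.swap`. -/
theorem CharSol.mem_region_swap {z : ℝ × ℝ} :
    z ∈ S.swap.region B n ↔ z.swap ∈ S.region B n := by
  refine ⟨fun h => ⟨?_, fun s b hs hb hsb => ?_⟩, fun h => ⟨?_, fun s b hs hb hsb => ?_⟩⟩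
  · rw [add_comm]
    exact h.1
  · exact (h.2 b s hb hs (by rwa [add_comm])).symm
  · rw [add_comm]
    exact h.1
  · exact (h.2 b s hb hs (by rwa [add_comm])).symm

theorem CharSol.region_swap_subset (hR : S.region B n ⊆ D) :
    S.swap.region B n ⊆ Prod.swap ⁻¹' D := fun _ hz => hR (S.mem_region_swap.1 hz)

variable {S}

theorem Bootstrap.B_pos (h : Bootstrap m B T M₀ Θ a a' A n n' u₀ v₀ p₀ q₀) : 0 < B :=
  lt_trans (by positivity) h.B_large

theorem CharSol.N_pos (hB : 0 < B) {z : ℝ × ℝ} (hz : z ∈ S.region B n) : 0 < S.N z :=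
  (inv_pos.2 hB).trans_le (dependenceRegion_subset hz).2.2.1.1.1

theorem CharSol.Q_pos (hB : 0 < B) {z : ℝ × ℝ} (hz : z ∈ S.region B n) : 0 < S.Q z :=
  (inv_pos.2 hB).trans_le (dependenceRegion_subset hz).2.2.1.2.1

theorem CharSol.line_mem {ξ β : ℝ} (hz : (ξ, β) ∈ S.region B n) {s : ℝ} (hs : s ∈ Icc (-β) ξ) :
    (s, β) ∈ S.region B n :=
  dependenceRegion_mono_point hz hs.2 le_rfl (by linarith [hs.1])

theorem CharSol.t_lt_fst (hB : 0 < B) (hR : S.region B n ⊆ D) {ξ β s : ℝ}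
    (hz : (ξ, β) ∈ S.region B n) (h1 : -β ≤ s) (h2 : s < ξ) : S.t (s, β) < S.t (ξ, β) := by
  have hl : ∀ x ∈ Ioo s ξ, (x, β) ∈ S.region B n := fun x hx =>
    S.line_mem hz ⟨h1.trans hx.1.le, hx.2.le⟩
  exact lt_of_hasDerivAt_pos h2 (S.cont_t.comp (by fun_prop : Continuous fun x => (x, β))).continuousOn
    (fun x hx => S.t_fst x β (hR (hl x hx))) (fun x hx => S.N_pos hB (hl x hx))

theorem CharSol.t_lt_snd (hB : 0 < B) (hR : S.region B n ⊆ D) {ξ β s : ℝ}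
    (hz : (ξ, β) ∈ S.region B n) (h1 : -ξ ≤ s) (h2 : s < β) : S.t (ξ, s) < S.t (ξ, β) :=
  S.swap.t_lt_fst hB (S.region_swap_subset hR) (S.mem_region_swap.2 hz) h1 h2

theorem CharSol.t_pos (hB : 0 < B) (hR : S.region B n ⊆ D) {ξ β : ℝ}
    (hz : (ξ, β) ∈ S.region B n) (h : -β < ξ) : 0 < S.t (ξ, β) := by
  have := S.t_lt_fst hB hR hz le_rfl h
  rwa [S.t_diag] at this

theorem CharSol.t_nonneg (hB : 0 < B) (hR : S.region B n ⊆ D) {z : ℝ × ℝ}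
    (hz : z ∈ S.region B n) : 0 ≤ S.t z := by
  obtain ⟨ξ, β⟩ := z
  have h0 : 0 ≤ ξ + β := hz.1
  rcases (show -β ≤ ξ by linarith).eq_or_lt with h | h
  · rw [← h, S.t_diag]
  · exact (S.t_pos hB hR hz h).le

theorem CharSol.t_mono (hB : 0 < B) (hR : S.region B n ⊆ D) {ξ β s b : ℝ}
    (hz : (ξ, β) ∈ S.region B n) (hs : s ≤ ξ) (hb : b ≤ β) (hsb : 0 ≤ s + b) :
    S.t (s, b) ≤ S.t (ξ, β) := by
  have h1 : S.t (s, b) ≤ S.t (s, β) := by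
    rcases hb.eq_or_lt with h | h
    · rw [h]
    · exact (S.t_lt_snd hB hR (dependenceRegion_mono_point hz hs le_rfl (by linarith))
        (by linarith) h).le
  refine h1.trans ?_
  rcases hs.eq_or_lt with h | h
  · rw [h]
  · exact (S.t_lt_fst hB hR hz (by linarith) h).le

theorem CharSol.continuous_eta (S : CharSol m a u₀ v₀ p₀ q₀ D) :
    Continuous fun z => eta m (S.u z) := continuous_iff_continuousAt.2 fun z =>
  (hasDerivAt_eta m (S.u_pos z)).continuousAt.comp S.cont_u.continuousAt

theorem CharSol.continuous_theta (S : CharSol m a u₀ v₀ p₀ q₀ D) :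
    Continuous fun z => theta m (S.u z) := continuous_iff_continuousAt.2 fun z =>
  (hasDerivAt_theta m (S.u_pos z)).continuousAt.comp S.cont_u.continuousAt

/-- Along a left-going characteristic a bound for one Riemann invariant controls the other. -/
theorem CharSol.invariant_line (h : Bootstrap m B T M₀ Θ a a' A n n' u₀ v₀ p₀ q₀)
    (hR : S.region B n ⊆ D) {ξ β M : ℝ} (hz : (ξ, β) ∈ S.region B n)
    (hM : ∀ s ∈ Icc (-β) ξ, |S.v (s, β) - eta m (S.u (s, β))| ≤ M) (hlt : M₀ < M) :
    |S.v (ξ, β) + eta m (S.u (ξ, β))| < M := by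
  have hab : -β ≤ ξ := by linarith [hz.1]
  have hl : ∀ x ∈ Ioo (-β) ξ, (x, β) ∈ S.region B n := fun x hx =>
    S.line_mem hz ⟨hx.1.le, hx.2.le⟩
  have hcl : Continuous fun x : ℝ => (x, β) := by fun_prop
  have hAc : Continuous A := continuous_iff_continuousAt.2 fun s => (h.hasDerivAt_A s).continuousAt
  have hv := S.cont_v.comp hcl
  have he := S.continuous_eta.comp hcl
  have ht := S.cont_t.comp hcl
  simp only [Function.comp_def] at hv he ht
  have hr : ∀ x ∈ Ioo (-β) ξ, HasDerivAt (fun x => S.v (x, β) + eta m (S.u (x, β)))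
      (-(a (S.t (x, β)) * S.v (x, β) * S.N (x, β))) x := fun x hx => by
    have hx' := hR (hl x hx)
    have h2 := HasDerivAt.comp (h₂ := eta m) (h := fun s => S.u (s, β)) x
      (hasDerivAt_eta m (S.u_pos (x, β))) (S.u_fst x β hx')
    exact ((S.v_fst x β hx').add h2).congr_deriv (by ring)
  have hE : ∀ x ∈ Ioo (-β) ξ, HasDerivAt (fun x => Real.exp (A (S.t (x, β)) / 2))
      (Real.exp (A (S.t (x, β)) / 2) * (a (S.t (x, β)) * S.N (x, β) / 2)) x := fun x hx =>
    ((HasDerivAt.comp (h₂ := A) (h := fun s => S.t (s, β)) x (h.hasDerivAt_A _)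
      (S.t_fst x β (hR (hl x hx)))).div_const 2).exp
  have hdiag : ∀ σ : ℝ, |σ| = 1 → 0 < M + σ * (S.v (-β, β) + eta m (S.u (-β, β))) := by
    intro σ hσ
    rw [S.v_diag, S.u_diag]
    have h1 := h.invariant_add β
    have h2 : |σ * (v₀ β + eta m (u₀ β))| ≤ M₀ := by rwa [abs_mul, hσ, one_mul]
    linarith [(abs_le.1 h2).1]
  have key : ∀ σ : ℝ, |σ| = 1 → 0 < M + σ * (S.v (ξ, β) + eta m (S.u (ξ, β))) := by
    intro σ hσ
    have hσ2 : σ * σ = 1 := by rw [← abs_mul_abs_self, hσ, one_mul]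
    -- Write `r = v + eta u` and `s = v - eta u`, so `v = (r + s) / 2`. The factor `exp (A / 2)`
    -- absorbs the `r` part of the damping, and `exp (A / 2) (M + σ r)` has derivative proportional
    -- to `a (M - σ s) ≥ 0`.
    have := le_of_hasDerivAt_nonneg
      (f := fun x => Real.exp (A (S.t (x, β)) / 2) * (M + σ * (S.v (x, β) + eta m (S.u (x, β)))))
      hab (by fun_prop) (fun x hx => (hE x hx).mul (((hr x hx).const_mul σ).const_add M))
      (fun x hx => by
        have hN := S.N_pos h.B_pos (hl x hx)
        have ha := h.a_nonneg (S.t (x, β))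
        have hs := hM x ⟨hx.1.le, hx.2.le⟩
        have hs' : |σ * (S.v (x, β) - eta m (S.u (x, β)))| ≤ M := by rwa [abs_mul, hσ, one_mul]
        have hpos : 0 ≤ Real.exp (A (S.t (x, β)) / 2) * (a (S.t (x, β)) * S.N (x, β) / 2) *
            (M - σ * (S.v (x, β) - eta m (S.u (x, β)))) :=
          mul_nonneg (by positivity) (by linarith [(abs_le.1 hs').2])
        refine hpos.trans_eq ?_
        ring)
    exact (mul_pos_iff_of_pos_left (Real.exp_pos _)).1
      (lt_of_lt_of_le (mul_pos (Real.exp_pos _) (hdiag σ hσ)) this)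
  rw [abs_lt]
  have h1 := key 1 (by simp)
  have h2 := key (-1) (by simp)
  constructor <;> linarith

/-- The Riemann invariants do not grow. -/
theorem CharSol.invariant_le (h : Bootstrap m B T M₀ Θ a a' A n n' u₀ v₀ p₀ q₀)
    (hR : S.region B n ⊆ D) {z : ℝ × ℝ} (hz : z ∈ S.region B n) :
    |S.v z + eta m (S.u z)| ≤ M₀ ∧ |S.v z - eta m (S.u z)| ≤ M₀ := by
  rw [← max_le_iff]
  have hv := S.cont_v
  have he := S.continuous_eta
  have hc : Continuous fun k => max |S.v (triangle z k) + eta m (S.u (triangle z k))|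
      |S.v (triangle z k) - eta m (S.u (triangle z k))| := by
    have ht : Continuous fun k => triangle z k :=
      continuous_triangle.comp (by fun_prop : Continuous fun k : ℝ × ℝ => (z, k))
    exact ((hv.comp ht).add (he.comp ht)).abs.max ((hv.comp ht).sub (he.comp ht)).abs
  -- The larger of the two moduli attains its maximum `M` on the compact triangle. If `M₀ < M`, the
  -- line estimate at the maximum point gives strict inequality for both invariants, a
  -- contradiction.
  obtain ⟨k, hk, hmax⟩ := isCompact_square.exists_isMaxOn
    (⟨(0, 0), by simp [square]⟩ : square.Nonempty) hc.continuousOn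
  set M := max |S.v (triangle z k) + eta m (S.u (triangle z k))|
      |S.v (triangle z k) - eta m (S.u (triangle z k))| with hM
  have hall : ∀ s b, s ≤ z.1 → b ≤ z.2 → 0 ≤ s + b →
      max |S.v (s, b) + eta m (S.u (s, b))| |S.v (s, b) - eta m (S.u (s, b))| ≤ M := by
    intro s b hs hb hsb
    obtain ⟨j, hj, e⟩ := exists_triangle_eq hs hb hsb
    have := hmax hj
    simp only [mem_ofPred_eq, e] at this
    exact this
  refine (hall z.1 z.2 le_rfl le_rfl hz.1).trans ?_
  by_contra! hlt
  obtain ⟨k1, k2, k3⟩ := triangle_mem hz.1 hk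
  obtain ⟨ξ, β, hw⟩ : ∃ ξ β, triangle z k = (ξ, β) := ⟨_, _, rfl⟩
  rw [hw] at k1 k2 k3 hM
  simp only at k1 k2 k3
  have hzw : (ξ, β) ∈ S.region B n := dependenceRegion_mono_point hz k1 k2 k3
  have h1 : |S.v (ξ, β) + eta m (S.u (ξ, β))| < M :=
    S.invariant_line h hR hzw (fun s hs => (le_max_right _ _).trans
      (hall s β (hs.2.trans k1) k2 (by linarith [hs.1]))) hlt
  have h2 : |S.v (ξ, β) - eta m (S.u (ξ, β))| < M := by
    have := S.swap.invariant_line h.swap (S.region_swap_subset hR) (S.mem_region_swap.2 hzw)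
      (ξ := β) (β := ξ) (M := M) (fun s hs => by
        refine le_trans ?_ ((le_max_left _ _).trans
          (hall ξ s k1 (hs.2.trans k2) (by linarith [hs.1])))
        rw [← abs_neg]
        refine le_of_eq (congrArg _ ?_)
        simp only [CharSol.swap, Prod.swap_prod_mk]
        ring) hlt
    rw [← abs_neg] at this
    refine lt_of_eq_of_lt (congrArg _ ?_) this
    simp only [CharSol.swap, Prod.swap_prod_mk]
    ring
  exact absurd (max_lt h1 h2) (by rw [← hM]; exact lt_irrefl _)

theorem abs_sub_one_le_of_invariants {v u : ℝ} (hm : 0 ≤ m) (hu : u ∈ Icc (1 / 2 : ℝ) 2)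
    (h1 : |v + eta m u| ≤ M₀) (h2 : |v - eta m u| ≤ M₀) : |u - 1| ≤ 4 ^ m * M₀ := by
  refine (abs_sub_one_le_eta hm hu).trans ?_
  have : |eta m u| ≤ M₀ := by
    rw [abs_le] at h1 h2 ⊢
    constructor <;> linarith
  gcongr

theorem Bootstrap.abs_theta_le (h : Bootstrap m B T M₀ Θ a a' A n n' u₀ v₀ p₀ q₀) {u : ℝ}
    (hu : u ∈ Icc (1 / 2 : ℝ) 2) (hu1 : |u - 1| ≤ 4 ^ m * M₀) : |theta m u| ≤ Θ := by
  refine (abs_theta_bounds h.m_nonneg hu).1.trans ?_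
  rw [h.Θ_eq]
  gcongr

/-- Solving the definition of `slope` for `p` gives `|p| ≤ 2 ^ m (n + a Θ / 2)`, which the field
`small` keeps below `1`. -/
theorem Bootstrap.abs_lt_one (h : Bootstrap m B T M₀ Θ a a' A n n' u₀ v₀ p₀ q₀) {u p t : ℝ}
    (hu : u ∈ Icc (1 / 2 : ℝ) 2) (hu1 : |u - 1| ≤ 4 ^ m * M₀) (ht : t ∈ Icc 0 T)
    (hp : |slope m (a t) p u| ≤ n t) : |p| < 1 := by
  have hupos : 0 < u := lt_of_lt_of_le (by norm_num) hu.1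
  have hθ := h.abs_theta_le hu hu1
  have ha := h.a_nonneg t
  have e : p = u ^ m * (slope m (a t) p u - a t / 2 * theta m u) := by
    rw [slope, Real.rpow_neg hupos.le]
    have : u ^ m ≠ 0 := (Real.rpow_pos_of_pos hupos m).ne'
    field_simp
    ring
  have h1 : |slope m (a t) p u - a t / 2 * theta m u| ≤ n t + a t * Θ / 2 := by
    refine (abs_sub _ _).trans ?_
    rw [abs_mul, abs_of_nonneg (by positivity : 0 ≤ a t / 2)]
    nlinarith
  rw [e, abs_mul, abs_of_pos (Real.rpow_pos_of_pos hupos m)]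
  refine lt_of_le_of_lt ?_ (h.small t ht)
  have := (rpow_le_two_rpow h.m_nonneg hu).1
  gcongr

/-- The Riccati comparison along a left-going characteristic. -/
theorem CharSol.slope_lt (h : Bootstrap m B T M₀ Θ a a' A n n' u₀ v₀ p₀ q₀)
    (hR : S.region B n ⊆ D) {ξ β : ℝ} (hz : (ξ, β) ∈ S.region B n) (hT : S.t (ξ, β) ≤ T) :
    |slope m (a (S.t (ξ, β))) (S.p (ξ, β)) (S.u (ξ, β))| < n (S.t (ξ, β)) := by
  have hab : -β ≤ ξ := by linarith [hz.1]
  have hl : ∀ x ∈ Ioo (-β) ξ, (x, β) ∈ S.region B n := fun x hx =>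
    S.line_mem hz ⟨hx.1.le, hx.2.le⟩
  have htx : ∀ x ∈ Ioo (-β) ξ, S.t (x, β) ∈ Ioo 0 T := fun x hx =>
    ⟨S.t_pos h.B_pos hR (hl x hx) hx.1, (S.t_lt_fst h.B_pos hR hz hx.1.le hx.2).trans_le hT⟩
  have hcl : Continuous fun x : ℝ => (x, β) := by fun_prop
  have hAc : Continuous A := continuous_iff_continuousAt.2 fun s => (h.hasDerivAt_A s).continuousAt
  have hp := S.cont_p.comp hcl
  have hth := S.continuous_theta.comp hcl
  have ht := S.cont_t.comp hcl
  have hu := S.cont_u.comp hcl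
  simp only [Function.comp_def] at hp hth ht hu
  have hac := h.cont_a
  have hnc := h.cont_n
  have hum : Continuous fun x => S.u (x, β) ^ (-m) :=
    hu.rpow_const fun x => Or.inl (S.u_pos _).ne'
  -- Since `u_ξ = q N`, differentiating `u ^ (-m)` cancels the product `p q`, and differentiating
  -- `θ(u)` cancels the linear term in `q`.
  have hd : ∀ x ∈ Ioo (-β) ξ,
      HasDerivAt (fun x => slope m (a (S.t (x, β))) (S.p (x, β)) (S.u (x, β)))
      (S.N (x, β) * (-m / S.u (x, β) * S.u (x, β) ^ (-m) * S.p (x, β) ^ 2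
        - a (S.t (x, β)) / 2 * slope m (a (S.t (x, β))) (S.p (x, β)) (S.u (x, β))
        + (a (S.t (x, β)) ^ 2 / 4 + a' (S.t (x, β)) / 2) * theta m (S.u (x, β)))) x := by
    intro x hx
    have hx' := hR (hl x hx)
    have d1 : HasDerivAt (fun x => S.u (x, β) ^ (-m))
        (-m * S.u (x, β) ^ (-m - 1) * (S.q (x, β) * S.N (x, β))) x :=
      HasDerivAt.comp (h₂ := fun y => y ^ (-m)) (h := fun s => S.u (s, β)) x
        (Real.hasDerivAt_rpow_const (Or.inl (S.u_pos (x, β)).ne')) (S.u_fst x β hx')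
    have d2 := HasDerivAt.comp (h₂ := theta m) (h := fun s => S.u (s, β)) x
      (hasDerivAt_theta m (S.u_pos (x, β))) (S.u_fst x β hx')
    have d3 := HasDerivAt.comp (h₂ := a) (h := fun s => S.t (s, β)) x
      (h.hasDerivAt_a _ (htx x hx)) (S.t_fst x β hx')
    refine ((d1.mul (S.p_fst x β hx')).add ((d3.div_const 2).mul d2)).congr_deriv ?_
    simp only [Function.comp_apply, slope]
    rw [Real.rpow_sub_one (S.u_pos (x, β)).ne']
    ring
  have hE : ∀ x ∈ Ioo (-β) ξ, HasDerivAt (fun x => Real.exp (A (S.t (x, β)) / 2))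
      (Real.exp (A (S.t (x, β)) / 2) * (a (S.t (x, β)) * S.N (x, β) / 2)) x := fun x hx =>
    ((HasDerivAt.comp (h₂ := A) (h := fun s => S.t (s, β)) x (h.hasDerivAt_A _)
      (S.t_fst x β (hR (hl x hx)))).div_const 2).exp
  have hn : ∀ x ∈ Ioo (-β) ξ, HasDerivAt (fun x => n (S.t (x, β)))
      (n' (S.t (x, β)) * S.N (x, β)) x := fun x hx =>
    HasDerivAt.comp (h₂ := n) (h := fun s => S.t (s, β)) x (h.hasDerivAt_n _ (htx x hx))
      (S.t_fst x β (hR (hl x hx)))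
  have hquad : ∀ x ∈ Ioo (-β) ξ, ∀ σ : ℝ, |σ| = 1 → 0 ≤ n' (S.t (x, β)) +
      a (S.t (x, β)) / 2 * n (S.t (x, β)) + σ * (-m / S.u (x, β) * S.u (x, β) ^ (-m) *
        S.p (x, β) ^ 2 + (a (S.t (x, β)) ^ 2 / 4 + a' (S.t (x, β)) / 2) * theta m (S.u (x, β))) := by
    intro x hx σ hσ
    have hc := dependenceRegion_subset (hl x hx)
    obtain ⟨i1, i2⟩ := S.invariant_le h hR (hl x hx)
    have hθ := h.abs_theta_le hc.2.1 (abs_sub_one_le_of_invariants h.m_nonneg hc.2.1 i1 i2)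
    have hY : |slope m (a (S.t (x, β))) (S.p (x, β)) (S.u (x, β))| ≤ n (S.t (x, β)) := hc.2.2.2.1
    have hub : S.u (x, β) ∈ Icc (1 / 2 : ℝ) 2 := hc.2.1
    have hsup := h.super _ (htx x hx)
    have ha := h.a_nonneg (S.t (x, β))
    have hm := h.m_nonneg
    have hu0 := S.u_pos (x, β)
    generalize S.u (x, β) = u at *
    generalize S.p (x, β) = p at *
    generalize S.t (x, β) = t at *
    have hPu : u ^ m * u ^ (-m) = 1 := by
      rw [← Real.rpow_add hu0, add_neg_cancel, Real.rpow_zero]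
    have hy : |u ^ (-m) * p| ≤ n t + a t * Θ / 2 := by
      have e : u ^ (-m) * p = slope m (a t) p u - a t / 2 * theta m u := by
        rw [slope]
        ring
      rw [e]
      refine (abs_sub _ _).trans ?_
      rw [abs_mul, abs_of_nonneg (by positivity : 0 ≤ a t / 2)]
      nlinarith
    have hq : |-m / u * u ^ (-m) * p ^ 2| ≤ 2 * m * 2 ^ m * (n t + a t * Θ / 2) ^ 2 := by
      -- Expressed through `u ^ (-m) p`, the quadratic term has coefficient `m u⁻¹ u ^ m ≤ 2 m 2 ^
      -- m` for `u ∈ [1 / 2, 2]`; this is the constant in the field `super`.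
      have e : -m / u * u ^ (-m) * p ^ 2 = -(m * u⁻¹ * u ^ m * (u ^ (-m) * p) ^ 2) := by
        linear_combination (m / u * u ^ (-m) * p ^ 2) * hPu
      have hinv : u⁻¹ ≤ 2 := by
        rw [inv_le_comm₀ hu0 two_pos, ← one_div]
        exact hub.1
      have hum := (rpow_le_two_rpow hm hub).1
      have hump := (Real.rpow_pos_of_pos hu0 m).le
      have hsq : (u ^ (-m) * p) ^ 2 ≤ (n t + a t * Θ / 2) ^ 2 := sq_le_sq' (abs_le.1 hy).1 (abs_le.1 hy).2
      rw [e, abs_neg, abs_of_nonneg (by positivity), mul_comm 2 m]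
      gcongr
    have hs : |σ * (-m / u * u ^ (-m) * p ^ 2 + (a t ^ 2 / 4 + a' t / 2) * theta m u)| ≤
        2 * m * 2 ^ m * (n t + a t * Θ / 2) ^ 2 + |a t ^ 2 / 4 + a' t / 2| * Θ := by
      rw [abs_mul, hσ, one_mul]
      refine (abs_add_le _ _).trans (add_le_add hq ?_)
      rw [abs_mul]
      gcongr
    linarith [(abs_le.1 hs).1]
  have hdiag : ∀ σ : ℝ, |σ| = 1 → 0 < n (S.t (-β, β)) +
      σ * slope m (a (S.t (-β, β))) (S.p (-β, β)) (S.u (-β, β)) := by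
    intro σ hσ
    rw [S.t_diag, S.u_diag, S.p_diag]
    have h2 : |σ * slope m (a 0) (p₀ β) (u₀ β)| < n 0 := by
      rw [abs_mul, hσ, one_mul]
      exact h.slope_p β
    linarith [(abs_lt.1 h2).1]
  have key : ∀ σ : ℝ, |σ| = 1 → 0 < n (S.t (ξ, β)) +
      σ * slope m (a (S.t (ξ, β))) (S.p (ξ, β)) (S.u (ξ, β)) := by
    intro σ hσ
    -- Multiplied by `exp (A / 2)`, the quantity `n ± Y` is nondecreasing along the characteristic.
    -- It is strictly positive initially, so the final inequality is strict even though `super` is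
    -- not.
    have := le_of_hasDerivAt_nonneg
      (f := fun x => Real.exp (A (S.t (x, β)) / 2) * (n (S.t (x, β)) +
        σ * slope m (a (S.t (x, β))) (S.p (x, β)) (S.u (x, β))))
      hab (by unfold slope; fun_prop) (fun x hx => (hE x hx).mul ((hn x hx).add ((hd x hx).const_mul σ)))
      (fun x hx => by
        have hN := S.N_pos h.B_pos (hl x hx)
        have hpos := mul_nonneg (mul_nonneg (Real.exp_pos (A (S.t (x, β)) / 2)).le hN.le)
          (hquad x hx σ hσ)
        refine hpos.trans_eq ?_
        ring)
    exact (mul_pos_iff_of_pos_left (Real.exp_pos _)).1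
      (lt_of_lt_of_le (mul_pos (Real.exp_pos _) (hdiag σ hσ)) this)
  rw [abs_lt]
  have h1 := key 1 (by simp)
  have h2 := key (-1) (by simp)
  constructor <;> linarith

theorem Bootstrap.initial_density (h : Bootstrap m B T M₀ Θ a a' A n n' u₀ v₀ p₀ q₀) (x : ℝ) :
    (2 * 4 ^ m)⁻¹ ≤ 1 / (2 * speed m (u₀ x)) ∧ 1 / (2 * speed m (u₀ x)) ≤ 4 ^ m / 2 := by
  obtain ⟨h1, h2⟩ := speed_bounds h.m_nonneg (h.u₀_mem x)
  have h0 : 0 < speed m (u₀ x) := speed_pos m (lt_of_lt_of_le (by norm_num) (h.u₀_mem x).1)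
  have h4 : (0:ℝ) < 4 ^ m := by positivity
  constructor
  · rw [one_div]
    exact inv_anti₀ (by positivity) (by linarith)
  · rw [inv_le_iff_one_le_mul₀' h4] at h2
    rw [div_le_div_iff₀ (by positivity) two_pos]
    linarith

/-- With respect to time, `log Q` has rate `(m / u) (p + q)`, of modulus at most `4 m`. Hence `exp
(± 4 m t) Q` are monotone in opposite directions. The resulting bound depends on `T`, which is
harmless: only positivity and finiteness of the densities matter. -/
theorem CharSol.Q_mem (h : Bootstrap m B T M₀ Θ a a' A n n' u₀ v₀ p₀ q₀)
    (hR : S.region B n ⊆ D) {ξ β : ℝ} (hz : (ξ, β) ∈ S.region B n) (hT : S.t (ξ, β) ≤ T) :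
    S.Q (ξ, β) ∈ Ioo B⁻¹ B := by
  have hab : -β ≤ ξ := by linarith [hz.1]
  have hl : ∀ x ∈ Ioo (-β) ξ, (x, β) ∈ S.region B n := fun x hx =>
    S.line_mem hz ⟨hx.1.le, hx.2.le⟩
  have hcl : Continuous fun x : ℝ => (x, β) := by fun_prop
  have hQ := S.cont_Q.comp hcl
  have ht := S.cont_t.comp hcl
  simp only [Function.comp_def] at hQ ht
  have hm := h.m_nonneg
  have hE : ∀ σ : ℝ, ∀ x ∈ Ioo (-β) ξ, HasDerivAt (fun x => Real.exp (σ * S.t (x, β)))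
      (Real.exp (σ * S.t (x, β)) * (σ * S.N (x, β))) x := fun σ x hx =>
    ((S.t_fst x β (hR (hl x hx))).const_mul σ).exp
  have hrate : ∀ x ∈ Ioo (-β) ξ, |m / S.u (x, β) * (S.p (x, β) + S.q (x, β))| ≤ 4 * m := by
    intro x hx
    have hc := dependenceRegion_subset (hl x hx)
    have hu0 := S.u_pos (x, β)
    have hinv : (S.u (x, β))⁻¹ ≤ 2 := by
      rw [inv_le_comm₀ hu0 two_pos, ← one_div]
      exact hc.2.1.1
    have hpq : |S.p (x, β) + S.q (x, β)| ≤ 2 :=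
      (abs_add_le _ _).trans (by linarith [hc.1.1, hc.1.2])
    rw [abs_mul, abs_of_nonneg (by positivity), div_eq_mul_inv]
    calc m * (S.u (x, β))⁻¹ * |S.p (x, β) + S.q (x, β)| ≤ m * 2 * 2 := by gcongr
      _ = 4 * m := by ring
  have hup := le_of_hasDerivAt_nonneg (f := fun x => Real.exp (4 * m * S.t (x, β)) * S.Q (x, β))
    hab (by fun_prop) (fun x hx => (hE (4 * m) x hx).mul (S.Q_fst x β (hR (hl x hx))))
    (fun x hx => by
      have hN := S.N_pos h.B_pos (hl x hx)
      have hQ := S.Q_pos h.B_pos (hl x hx)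
      have hpos := mul_nonneg (mul_nonneg (mul_nonneg (Real.exp_pos (4 * m * S.t (x, β))).le hN.le)
        hQ.le) (by linarith [(abs_le.1 (hrate x hx)).1] :
          0 ≤ 4 * m + m / S.u (x, β) * (S.p (x, β) + S.q (x, β)))
      refine hpos.trans_eq ?_
      ring)
  have hdn := le_of_hasDerivAt_nonneg
    (f := fun x => -(Real.exp (-(4 * m) * S.t (x, β)) * S.Q (x, β)))
    hab (by fun_prop) (fun x hx => ((hE (-(4 * m)) x hx).mul (S.Q_fst x β (hR (hl x hx)))).neg)
    (fun x hx => by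
      have hN := S.N_pos h.B_pos (hl x hx)
      have hQ := S.Q_pos h.B_pos (hl x hx)
      have hpos := mul_nonneg (mul_nonneg (mul_nonneg (Real.exp_pos (-(4 * m) * S.t (x, β))).le
        hN.le) hQ.le) (by linarith [(abs_le.1 (hrate x hx)).2] :
          0 ≤ 4 * m - m / S.u (x, β) * (S.p (x, β) + S.q (x, β)))
      refine hpos.trans_eq ?_
      ring)
  simp only [S.t_diag, S.Q_diag, mul_zero, Real.exp_zero, one_mul] at hup hdn
  obtain ⟨b1, b2⟩ := h.initial_density β
  have hmt : 4 * m * S.t (ξ, β) ≤ 4 * m * T := by gcongr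
  have hexp : Real.exp (4 * m * S.t (ξ, β)) ≤ Real.exp (4 * m * T) := Real.exp_le_exp.2 hmt
  have hB := h.B_large
  have h4 : (0:ℝ) < 4 ^ m := by positivity
  have hQ0 := S.Q_pos h.B_pos hz
  constructor
  · have h1 : (2 * 4 ^ m)⁻¹ ≤ Real.exp (4 * m * T) * S.Q (ξ, β) :=
      b1.trans (hup.trans (by gcongr))
    rw [inv_le_iff_one_le_mul₀' (by positivity)] at h1
    rw [inv_lt_iff_one_lt_mul₀' h.B_pos]
    refine h1.trans_lt ?_
    rw [← mul_assoc]
    gcongr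
  · have h1 : S.Q (ξ, β) = Real.exp (4 * m * S.t (ξ, β)) *
        (Real.exp (-(4 * m) * S.t (ξ, β)) * S.Q (ξ, β)) := by
      rw [← mul_assoc, ← Real.exp_add]
      simp
    rw [h1]
    calc _ ≤ Real.exp (4 * m * T) * (4 ^ m / 2) := by
          gcongr
          linarith
      _ < B := by nlinarith [mul_pos h4 (Real.exp_pos (4 * m * T))]

/-- The bootstrap: up to time `T` the closed conditions imply the open ones. -/
theorem CharSol.strictlyControlled (h : Bootstrap m B T M₀ Θ a a' A n n' u₀ v₀ p₀ q₀)
    (hR : S.region B n ⊆ D) {z : ℝ × ℝ} (hz : z ∈ S.region B n) (hT : S.t z ≤ T) :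
    StrictlyControlled m B a n (S.p z) (S.q z) (S.N z) (S.Q z) (S.u z) (S.t z) := by
  obtain ⟨ξ, β⟩ := z
  have hc := dependenceRegion_subset hz
  obtain ⟨i1, i2⟩ := S.invariant_le h hR hz
  have hu1 := abs_sub_one_le_of_invariants h.m_nonneg hc.2.1 i1 i2
  have ht : S.t (ξ, β) ∈ Icc 0 T := ⟨S.t_nonneg h.B_pos hR hz, hT⟩
  have hz' : (β, ξ) ∈ S.swap.region B n := S.mem_region_swap.2 hz
  have hR' := S.region_swap_subset hR
  refine ⟨⟨h.abs_lt_one hc.2.1 hu1 ht hc.2.2.2.1, h.abs_lt_one hc.2.1 hu1 ht hc.2.2.2.2⟩, ?_,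
    ⟨S.swap.Q_mem h.swap hR' hz' hT, S.Q_mem h hR hz hT⟩, S.slope_lt h hR hz hT,
    S.swap.slope_lt h.swap hR' hz' hT⟩
  have := abs_lt.1 (hu1.trans_lt h.M₀_small)
  constructor <;> linarith [this.1, this.2]

theorem Bootstrap.initial_controlled (h : Bootstrap m B T M₀ Θ a a' A n n' u₀ v₀ p₀ q₀) (x : ℝ) :
    Controlled m B a n (p₀ x) (q₀ x) (1 / (2 * speed m (u₀ x))) (1 / (2 * speed m (u₀ x))) (u₀ x)
      0 := by
  have hu1 := abs_sub_one_le_of_invariants h.m_nonneg (h.u₀_mem x) (h.invariant_add x)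
    (h.invariant_sub x)
  have ht : (0:ℝ) ∈ Icc 0 T := ⟨le_rfl, h.T_pos.le⟩
  obtain ⟨b1, b2⟩ := h.initial_density x
  have hm := h.m_nonneg
  have he : 1 ≤ Real.exp (4 * m * T) := Real.one_le_exp (mul_nonneg (by positivity) h.T_pos.le)
  have h4 : (0:ℝ) < 4 ^ m := by positivity
  have hB : 2 * 4 ^ m ≤ B := by nlinarith [h.B_large]
  have hN : 1 / (2 * speed m (u₀ x)) ∈ Icc B⁻¹ B :=
    ⟨(inv_anti₀ (by positivity) hB).trans b1, by linarith⟩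
  exact ⟨⟨(h.abs_lt_one (h.u₀_mem x) hu1 ht (h.slope_p x).le).le,
    (h.abs_lt_one (h.u₀_mem x) hu1 ht (h.slope_q x).le).le⟩, h.u₀_mem x, ⟨hN, hN⟩,
    (h.slope_p x).le, (h.slope_q x).le⟩

/-- The initial line belongs to the region. -/
theorem CharSol.diag_mem_region (h : Bootstrap m B T M₀ Θ a a' A n n' u₀ v₀ p₀ q₀) (x : ℝ) :
    (-x, x) ∈ S.region B n := by
  refine ⟨by simp, fun s b hs hb hsb => ?_⟩
  simp only at hs hb
  obtain rfl : b = x := by linarith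
  obtain rfl : s = -b := by linarith
  simp only [CharSol.controlled, mem_ofPred_eq, S.p_diag, S.q_diag, S.N_diag, S.Q_diag, S.u_diag,
    S.t_diag]
  exact h.initial_controlled b

theorem CharSol.continuous_slope (S : CharSol m a u₀ v₀ p₀ q₀ D) (ha : Continuous a)
    {p : ℝ × ℝ → ℝ} (hp : Continuous p) : Continuous fun z => slope m (a (S.t z)) (p z) (S.u z) := by
  have h1 : Continuous fun z => S.u z ^ (-m) :=
    S.cont_u.rpow_const fun x => Or.inl (S.u_pos _).ne'
  have h2 := S.continuous_theta
  have h3 := ha.comp S.cont_t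
  simp only [Function.comp_def] at h3
  exact (h1.mul hp).add ((h3.div_const 2).mul h2)

theorem CharSol.isClosed_region (S : CharSol m a u₀ v₀ p₀ q₀ D) (ha : Continuous a)
    (hn : Continuous n) : IsClosed (S.region B n) := by
  refine isClosed_dependenceRegion ?_
  have hn' := hn.comp S.cont_t
  exact ((isClosed_le S.cont_p.abs continuous_const).inter
    (isClosed_le S.cont_q.abs continuous_const)).inter
    ((isClosed_Icc.preimage S.cont_u).inter (((isClosed_Icc.preimage S.cont_N).inter
    (isClosed_Icc.preimage S.cont_Q)).inter
    ((isClosed_le (S.continuous_slope ha S.cont_p).abs hn').inter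
    (isClosed_le (S.continuous_slope ha S.cont_q).abs hn'))))

/-- Up to time `T` the region is relatively open in the half plane. -/
theorem CharSol.eventually_mem_region (h : Bootstrap m B T M₀ Θ a a' A n n' u₀ v₀ p₀ q₀)
    (hR : S.region B n ⊆ D) {z : ℝ × ℝ} (hz : z ∈ S.region B n) (hT : S.t z ≤ T) :
    ∀ᶠ w in 𝓝 z, 0 ≤ w.1 + w.2 → w ∈ S.region B n := by
  -- Time is monotone in both coordinates, so the whole triangle below `z` lies at times at most
  -- `T`, and the strict bounds hold at each of its points.
  refine eventually_mem_dependenceRegion (fun s b hs hb hsb => ?_) hz.1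
  have hn' := h.cont_n.comp S.cont_t
  have ho : IsOpen {w | StrictlyControlled m B a n (S.p w) (S.q w) (S.N w) (S.Q w) (S.u w) (S.t w)} :=
    ((isOpen_lt S.cont_p.abs continuous_const).inter
    (isOpen_lt S.cont_q.abs continuous_const)).inter
    ((isOpen_Ioo.preimage S.cont_u).inter (((isOpen_Ioo.preimage S.cont_N).inter
    (isOpen_Ioo.preimage S.cont_Q)).inter
    ((isOpen_lt (S.continuous_slope h.cont_a S.cont_p).abs hn').inter
    (isOpen_lt (S.continuous_slope h.cont_a S.cont_q).abs hn'))))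
  refine mem_of_superset (ho.mem_nhds (S.strictlyControlled h hR
    (dependenceRegion_mono_point hz hs hb hsb) ((S.t_mono h.B_pos hR hz hs hb hsb).trans hT)))
    fun w hw => StrictlyControlled.controlled hw

end

end

/-! ### Inversion of the map from characteristic coordinates to time and space. -/

section

/-- The differential of `(t, x)` with respect to the characteristic coordinates. -/
def charEquiv {N Q c : ℝ} (hN : N ≠ 0) (hQ : Q ≠ 0) (hc : c ≠ 0) : (ℝ × ℝ) ≃L[ℝ] (ℝ × ℝ) :=
  ContinuousLinearEquiv.equivOfInverse
    ((planeForm N Q).prod (planeForm (-(c * N)) (c * Q)))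
    ((planeForm (1 / (2 * N)) (-(1 / (2 * c * N)))).prod (planeForm (1 / (2 * Q)) (1 / (2 * c * Q))))
    (fun z => by
      ext <;> simp <;> field_simp <;> ring)
    (fun z => by
      ext <;> simp <;> field_simp <;> ring)

theorem contDiffOn_of_planeForm {U : Set (ℝ × ℝ)} (hU : UniqueDiffOn ℝ U) {f a b : ℝ × ℝ → ℝ}
    (hf : ∀ y ∈ U, HasFDerivWithinAt f (planeForm (a y) (b y)) U y)
    (ha : ContinuousOn a U) (hb : ContinuousOn b U) : ContDiffOn ℝ 1 f U := by
  have := (contDiffOn_succ_iff_hasFDerivWithinAt_of_uniqueDiffOn (𝕜 := ℝ) (n := 0) (f := f) hU).2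
    ⟨by simp, fun y => planeForm (a y) (b y), ?_, hf⟩
  · simpa using this
  · rw [contDiffOn_zero]
    exact (ha.smul continuousOn_const).add (hb.smul continuousOn_const)

section

variable {m B T M₀ Θ : ℝ} {a a' A n n' u₀ v₀ p₀ q₀ : ℝ → ℝ} {D : Set (ℝ × ℝ)}
  {S : CharSol m a u₀ v₀ p₀ q₀ D}

theorem CharSol.continuous_speed (S : CharSol m a u₀ v₀ p₀ q₀ D) :
    Continuous fun z => speed m (S.u z) :=
  S.cont_u.rpow_const fun z => Or.inl (S.u_pos z).ne'

/-- The map from characteristic coordinates to time and space. -/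
def CharSol.toTimeSpace (S : CharSol m a u₀ v₀ p₀ q₀ D) (z : ℝ × ℝ) : ℝ × ℝ := (S.t z, S.X z)

/-- The Jacobian determinant is `2 c N Q`, so nonvanishing densities make the map a local
diffeomorphism. -/
theorem CharSol.hasStrictFDerivAt_toTimeSpace (hD : IsOpen D) {z : ℝ × ℝ} (hz : z ∈ D)
    (hN : S.N z ≠ 0) (hQ : S.Q z ≠ 0) :
    HasStrictFDerivAt S.toTimeSpace
      (charEquiv hN hQ (speed_pos m (S.u_pos z)).ne' : ℝ × ℝ →L[ℝ] ℝ × ℝ) z := by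
  have hs := S.continuous_speed
  have h1 := hasStrictFDerivAt_of_partials hD S.cont_Q S.cont_N S.t_fst S.t_snd hz
  have h2 := hasStrictFDerivAt_of_partials hD (hs.mul S.cont_Q) (hs.mul S.cont_N).neg
    S.X_fst S.X_snd hz
  exact h1.prodMk h2

theorem CharSol.hasStrictFDerivAt_u (hD : IsOpen D) {z : ℝ × ℝ} (hz : z ∈ D) :
    HasStrictFDerivAt S.u (planeForm (S.q z * S.N z) (S.p z * S.Q z)) z :=
  hasStrictFDerivAt_of_partials hD (S.cont_p.mul S.cont_Q) (S.cont_q.mul S.cont_N)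
    S.u_fst S.u_snd hz

theorem CharSol.hasStrictFDerivAt_v (ha : Continuous a) (hD : IsOpen D) {z : ℝ × ℝ} (hz : z ∈ D) :
    HasStrictFDerivAt S.v
      (planeForm (-(a (S.t z) * S.v z * S.N z) - speed m (S.u z) * S.q z * S.N z)
        (-(a (S.t z) * S.v z * S.Q z) + speed m (S.u z) * S.p z * S.Q z)) z := by
  have hs := S.continuous_speed
  have hat := ha.comp S.cont_t
  exact hasStrictFDerivAt_of_partials hD
    (((hat.mul S.cont_v).mul S.cont_Q).neg.add ((hs.mul S.cont_p).mul S.cont_Q))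
    (((hat.mul S.cont_v).mul S.cont_N).neg.sub ((hs.mul S.cont_q).mul S.cont_N))
    S.v_fst S.v_snd hz

/-- Space decreases along left-going characteristics, at most with the maximal speed. -/
theorem CharSol.X_bounds_fst (hm : 0 ≤ m) (hB : 0 < B) (hR : S.region B n ⊆ D) {ξ β : ℝ}
    (hz : (ξ, β) ∈ S.region B n) : β - 4 ^ m * S.t (ξ, β) ≤ S.X (ξ, β) ∧ S.X (ξ, β) ≤ β := by
  have hab : -β ≤ ξ := by linarith [hz.1]
  have hl : ∀ x ∈ Ioo (-β) ξ, (x, β) ∈ S.region B n := fun x hx =>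
    S.line_mem hz ⟨hx.1.le, hx.2.le⟩
  have hcl : Continuous fun x : ℝ => (x, β) := by fun_prop
  have hX := S.cont_X.comp hcl
  have ht := S.cont_t.comp hcl
  have h1 := le_of_hasDerivAt_nonneg (f := fun x => S.X (x, β) + 4 ^ m * S.t (x, β)) hab
    (hX.add (ht.const_mul _)).continuousOn
    (fun x hx => (S.X_fst x β (hR (hl x hx))).add ((S.t_fst x β (hR (hl x hx))).const_mul _))
    (fun x hx => by
      have h := (speed_bounds hm (dependenceRegion_subset (hl x hx)).2.1).1
      nlinarith [S.N_pos hB (hl x hx)])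
  have h2 := le_of_hasDerivAt_nonneg (f := fun x => -S.X (x, β)) hab hX.neg.continuousOn
    (fun x hx => (S.X_fst x β (hR (hl x hx))).neg)
    (fun x hx => by
      have h := speed_pos m (S.u_pos (x, β))
      have := mul_pos h (S.N_pos hB (hl x hx))
      linarith)
  simp only [S.X_diag, S.t_diag] at h1 h2
  constructor <;> linarith

theorem CharSol.X_bounds_snd (hm : 0 ≤ m) (hB : 0 < B) (hR : S.region B n ⊆ D) {ξ β : ℝ}
    (hz : (ξ, β) ∈ S.region B n) : -ξ ≤ S.X (ξ, β) ∧ S.X (ξ, β) ≤ -ξ + 4 ^ m * S.t (ξ, β) := by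
  obtain ⟨h1, h2⟩ := S.swap.X_bounds_fst hm hB (S.region_swap_subset hR) (S.mem_region_swap.2 hz)
    (ξ := β) (β := ξ)
  simp only [CharSol.swap, Prod.swap_prod_mk] at h1 h2
  constructor <;> linarith

theorem CharSol.X_lt_fst (hB : 0 < B) (hR : S.region B n ⊆ D) {ξ β s : ℝ}
    (hz : (ξ, β) ∈ S.region B n) (h1 : -β ≤ s) (h2 : s < ξ) : S.X (ξ, β) < S.X (s, β) := by
  have hl : ∀ x ∈ Ioo s ξ, (x, β) ∈ S.region B n := fun x hx =>
    S.line_mem hz ⟨h1.trans hx.1.le, hx.2.le⟩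
  have := lt_of_hasDerivAt_pos h2 (f := fun x => -S.X (x, β))
    (S.cont_X.comp (by fun_prop : Continuous fun x => (x, β))).neg.continuousOn
    (fun x hx => (S.X_fst x β (hR (hl x hx))).neg) (fun x hx => by
      have := mul_pos (speed_pos m (S.u_pos (x, β))) (S.N_pos hB (hl x hx))
      linarith)
  linarith

theorem CharSol.X_lt_snd (hB : 0 < B) (hR : S.region B n ⊆ D) {ξ β s : ℝ}
    (hz : (ξ, β) ∈ S.region B n) (h1 : -ξ ≤ s) (h2 : s < β) : S.X (ξ, s) < S.X (ξ, β) := by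
  have := S.swap.X_lt_fst hB (S.region_swap_subset hR) (S.mem_region_swap.2 hz)
    (ξ := β) (β := ξ) h1 h2
  simp only [CharSol.swap, Prod.swap_prod_mk] at this
  linarith

/-- Time is strictly increasing in both coordinates, while space decreases in `ξ` and increases in
`β`. Points ordered the same way in both coordinates differ in time, and points ordered oppositely
differ in space. -/
theorem CharSol.toTimeSpace_injOn (hm : 0 ≤ m) (hB : 0 < B) (hR : S.region B n ⊆ D) :
    InjOn S.toTimeSpace (S.region B n) := by
  have key : ∀ ξ₁ β₁ ξ₂ β₂, (ξ₁, β₁) ∈ S.region B n → (ξ₂, β₂) ∈ S.region B n →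
      S.t (ξ₁, β₁) = S.t (ξ₂, β₂) → S.X (ξ₁, β₁) = S.X (ξ₂, β₂) → ¬ ξ₁ < ξ₂ := by
    intro ξ₁ β₁ ξ₂ β₂ h₁ h₂ ht hX hlt
    have p₁ : 0 ≤ ξ₁ + β₁ := h₁.1
    have p₂ : 0 ≤ ξ₂ + β₂ := h₂.1
    have hβ : β₂ < β₁ := by
      by_contra! hle
      have e1 := S.t_mono hB hR h₂ le_rfl hle (by linarith : 0 ≤ ξ₂ + β₁)
      have e2 := S.t_lt_fst hB hR
        (dependenceRegion_mono_point h₂ le_rfl hle (by linarith : 0 ≤ ξ₂ + β₁))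
        (by linarith : -β₁ ≤ ξ₁) hlt
      linarith
    -- The comparison passes through the corner `(ξ₁, β₂)`. If it lies below the initial line, the
    -- two triangles have disjoint bases and `-ξ ≤ X ≤ β` separates the points directly.
    rcases le_or_gt 0 (ξ₁ + β₂) with h | h
    · have e1 := S.X_lt_snd hB hR h₁ (by linarith) hβ
      have e2 := S.X_lt_fst hB hR h₂ (by linarith) hlt
      linarith
    · have e1 := (S.X_bounds_snd hm hB hR h₁).1
      have e2 := (S.X_bounds_fst hm hB hR h₂).2
      linarith
  rintro ⟨ξ₁, β₁⟩ h₁ ⟨ξ₂, β₂⟩ h₂ h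
  obtain ⟨ht, hX⟩ := Prod.ext_iff.1 h
  simp only [CharSol.toTimeSpace] at ht hX
  obtain rfl : ξ₁ = ξ₂ := le_antisymm (not_lt.1 (key _ _ _ _ h₂ h₁ ht.symm hX.symm))
    (not_lt.1 (key _ _ _ _ h₁ h₂ ht hX))
  have p₁ : 0 ≤ ξ₁ + β₁ := h₁.1
  have p₂ : 0 ≤ ξ₁ + β₂ := h₂.1
  rcases lt_trichotomy β₁ β₂ with hlt | rfl | hlt
  · have := S.t_lt_snd hB hR h₂ (by linarith) hlt
    linarith
  · rfl
  · have := S.t_lt_snd hB hR h₁ (by linarith) hlt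
    linarith

/-- Near a point of the region, nonnegative time characterizes the half plane. -/
theorem CharSol.eventually_halfPlane (hB : 0 < B) (hD : IsOpen D) (hR : S.region B n ⊆ D)
    {z : ℝ × ℝ} (hz : z ∈ S.region B n) : ∀ᶠ w in 𝓝 z, 0 ≤ S.t w → 0 ≤ w.1 + w.2 := by
  rcases (show 0 ≤ z.1 + z.2 from hz.1).eq_or_lt with h0 | h0
  · have hev : ∀ᶠ w in 𝓝 z, w ∈ D ∧ 0 < S.Q w :=
      (hD.eventually_mem (hR hz)).and (S.cont_Q.continuousAt.eventually (lt_mem_nhds (S.Q_pos hB hz)))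
    obtain ⟨δ, hδ, hball⟩ := Metric.eventually_nhds_iff_ball.1 hev
    filter_upwards [Metric.ball_mem_nhds z hδ] with w hw ht
    by_contra! hneg
    rw [Metric.mem_ball, Prod.dist_eq, max_lt_iff, Real.dist_eq, Real.dist_eq, abs_lt, abs_lt] at hw
    -- A point just below the initial line reaches it along a short segment on which `t_β = Q > 0`,
    -- so its time is negative.
    have hl : ∀ b ∈ Ioo w.2 (-w.1), (w.1, b) ∈ D ∧ 0 < S.Q (w.1, b) := by
      intro b hb
      refine hball _ ?_
      rw [Metric.mem_ball, Prod.dist_eq, max_lt_iff, Real.dist_eq, Real.dist_eq, abs_lt, abs_lt]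
      refine ⟨hw.1, ?_, ?_⟩ <;> simp only <;> linarith [hb.1, hb.2, hw.1.1, hw.2.1, hw.1.2]
    have := lt_of_hasDerivAt_pos (show w.2 < -w.1 by linarith) (f := fun b => S.t (w.1, b))
      (S.cont_t.comp (by fun_prop : Continuous fun b => (w.1, b))).continuousOn
      (fun b hb => S.t_snd w.1 b (hl b hb).1) (fun b hb => (hl b hb).2)
    have hd := S.t_diag (-w.1)
    rw [neg_neg] at hd
    rw [hd] at this
    exact absurd ht (not_le.2 this)
  · have hc : ContinuousAt (fun w : ℝ × ℝ => w.1 + w.2) z := by fun_prop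
    filter_upwards [hc.eventually (lt_mem_nhds h0)] with w hw _
    exact hw.le

theorem CharSol.eventually_mem_region_of_nonneg
    (h : Bootstrap m B T M₀ Θ a a' A n n' u₀ v₀ p₀ q₀) (hD : IsOpen D) (hR : S.region B n ⊆ D)
    {z : ℝ × ℝ} (hz : z ∈ S.region B n) (hT : S.t z ≤ T) :
    ∀ᶠ w in 𝓝 z, 0 ≤ S.t w → w ∈ S.region B n := by
  filter_upwards [S.eventually_mem_region h hR hz hT, S.eventually_halfPlane h.B_pos hD hR hz]
    with w h1 h2 ht using h1 (h2 ht)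

/-- The characteristic coordinates reach every point of space up to time `T`. -/
theorem CharSol.exists_region_eq (h : Bootstrap m B T M₀ Θ a a' A n n' u₀ v₀ p₀ q₀)
    (hD : IsOpen D) (hR : S.region B n ⊆ D) {τ : ℝ} (hτ : τ ∈ Icc 0 T) (x : ℝ) :
    ∃ z ∈ S.region B n, S.t z = τ ∧ S.X z = x := by
  have hm := h.m_nonneg
  have hB := h.B_pos
  set s : Set ℝ := {τ | ∃ z ∈ S.region B n, S.t z = τ ∧ S.X z = x} with hs
  suffices Icc 0 T ⊆ s from this hτ
  refine IsClosed.Icc_subset_of_forall_exists_gt ?_ ⟨(-x, x), S.diag_mem_region h x, S.t_diag x,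
    S.X_diag x⟩ ?_
  -- Closedness of the set of reached times: by finite propagation speed, the region points above a
  -- fixed `x` up to time `T` form a compact set.
  · set K : Set (ℝ × ℝ) := S.region B n ∩ {z | S.X z = x} ∩ {z | S.t z ≤ T} with hK
    have hKc : IsClosed K := ((S.isClosed_region h.cont_a h.cont_n).inter
      (isClosed_eq S.cont_X continuous_const)).inter (isClosed_le S.cont_t continuous_const)
    have hKb : K ⊆ Icc (-x) (-x + 4 ^ m * T) ×ˢ Icc x (x + 4 ^ m * T) := by
      rintro ⟨ξ, β⟩ ⟨⟨hz, hX⟩, ht⟩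
      simp only [mem_ofPred_eq] at hX ht
      obtain ⟨e1, e2⟩ := S.X_bounds_fst hm hB hR hz
      obtain ⟨e3, e4⟩ := S.X_bounds_snd hm hB hR hz
      have e5 : 4 ^ m * S.t (ξ, β) ≤ 4 ^ m * T := by gcongr
      rw [hX] at e1 e2 e3 e4
      refine ⟨⟨?_, ?_⟩, ?_, ?_⟩ <;> simp only <;> linarith
    have hKk : IsCompact K := (isCompact_Icc.prod isCompact_Icc).of_isClosed_subset hKc hKb
    have : s ∩ Icc 0 T = S.t '' K := by
      ext τ
      constructor
      · rintro ⟨⟨z, hz, rfl, hX⟩, h2⟩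
        exact ⟨z, ⟨⟨hz, hX⟩, h2.2⟩, rfl⟩
      · rintro ⟨z, ⟨⟨hz, hX⟩, ht⟩, rfl⟩
        exact ⟨⟨z, hz, rfl, hX⟩, S.t_nonneg hB hR hz, ht⟩
    rw [this]
    exact (hKk.image S.cont_t).isClosed
  · rintro τ ⟨⟨z, hz, rfl, hX⟩, hτ⟩ y hy
    have hΦ := S.hasStrictFDerivAt_toTimeSpace hD (hR hz) (S.N_pos hB hz).ne' (S.Q_pos hB hz).ne'
    -- Openness to the right: near `z` the map is open, and preimages with nonnegative time stay in
    -- the region, so slightly later times at the same `x` are reached.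
    have himg := image_mem_map (m := S.toTimeSpace)
      (S.eventually_mem_region_of_nonneg h hD hR hz hτ.2.le)
    rw [hΦ.map_nhds_eq_of_equiv] at himg
    have hcurve : ContinuousAt (fun σ : ℝ => (σ, x)) (S.t z) := by fun_prop
    have hpt : S.toTimeSpace z = (S.t z, x) := by rw [CharSol.toTimeSpace, hX]
    rw [hpt] at himg
    have hev : ∀ᶠ σ in 𝓝[>] (S.t z), (σ, x) ∈ S.toTimeSpace '' {w | 0 ≤ S.t w → w ∈ S.region B n} :=
      (hcurve.eventually himg).filter_mono nhdsWithin_le_nhds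
    obtain ⟨σ, ⟨w, hw, hwe⟩, hσ⟩ := (hev.and (Ioc_mem_nhdsGT hy)).exists
    obtain ⟨e1, e2⟩ := Prod.ext_iff.1 hwe
    simp only [CharSol.toTimeSpace] at e1 e2
    refine ⟨σ, ⟨w, hw ?_, e1, e2⟩, hσ⟩
    rw [e1]
    exact hτ.1.trans hσ.1.le

/-- The inverse of the map from characteristic coordinates to time and space, together with its
derivative. -/
theorem CharSol.exists_inverse (h : Bootstrap m B T M₀ Θ a a' A n n' u₀ v₀ p₀ q₀)
    (hD : IsOpen D) (hR : S.region B n ⊆ D) :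
    ∃ g : ℝ × ℝ → ℝ × ℝ, (∀ y ∈ Ico 0 T ×ˢ (univ : Set ℝ), g y ∈ S.region B n ∧
      S.t (g y) = y.1 ∧ S.X (g y) = y.2) ∧
      ∀ y ∈ Ico 0 T ×ˢ (univ : Set ℝ), HasFDerivWithinAt g
        ((planeForm (1 / (2 * S.N (g y))) (-(1 / (2 * speed m (S.u (g y)) * S.N (g y))))).prod
          (planeForm (1 / (2 * S.Q (g y))) (1 / (2 * speed m (S.u (g y)) * S.Q (g y)))))
        (Ico 0 T ×ˢ (univ : Set ℝ)) y := by
  have hB := h.B_pos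
  have hex : ∀ y : ℝ × ℝ, ∃ z : ℝ × ℝ, y ∈ Ico 0 T ×ˢ (univ : Set ℝ) → z ∈ S.region B n ∧
      S.t z = y.1 ∧ S.X z = y.2 := by
    intro y
    by_cases hy : y ∈ Ico 0 T ×ˢ (univ : Set ℝ)
    · obtain ⟨z, hz⟩ := S.exists_region_eq h hD hR ⟨hy.1.1, hy.1.2.le⟩ y.2
      exact ⟨z, fun _ => hz⟩
    · exact ⟨0, fun h => absurd h hy⟩
  choose g hg using hex
  refine ⟨g, hg, fun y hy => ?_⟩
  obtain ⟨hz, ht, hX⟩ := hg y hy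
  have hΦ := S.hasStrictFDerivAt_toTimeSpace hD (hR hz) (S.N_pos hB hz).ne' (S.Q_pos hB hz).ne'
  have hpt : S.toTimeSpace (g y) = y := Prod.ext ht hX
  have hloc := hΦ.to_localInverse.hasFDerivAt.hasFDerivWithinAt (s := Ico 0 T ×ˢ (univ : Set ℝ))
  have htend := hΦ.localInverse_tendsto
  have hright := hΦ.eventually_right_inverse
  have hfix := hΦ.localInverse_apply_image
  rw [hpt] at hloc htend hright hfix
  -- The global inverse was merely chosen pointwise; injectivity on the region identifies it near
  -- `y` with the smooth local inverse.
  refine hloc.congr_of_eventuallyEq ?_ hfix.symm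
  have hreg := htend.eventually (S.eventually_mem_region_of_nonneg h hD hR hz
    (ht.trans_le hy.1.2.le))
  filter_upwards [hreg.filter_mono nhdsWithin_le_nhds, hright.filter_mono nhdsWithin_le_nhds,
    self_mem_nhdsWithin] with w h1 h2 h3
  obtain ⟨k1, k2, k3⟩ := hg w h3
  refine S.toTimeSpace_injOn h.m_nonneg hB hR k1 (h1 ?_) ?_
  · have : S.t (hΦ.localInverse _ _ _ w) = w.1 := congrArg Prod.fst h2
    rw [this]
    exact h3.1.1
  · rw [h2]
    exact Prod.ext k2 k3

end

end

/-! ### Return to the Euler equations and lower bound for the lifespan. -/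

section

theorem planeForm_comp_prod (a b c d e f : ℝ) :
    (planeForm a b).comp ((planeForm c d).prod (planeForm e f))
      = planeForm (a * c + b * e) (a * d + b * f) := by
  ext <;> simp

theorem dt_eq_of_hasFDerivWithinAt {T : ℝ} {f : ℝ × ℝ → ℝ} {a b τ x : ℝ} (hτ : τ ∈ Ico 0 T)
    (hf : HasFDerivWithinAt f (planeForm a b) (Ico 0 T ×ˢ univ) (τ, x)) :
    dt T (fun τ x => f (τ, x)) τ x = a := by
  have hc : HasDerivWithinAt (fun s : ℝ => (s, x)) ((1 : ℝ), (0 : ℝ)) (Ico 0 T) τ :=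
    (hasDerivWithinAt_id τ _).prodMk (hasDerivWithinAt_const τ _ x)
  have hmaps : MapsTo (fun s : ℝ => (s, x)) (Ico 0 T) (Ico 0 T ×ˢ univ) := fun s hs =>
    ⟨hs, mem_univ _⟩
  have := hf.comp_hasDerivWithinAt τ hc hmaps
  simp only [planeForm_apply, mul_one, mul_zero, add_zero] at this
  exact this.derivWithin (uniqueDiffOn_Ico 0 T τ hτ)

theorem hasDerivAt_snd_of_hasFDerivWithinAt {T : ℝ} {f : ℝ × ℝ → ℝ} {a b τ x : ℝ}
    (hτ : τ ∈ Ico 0 T) (hf : HasFDerivWithinAt f (planeForm a b) (Ico 0 T ×ˢ univ) (τ, x)) :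
    HasDerivAt (fun y => f (τ, y)) b x := by
  have hc : HasDerivWithinAt (fun s : ℝ => (τ, s)) ((0 : ℝ), (1 : ℝ)) univ x :=
    (hasDerivWithinAt_const x _ τ).prodMk (hasDerivWithinAt_id x _)
  have hmaps : MapsTo (fun s : ℝ => (τ, s)) univ (Ico 0 T ×ˢ univ) := fun s _ =>
    ⟨hτ, mem_univ _⟩
  have := hf.comp_hasDerivWithinAt x hc hmaps
  simp only [planeForm_apply, mul_one, mul_zero, zero_add] at this
  exact hasDerivWithinAt_univ.1 this

theorem speed_sq {m γ u : ℝ} (hm : 4 * m = γ + 1) (hu : 0 < u) :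
    u ^ (-γ - 1) = speed m u ^ 2 := by
  rw [speed, ← Real.rpow_mul_natCast hu.le]
  congr 1
  push_cast
  linarith

theorem hasDerivAt_pressure {m γ u : ℝ} (hγ : γ ≠ 0) (hm : 4 * m = γ + 1) (hu : 0 < u) :
    HasDerivAt (pressure γ) (-(speed m u ^ 2)) u := by
  rw [← speed_sq hm hu]
  refine ((Real.hasDerivAt_rpow_const (p := -γ) (Or.inl hu.ne')).div_const γ).congr_deriv ?_
  field_simp

variable {m B T M₀ Θ : ℝ} {a a' A n n' u₀ v₀ p₀ q₀ : ℝ → ℝ} {D : Set (ℝ × ℝ)}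

/-- A solution in characteristic coordinates that obeys the bootstrap bounds yields a classical
solution with bounded derivatives. -/
theorem CharSol.exists_isSolution {γ mu lam : ℝ} (S : CharSol m a u₀ v₀ p₀ q₀ D)
    (h : Bootstrap m B T M₀ Θ a a' A n n' u₀ v₀ p₀ q₀) (hD : IsOpen D) (hR : S.region B n ⊆ D)
    (hγ : γ ≠ 0) (hm : 4 * m = γ + 1) (ha : ∀ t ∈ Ico 0 T, a t = lam / (1 + t) ^ mu)
    (haM : ∃ K, ∀ t, |a t| ≤ K) :
    ∃ u v, IsSolution γ mu lam u₀ v₀ T u v ∧ IsBoundedOn γ T u v := by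
  obtain ⟨g, hg, hg'⟩ := S.exists_inverse h hD hR
  have hB := h.B_pos
  set U : Set (ℝ × ℝ) := Ico 0 T ×ˢ univ with hU
  have hUd : UniqueDiffOn ℝ U := (uniqueDiffOn_Ico 0 T).prod uniqueDiffOn_univ
  have hgc : ContinuousOn g U := fun y hy => (hg' y hy).continuousWithinAt
  have hpos : ∀ y ∈ U, 0 < S.N (g y) ∧ 0 < S.Q (g y) ∧ 0 < speed m (S.u (g y)) := fun y hy =>
    ⟨S.N_pos hB (hg y hy).1, S.Q_pos hB (hg y hy).1, speed_pos m (S.u_pos _)⟩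
  have hu : ∀ y ∈ U, HasFDerivWithinAt (fun y => S.u (g y))
      (planeForm ((S.p (g y) + S.q (g y)) / 2)
        ((S.p (g y) - S.q (g y)) / (2 * speed m (S.u (g y))))) U y := by
    intro y hy
    have := (S.hasStrictFDerivAt_u hD (hR (hg y hy).1)).hasFDerivAt.comp_hasFDerivWithinAt y
      (hg' y hy)
    obtain ⟨h1, h2, h3⟩ := hpos y hy
    rw [planeForm_comp_prod] at this
    refine this.congr_fderiv ?_
    congr 1 <;> field_simp <;> ring
  have hv : ∀ y ∈ U, HasFDerivWithinAt (fun y => S.v (g y))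
      (planeForm (-(a (S.t (g y)) * S.v (g y)) + speed m (S.u (g y)) * (S.p (g y) - S.q (g y)) / 2)
        ((S.p (g y) + S.q (g y)) / 2)) U y := by
    intro y hy
    have := (S.hasStrictFDerivAt_v h.cont_a hD (hR (hg y hy).1)).hasFDerivAt.comp_hasFDerivWithinAt
      y (hg' y hy)
    obtain ⟨h1, h2, h3⟩ := hpos y hy
    rw [planeForm_comp_prod] at this
    refine this.congr_fderiv ?_
    congr 1 <;> field_simp <;> ring
  have cs := S.continuous_speed
  have hp := S.cont_p
  have hq := S.cont_q
  have hvc := S.cont_v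
  have hat := h.cont_a.comp S.cont_t
  have hut : ∀ t ∈ Ico 0 T, ∀ x, dt T (fun t x => S.u (g (t, x))) t x
      = (S.p (g (t, x)) + S.q (g (t, x))) / 2 := fun t ht x =>
    dt_eq_of_hasFDerivWithinAt (f := fun y => S.u (g y)) ht (hu (t, x) ⟨ht, mem_univ _⟩)
  have hvt : ∀ t ∈ Ico 0 T, ∀ x, dt T (fun t x => S.v (g (t, x))) t x
      = -(a t * S.v (g (t, x)))
        + speed m (S.u (g (t, x))) * (S.p (g (t, x)) - S.q (g (t, x))) / 2 := fun t ht x => by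
    rw [dt_eq_of_hasFDerivWithinAt (f := fun y => S.v (g y)) ht (hv (t, x) ⟨ht, mem_univ _⟩),
      (hg (t, x) ⟨ht, mem_univ _⟩).2.1]
  have hux : ∀ t ∈ Ico 0 T, ∀ x, HasDerivAt (fun y => S.u (g (t, y)))
      ((S.p (g (t, x)) - S.q (g (t, x))) / (2 * speed m (S.u (g (t, x))))) x := fun t ht x =>
    hasDerivAt_snd_of_hasFDerivWithinAt (f := fun y => S.u (g y)) ht (hu (t, x) ⟨ht, mem_univ _⟩)
  have hvx : ∀ t ∈ Ico 0 T, ∀ x, HasDerivAt (fun y => S.v (g (t, y)))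
      ((S.p (g (t, x)) + S.q (g (t, x))) / 2) x := fun t ht x =>
    hasDerivAt_snd_of_hasFDerivWithinAt (f := fun y => S.v (g y)) ht (hv (t, x) ⟨ht, mem_univ _⟩)
  -- By injectivity the diagonal point is the only preimage at time zero, so the initial data are
  -- attained.
  have hinit : ∀ x, g (0, x) = (-x, x) := fun x => by
    obtain ⟨k1, k2, k3⟩ := hg (0, x) ⟨⟨le_rfl, h.T_pos⟩, mem_univ _⟩
    refine S.toTimeSpace_injOn h.m_nonneg hB hR k1 (S.diag_mem_region h x) ?_
    simp only [CharSol.toTimeSpace, k2, k3, S.t_diag, S.X_diag]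
  refine ⟨fun t x => S.u (g (t, x)), fun t x => S.v (g (t, x)), ⟨?_, ?_, fun t _ x => S.u_pos _,
    fun t ht x => ?_, fun t ht x => ?_, fun x => ?_, fun x => ?_⟩, ?_⟩
  · exact contDiffOn_of_planeForm hUd hu
      (((hp.add hq).div_const 2).comp_continuousOn hgc)
      (((hp.sub hq).div (continuous_const.mul cs) fun z =>
        (mul_pos two_pos (speed_pos m (S.u_pos z))).ne').comp_continuousOn hgc)
  · exact contDiffOn_of_planeForm hUd hv
      (((hat.mul hvc).neg.add ((cs.mul (hp.sub hq)).div_const 2)).comp_continuousOn hgc)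
      (((hp.add hq).div_const 2).comp_continuousOn hgc)
  · rw [hut t ht x, dx, (hvx t ht x).deriv, sub_self]
  · have hpr := (hasDerivAt_pressure hγ hm (S.u_pos (g (t, x)))).comp x (hux t ht x)
    have h0 := speed_pos m (S.u_pos (g (t, x)))
    have : dx (fun τ y => pressure γ (S.u (g (τ, y)))) t x = _ := hpr.deriv
    rw [hvt t ht x, this, ha t ht]
    field_simp
    ring
  · simp only [hinit, S.u_diag]
  · simp only [hinit, S.v_diag]
  · obtain ⟨K, hK⟩ := haM
    have hK0 : 0 ≤ K := (abs_nonneg _).trans (hK 0)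
    have h4 : (1:ℝ) ≤ 4 ^ m := Real.one_le_rpow (by norm_num) h.m_nonneg
    have hM : 0 ≤ M₀ := (abs_nonneg _).trans (h.invariant_add 0)
    refine ⟨2 + K * M₀ + M₀ + (4 ^ m) ^ 2, fun t ht x => ?_⟩
    have hz := (hg (t, x) ⟨ht, mem_univ _⟩).1
    have hc := dependenceRegion_subset hz
    obtain ⟨⟨bp, bq⟩, bu, -, -⟩ := hc
    obtain ⟨i1, i2⟩ := S.invariant_le h hR hz
    obtain ⟨s1, s2⟩ := speed_bounds h.m_nonneg bu
    have h0 := speed_pos m (S.u_pos (g (t, x)))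
    have bv : |S.v (g (t, x))| ≤ M₀ := by
      rw [abs_le] at i1 i2 ⊢
      constructor <;> linarith
    have bK : |a t * S.v (g (t, x))| ≤ K * M₀ := by
      rw [abs_mul]
      exact mul_le_mul (hK t) bv (abs_nonneg _) hK0
    have hKM : 0 ≤ K * M₀ := mul_nonneg hK0 hM
    have b4 : (4:ℝ) ^ m ≤ (4 ^ m) ^ 2 := by nlinarith
    have bs : speed m (S.u (g (t, x))) ^ 2 ≤ (4 ^ m) ^ 2 := by gcongr
    have bsum : |(S.p (g (t, x)) + S.q (g (t, x))) / 2| ≤ 1 := by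
      rw [abs_le] at bp bq ⊢
      constructor <;> linarith
    have bdiff : |(S.p (g (t, x)) - S.q (g (t, x))) / 2| ≤ 1 := by
      rw [abs_le] at bp bq ⊢
      constructor <;> linarith
    simp only [hut t ht x, hvt t ht x, dx, (hux t ht x).deriv, (hvx t ht x).deriv,
      (hasDerivAt_pressure hγ hm (S.u_pos (g (t, x)))).deriv]
    refine ⟨?_, ?_, ?_, ?_, ?_, ?_, ?_⟩
    · rw [abs_of_pos (S.u_pos _)]
      linarith [bu.2]
    · linarith
    · linarith
    · refine (abs_add_le _ _).trans ?_
      rw [abs_neg, mul_div_assoc, abs_mul (speed _ _), abs_of_pos h0]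
      have : speed m (S.u (g (t, x))) * |(S.p (g (t, x)) - S.q (g (t, x))) / 2| ≤ 4 ^ m * 1 := by
        gcongr
      linarith
    · rw [← div_div, abs_div, abs_of_pos h0, div_le_iff₀ h0]
      have : 1 ≤ 4 ^ m * speed m (S.u (g (t, x))) := by
        rwa [inv_le_iff_one_le_mul₀' (by positivity)] at s2
      nlinarith
    · linarith
    · rw [abs_neg, abs_of_nonneg (by positivity)]
      linarith

/-- The bootstrap data bound the lifespan from below. -/
theorem Bootstrap.le_lifespan {γ mu lam : ℝ} {u₀' v₀' : ℝ → ℝ}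
    (h : Bootstrap m B T M₀ Θ a a' A n n' u₀ v₀ p₀ q₀)
    (hγ : γ ≠ 0) (hm : 4 * m = γ + 1) (hlip : BddLip a)
    (ha : ∀ t ∈ Ico 0 T, a t = lam / (1 + t) ^ mu)
    (hu₀ : ∀ x, HasDerivAt u₀ (u₀' x) x) (hv₀ : ∀ x, HasDerivAt v₀ (v₀' x) x)
    (hu₀' : Continuous u₀') (hv₀' : Continuous v₀')
    (hp₀ : ∀ x, p₀ x = v₀' x + speed m (u₀ x) * u₀' x)
    (hq₀ : ∀ x, q₀ x = v₀' x - speed m (u₀ x) * u₀' x) :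
    (T : EReal) ≤ lifespan γ mu lam u₀ v₀ := by
  have hB := h.B_pos
  -- The truncation levels `2`, `2 B`, `1 / 4` and `4` leave room around the closed bootstrap
  -- bounds, so controlled values are strictly inside.
  have hun : ∀ {p q N Q u t : ℝ}, Controlled m B a n p q N Q u t →
      Untruncated (2 * B) p q N Q u := by
    rintro p q N Q u t ⟨⟨h1, h2⟩, h3, ⟨h4, h5⟩, -⟩
    have := inv_pos.2 hB
    rw [abs_le] at h1 h2
    exact ⟨⟨by linarith, by linarith⟩, ⟨by linarith, by linarith⟩,
      ⟨by linarith [h4.1], by linarith [h4.2]⟩, ⟨by linarith [h5.1], by linarith [h5.2]⟩,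
      ⟨by linarith [h3.1], by linarith [h3.2]⟩⟩
  have hdata : ∀ x, Untruncated (2 * B) (p₀ x) (q₀ x) (1 / (2 * speed m (u₀ x)))
      (1 / (2 * speed m (u₀ x))) (u₀ x) := fun x => hun (h.initial_controlled x)
  obtain ⟨D, S, hD, hmem⟩ := exists_charSol m hlip h.hasDerivAt_A h.A_zero hu₀ hv₀ hu₀' hv₀' hp₀ hq₀
    hdata
  -- The segment from the initial line to a point of the region is part of its triangle of
  -- dependence, hence controlled.
  have hR : S.region B n ⊆ D := by
    rintro ⟨ξ, β⟩ hz
    refine hmem _ fun b hb => ?_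
    have h0 : 0 ≤ ξ + β := hz.1
    simp only at hb ⊢
    rw [uIcc_of_le (by linarith)] at hb
    exact hun (hz.2 ξ b le_rfl hb.2 (by linarith [hb.1]))
  obtain ⟨K, hK⟩ := hlip.2
  obtain ⟨u, v, hs, hb⟩ := S.exists_isSolution h hD hR hγ hm ha ⟨K, hK⟩
  exact le_sSup ⟨T, rfl, h.T_pos, u, v, hs, hb⟩

end

/-! ### The damping coefficient and the scalar lifespan criterion. -/

section

/-- The damping coefficient. -/
def damp (mu lam t : ℝ) : ℝ := lam * (1 + t) ^ (-mu)

/-- The coefficient `a² / 4 + a' / 2` of the zeroth order term in the equation of the slopes. -/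
def dampDefect (mu lam t : ℝ) : ℝ :=
  damp mu lam t ^ 2 / 4 + -(lam * mu * (1 + t) ^ (-mu - 1)) / 2

section Damping

variable {mu lam : ℝ}

theorem hasDerivAt_damp {t : ℝ} (ht : 0 ≤ t) :
    HasDerivAt (damp mu lam) (-(lam * mu * (1 + t) ^ (-mu - 1))) t := by
  have h := ((((hasDerivAt_id t).const_add 1).rpow_const (p := -mu)
    (Or.inl (by simp only [id]; positivity))).const_mul lam)
  refine h.congr_deriv ?_
  simp only [id]
  ring

theorem one_add_rpow_neg_le_one {r t : ℝ} (hr : 0 ≤ r) (ht : 0 ≤ t) : (1 + t) ^ (-r) ≤ 1 :=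
  Real.rpow_le_one_of_one_le_of_nonpos (by linarith) (by linarith)

theorem damp_nonneg (hlam : 0 ≤ lam) {t : ℝ} (ht : 0 ≤ t) : 0 ≤ damp mu lam t :=
  mul_nonneg hlam (Real.rpow_nonneg (by linarith) _)

/-- The truncated system lives on the whole plane, which includes negative times; freezing the
coefficient there makes it globally bounded and Lipschitz. -/
theorem bddLip_damp (hmu : 0 ≤ mu) (hlam : 0 ≤ lam) : BddLip fun t => damp mu lam (max t 0) := by
  refine ⟨⟨⟨lam * mu, mul_nonneg hlam hmu⟩, LipschitzWith.of_dist_le_mul fun x y => ?_⟩, lam,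
    fun x => ?_⟩
  · have h := (convex_Ici (0:ℝ)).norm_image_sub_le_of_norm_hasDerivWithin_le (f := damp mu lam)
      (C := lam * mu) (fun t ht => (hasDerivAt_damp ht).hasDerivWithinAt) (fun t ht => by
        rw [norm_neg, Real.norm_eq_abs, abs_of_nonneg
          (mul_nonneg (mul_nonneg hlam hmu) (Real.rpow_nonneg (by linarith [mem_Ici.1 ht]) _)),
          show -mu - 1 = -(mu + 1) by ring]
        exact mul_le_of_le_one_right (mul_nonneg hlam hmu)
          (one_add_rpow_neg_le_one (by linarith) ht))
      (le_max_right y 0) (le_max_right x 0)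
    rw [← dist_eq_norm, ← dist_eq_norm] at h
    refine h.trans (mul_le_mul_of_nonneg_left ?_ (mul_nonneg hlam hmu))
    simp only [Real.dist_eq]
    simpa using abs_max_sub_max_le_max x 0 y 0
  · rw [abs_of_nonneg (damp_nonneg hlam (le_max_right _ _))]
    exact mul_le_of_le_one_right hlam (one_add_rpow_neg_le_one hmu (le_max_right _ _))

theorem hasDerivAt_comp_max_zero {f : ℝ → ℝ} {f' t : ℝ} (hf : HasDerivAt f f' t) (ht : 0 < t) :
    HasDerivAt (fun s => f (max s 0)) f' t := by
  refine hf.congr_of_eventuallyEq ?_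
  filter_upwards [lt_mem_nhds ht] with s hs
  rw [max_eq_left hs.le]

end Damping

theorem IsC1b.exists_bound {φ : ℝ → ℝ} (h : IsC1b φ) :
    ∃ M, 0 < M ∧ ∀ x, |φ x| ≤ M ∧ |deriv φ x| ≤ M := by
  obtain ⟨-, ⟨M, hM⟩, K, hK⟩ := h
  refine ⟨max 1 (max M K), by positivity, fun x => ⟨(hM x).trans ?_, (hK x).trans ?_⟩⟩
  · exact (le_max_left _ _).trans (le_max_right _ _)
  · exact (le_max_right _ _).trans (le_max_right _ _)

/-- A positive supersolution of the scalar comparison equation for the slopes bounds the lifespan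
from below. -/
theorem exists_lifespan_criterion {γ mu lam : ℝ} (hγ : 1 < γ) (hmu : 0 ≤ mu) (hlam : 0 ≤ lam)
    {φ ψ : ℝ → ℝ} (hφ : IsC1b φ) (hψ : IsC1b ψ) :
    ∃ κ ε₁ : ℝ, 0 < κ ∧ 0 < ε₁ ∧ ∀ ε, 0 < ε → ε ≤ ε₁ → ∀ T, 0 < T → ∀ n n' : ℝ → ℝ,
      (∀ t, 0 ≤ t → HasDerivAt n (n' t) t) → κ * ε < n 0 → (∀ t ∈ Icc 0 T, 0 ≤ n t) →
      (∀ t ∈ Ioo 0 T, κ * (n t + κ * ε * damp mu lam t) ^ 2 + κ * ε * |dampDefect mu lam t|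
        ≤ n' t + damp mu lam t / 2 * n t) →
      (∀ t ∈ Icc 0 T, κ * (n t + κ * ε * damp mu lam t) < 1) →
      (T : EReal) ≤ lifespan γ mu lam (fun x => 1 + ε * φ x) (fun x => ε * ψ x) := by
  obtain ⟨M₁, hM₁, hφb⟩ := hφ.exists_bound
  obtain ⟨M₂, hM₂, hψb⟩ := hψ.exists_bound
  set M := max M₁ M₂ with hMdef
  have hM : 0 < M := lt_max_of_lt_left hM₁
  have hφM : ∀ x, |φ x| ≤ M ∧ |deriv φ x| ≤ M := fun x =>
    ⟨(hφb x).1.trans (le_max_left _ _), (hφb x).2.trans (le_max_left _ _)⟩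
  have hψM : ∀ x, |ψ x| ≤ M ∧ |deriv ψ x| ≤ M := fun x =>
    ⟨(hψb x).1.trans (le_max_right _ _), (hψb x).2.trans (le_max_right _ _)⟩
  obtain ⟨m, hm⟩ : ∃ m : ℝ, 4 * m = γ + 1 := ⟨(γ + 1) / 4, by ring⟩
  have hm0 : 0 ≤ m := by linarith
  have h2 : (1:ℝ) ≤ 2 ^ m := Real.one_le_rpow (by norm_num) hm0
  have h4 : (1:ℝ) ≤ 4 ^ m := Real.one_le_rpow (by norm_num) hm0
  -- The number `W ε` bounds both the initial Riemann invariants and their derivatives: `1` accounts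
  -- for `ψ`, and `4 ^ m` for the speed of sound in front of `φ`.
  obtain ⟨W, hW⟩ : ∃ W : ℝ, W = (1 + 4 ^ m) * M := ⟨_, rfl⟩
  have hW0 : 0 < W := by rw [hW]; positivity
  have hMW : M ≤ W := by rw [hW]; nlinarith
  -- The four summands dominate, in order, the quadratic coefficient, the factor in the smallness
  -- condition, `Θ / ε`, and the initial slopes divided by `ε`.
  obtain ⟨κ, hκ⟩ : ∃ κ : ℝ, κ = 2 * m * 2 ^ m + 2 ^ m + 2 ^ m * (4 ^ m * W)
    + 2 ^ m * (W + lam / 2 * M) := ⟨_, rfl⟩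
  have k1 : 0 ≤ 2 * m * 2 ^ m := by positivity
  have k2 : 0 ≤ 2 ^ m * (4 ^ m * W) := by positivity
  have k3 : 0 ≤ 2 ^ m * (W + lam / 2 * M) := by positivity
  have hκ0 : 0 < κ := by linarith
  -- The threshold gives `4 ^ m W ε ≤ 1 / 4`, below the `1 / 2` that keeps `u` strictly inside `(1 /
  -- 2, 2)`.
  refine ⟨κ, 1 / (4 * (4 ^ m * W)), hκ0, by positivity, fun ε hε hε1 T hT n n' hn hn0 hnn hsup
    hsmall => ?_⟩
  have hεW : 4 ^ m * (W * ε) ≤ 1 / 4 := by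
    rw [le_div_iff₀ (by positivity)] at hε1
    linarith
  have hWε : W * ε ≤ 1 / 4 := by nlinarith [mul_pos hW0 hε]
  have hMε : M * ε ≤ W * ε := by gcongr
  have hu1 : ∀ x, |1 + ε * φ x - 1| ≤ M * ε := fun x => by
    rw [add_sub_cancel_left, abs_mul, abs_of_pos hε, mul_comm]
    exact mul_le_mul_of_nonneg_right (hφM x).1 hε.le
  have hv1 : ∀ x, |ε * ψ x| ≤ M * ε := fun x => by
    rw [abs_mul, abs_of_pos hε, mul_comm]
    exact mul_le_mul_of_nonneg_right (hψM x).1 hε.le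
  have hu : ∀ x, 1 + ε * φ x ∈ Icc (1 / 2 : ℝ) 2 := fun x => by
    have := abs_le.1 (hu1 x)
    constructor <;> linarith [this.1, this.2]
  have heta : ∀ x, |eta m (1 + ε * φ x)| ≤ 4 ^ m * (M * ε) := fun x => by
    refine (abs_theta_bounds (m := 2 * m) (by linarith) (hu x)).1.trans ?_
    rw [← four_rpow]
    gcongr
    exact hu1 x
  have hinv : ∀ x, |ε * ψ x| + |eta m (1 + ε * φ x)| ≤ W * ε := fun x => by
    have := add_le_add (hv1 x) (heta x)
    rw [hW]
    linarith
  have hsp : ∀ x, |speed m (1 + ε * φ x) * (ε * deriv φ x)| ≤ 4 ^ m * (M * ε) := fun x => by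
    obtain ⟨s1, -⟩ := speed_bounds hm0 (hu x)
    have h0 := speed_pos m (show 0 < 1 + ε * φ x by linarith [(hu x).1])
    rw [abs_mul, abs_of_pos h0, abs_mul, abs_of_pos hε, mul_comm ε |_|]
    have := (hφM x).2
    gcongr
  have hv' : ∀ x, |ε * deriv ψ x| ≤ M * ε := fun x => by
    rw [abs_mul, abs_of_pos hε, mul_comm]
    exact mul_le_mul_of_nonneg_right (hψM x).2 hε.le
  have hslope : ∀ x p, |p| ≤ W * ε →
      |slope m (damp mu lam (max 0 0)) p (1 + ε * φ x)| < n (max 0 0) := fun x p hp => by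
    have d0 : damp mu lam 0 = lam := by simp [damp]
    rw [max_self, d0, slope]
    refine lt_of_le_of_lt (abs_add_le _ _) (lt_of_le_of_lt ?_ hn0)
    have hpos : 0 < 1 + ε * φ x := by linarith [(hu x).1]
    rw [abs_mul, abs_mul, abs_of_pos (Real.rpow_pos_of_pos hpos _),
      abs_of_nonneg (by positivity : 0 ≤ lam / 2)]
    have t1 : (1 + ε * φ x) ^ (-m) * |p| ≤ 2 ^ m * (W * ε) := by
      have := (rpow_le_two_rpow hm0 (hu x)).2.1
      gcongr
    have t2 : lam / 2 * |theta m (1 + ε * φ x)| ≤ lam / 2 * (2 ^ m * (M * ε)) := by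
      have := (abs_theta_bounds hm0 (hu x)).1.trans
        (mul_le_mul_of_nonneg_left (hu1 x) (by positivity))
      gcongr
    have t3 : 2 ^ m * (W + lam / 2 * M) * ε ≤ κ * ε := by
      gcongr
      linarith
    linarith
  have hΘ : 2 ^ m * (4 ^ m * (W * ε)) ≤ κ * ε := by
    have : 2 ^ m * (4 ^ m * W) * ε ≤ κ * ε := by
      gcongr
      linarith
    linarith
  have hΘ0 : 0 ≤ 2 ^ m * (4 ^ m * (W * ε)) := by positivity
  have hlip := bddLip_damp hmu hlam
  have hac : Continuous fun t => damp mu lam (max t 0) := hlip.1.choose_spec.continuous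
  have hnc : Continuous fun t => n (max t 0) := continuous_iff_continuousAt.2 fun t =>
    (hn _ (le_max_right t 0)).continuousAt.comp (f := fun t : ℝ => max t 0) (by fun_prop)
  have hstep : ∀ t ∈ Icc 0 T, n t + damp mu lam t * (2 ^ m * (4 ^ m * (W * ε))) / 2
      ≤ n t + κ * ε * damp mu lam t ∧
      0 ≤ n t + damp mu lam t * (2 ^ m * (4 ^ m * (W * ε))) / 2 := fun t ht => by
    have hd := damp_nonneg (mu := mu) hlam ht.1
    have h0 := hnn t ht
    constructor
    · nlinarith [mul_le_mul_of_nonneg_left hΘ hd]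
    · positivity
  have hboot : Bootstrap m (2 * 4 ^ m * Real.exp (4 * m * T) + 1) T (W * ε)
      (2 ^ m * (4 ^ m * (W * ε))) (fun t => damp mu lam (max t 0))
      (fun t => -(lam * mu * (1 + t) ^ (-mu - 1))) (fun t => ∫ s in (0:ℝ)..t, damp mu lam (max s 0))
      (fun t => n (max t 0)) n' (fun x => 1 + ε * φ x) (fun x => ε * ψ x)
      (fun x => ε * deriv ψ x + speed m (1 + ε * φ x) * (ε * deriv φ x))
      (fun x => ε * deriv ψ x - speed m (1 + ε * φ x) * (ε * deriv φ x)) :=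
    { m_nonneg := hm0
      T_pos := hT
      a_nonneg := fun t => damp_nonneg hlam (le_max_right _ _)
      cont_a := hac
      cont_n := hnc
      hasDerivAt_A := fun t => by simpa using hasDerivAt_integral_right hac 0 0 t
      A_zero := intervalIntegral.integral_same
      hasDerivAt_a := fun t ht => hasDerivAt_comp_max_zero (hasDerivAt_damp ht.1.le) ht.1
      hasDerivAt_n := fun t ht => hasDerivAt_comp_max_zero (hn t ht.1.le) ht.1
      super := fun t ht => by
        obtain ⟨e1, e2⟩ := hstep t ⟨ht.1.le, ht.2.le⟩
        rw [max_eq_left ht.1.le]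
        refine le_trans ?_ (hsup t ht)
        have : 2 * m * 2 ^ m ≤ κ := by linarith
        have hR : |damp mu lam t ^ 2 / 4 + -(lam * mu * (1 + t) ^ (-mu - 1)) / 2|
            * (2 ^ m * (4 ^ m * (W * ε))) ≤ κ * ε * |dampDefect mu lam t| := by
          rw [mul_comm, dampDefect]
          gcongr
        have : 2 * m * 2 ^ m * (n t + damp mu lam t * (2 ^ m * (4 ^ m * (W * ε))) / 2) ^ 2
            ≤ κ * (n t + κ * ε * damp mu lam t) ^ 2 := by gcongr
        exact add_le_add this hR
      small := fun t ht => by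
        obtain ⟨e1, e2⟩ := hstep t ht
        rw [max_eq_left ht.1]
        refine lt_of_le_of_lt ?_ (hsmall t ht)
        have : 2 ^ m ≤ κ := by linarith
        gcongr
      M₀_small := by linarith
      Θ_eq := rfl
      B_large := by linarith
      u₀_mem := hu
      invariant_add := fun x => (abs_add_le _ _).trans (hinv x)
      invariant_sub := fun x => (abs_sub _ _).trans (hinv x)
      slope_p := fun x => hslope x _ <| (abs_add_le _ _).trans <|
        (add_le_add (hv' x) (hsp x)).trans (by rw [hW]; linarith)
      slope_q := fun x => hslope x _ <| (abs_sub _ _).trans <|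
        (add_le_add (hv' x) (hsp x)).trans (by rw [hW]; linarith) }
  refine hboot.le_lifespan (u₀' := fun x => ε * deriv φ x) (v₀' := fun x => ε * deriv ψ x)
    (by linarith) hm hlip (fun t ht => ?_) (fun x => ?_) (fun x => ?_)
    (continuous_const.mul (hφ.1.continuous_deriv le_rfl))
    (continuous_const.mul (hψ.1.continuous_deriv le_rfl)) (fun x => rfl) fun x => rfl
  · simp only [max_eq_left ht.1, damp, Real.rpow_neg (show 0 ≤ 1 + t by linarith [ht.1]),
      div_eq_mul_inv]
  · exact ((hφ.1.differentiable one_ne_zero x).hasDerivAt.const_mul ε).const_add 1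
  · exact (hψ.1.differentiable one_ne_zero x).hasDerivAt.const_mul ε

end

/-! ### Two families of supersolutions. -/

variable {γ mu lam : ℝ} {φ ψ : ℝ → ℝ}

/-- If `E` grows at most like the integrating factor of the damping, then the lifespan is bounded
below by the time that `∫ 1 / E` needs to become of order `1 / ε`. -/
theorem exists_lifespan_of_factor (hγ : 1 < γ) (hmu : 0 ≤ mu) (hlam : 0 ≤ lam)
    (hφ : IsC1b φ) (hψ : IsC1b ψ) {E E' F F' f f' : ℝ → ℝ} {c K : ℝ} (hc : 0 ≤ c) (hK : 0 ≤ K)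
    (hE : ∀ t, 0 ≤ t → HasDerivAt E (E' t) t) (hF : ∀ t, 0 ≤ t → HasDerivAt F (F' t) t)
    (hf : ∀ t, 0 ≤ t → HasDerivAt f (f' t) t)
    (hE0 : E 0 = 1) (hE1 : ∀ t, 0 ≤ t → 1 ≤ E t)
    (hEa : ∀ t, 0 ≤ t → E' t ≤ damp mu lam t / 2 * E t)
    (haE : ∀ t, 0 ≤ t → damp mu lam t * E t ≤ c)
    (hF0 : ∀ t, 0 ≤ t → 0 ≤ F t) (hFE : ∀ t, 0 ≤ t → (E t)⁻¹ ≤ F' t)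
    (hfK : ∀ t, 0 ≤ t → f t ∈ Icc 0 K)
    (hfE : ∀ t, 0 ≤ t → E t * |dampDefect mu lam t| ≤ f' t) :
    ∃ ε₀ C : ℝ, 0 < ε₀ ∧ 0 < C ∧ ∀ ε, 0 < ε → ε ≤ ε₀ → ∀ T, 0 < T →
      (∀ t ∈ Icc 0 T, ε * F t ≤ C) →
      (T : EReal) ≤ lifespan γ mu lam (fun x => 1 + ε * φ x) (fun x => ε * ψ x) := by
  obtain ⟨κ, ε₁, hκ, hε₁, hcrit⟩ := exists_lifespan_criterion hγ hmu hlam hφ hψ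
  -- On `[0, T]` the sum `n + κ ε a` is at most `ε J / E`: the terms of `J` come from `f ≤ K`, from
  -- `k₂ ε² F ≤ ε` (where `C = 1 / k₂`), and from `a E ≤ c`.
  obtain ⟨J, hJ⟩ : ∃ J, J = (κ + 1) * (1 + K) + 1 + κ * c := ⟨_, rfl⟩
  have hJ0 : 0 < J := by rw [hJ]; positivity
  obtain ⟨k₂, hk₂⟩ : ∃ k₂, k₂ = κ * J ^ 2 := ⟨_, rfl⟩
  have hk0 : 0 < k₂ := by rw [hk₂]; positivity
  refine ⟨min ε₁ (1 / (2 * (κ * J))), 1 / k₂, lt_min hε₁ (by positivity), by positivity,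
    fun ε hε hεle T hT hFT => ?_⟩
  obtain ⟨hεa, hεb⟩ := le_min_iff.1 hεle
  -- The supersolution is `w / E`. Division by `E` uses up the damping, the growth of `f` pays for
  -- the defect, and that of `F` pays for the quadratic term, which is at most `k₂ ε² / E²`.
  set w : ℝ → ℝ := fun t => ε * (κ + 1) * (1 + f t) + k₂ * ε ^ 2 * F t with hw
  have hwd : ∀ t, 0 ≤ t → HasDerivAt w (ε * (κ + 1) * f' t + k₂ * ε ^ 2 * F' t) t := fun t ht =>
    (((hf t ht).const_add 1).const_mul _).add ((hF t ht).const_mul _)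
  have hw0 : ∀ t, 0 ≤ t → ε * (κ + 1) ≤ w t := fun t ht => by
    have h1 := (hfK t ht).1
    have h2 := hF0 t ht
    have : 0 ≤ k₂ * ε ^ 2 * F t := by positivity
    have : 0 ≤ ε * (κ + 1) * f t := by positivity
    simp only [hw]
    linarith
  have hwpos : ∀ t, 0 ≤ t → 0 < w t := fun t ht => lt_of_lt_of_le (by positivity) (hw0 t ht)
  have hsum : ∀ t ∈ Icc 0 T, w t / E t + κ * ε * damp mu lam t ≤ ε * J / E t := fun t ht => by
    have hEt : 0 < E t := lt_of_lt_of_le one_pos (hE1 t ht.1)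
    rw [div_add' _ _ _ hEt.ne']
    refine div_le_div_of_nonneg_right ?_ hEt.le
    have h1 : ε * (κ + 1) * (1 + f t) ≤ ε * (κ + 1) * (1 + K) := by
      have := (hfK t ht.1).2
      gcongr
    have h2 : k₂ * ε ^ 2 * F t ≤ ε := by
      have := hFT t ht
      rw [le_div_iff₀ hk0] at this
      nlinarith
    have h3 : κ * ε * (damp mu lam t * E t) ≤ κ * ε * c := by
      have := haE t ht.1
      gcongr
    simp only [hw]
    rw [hJ]
    linarith
  have hnn : ∀ t ∈ Icc 0 T, 0 ≤ w t / E t + κ * ε * damp mu lam t := fun t ht => by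
    have hEt : 0 < E t := lt_of_lt_of_le one_pos (hE1 t ht.1)
    have h1 := hwpos t ht.1
    have h2 := damp_nonneg (mu := mu) hlam ht.1
    positivity
  refine hcrit ε hε hεa T hT (fun t => w t / E t)
    (fun t => ((ε * (κ + 1) * f' t + k₂ * ε ^ 2 * F' t) * E t - w t * E' t) / E t ^ 2)
    (fun t ht => (hwd t ht).div (hE t ht) (lt_of_lt_of_le one_pos (hE1 t ht)).ne') ?_
    (fun t ht => ?_) (fun t ht => ?_) (fun t ht => ?_)
  · have := hw0 0 le_rfl
    simp only [hE0, div_one]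
    nlinarith
  · exact div_nonneg (hwpos t ht.1).le (zero_le_one.trans (hE1 t ht.1))
  · have ht' : t ∈ Icc 0 T := ⟨ht.1.le, ht.2.le⟩
    have hEt : 0 < E t := lt_of_lt_of_le one_pos (hE1 t ht.1.le)
    have s1 : κ * (w t / E t + κ * ε * damp mu lam t) ^ 2 ≤ k₂ * ε ^ 2 * (E t)⁻¹ / E t := by
      have : (w t / E t + κ * ε * damp mu lam t) ^ 2 ≤ (ε * J / E t) ^ 2 :=
        pow_le_pow_left₀ (hnn t ht') (hsum t ht') 2
      refine (mul_le_mul_of_nonneg_left this hκ.le).trans_eq ?_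
      rw [hk₂]
      field_simp
    have s2 : k₂ * ε ^ 2 * (E t)⁻¹ / E t ≤ k₂ * ε ^ 2 * F' t / E t := by
      have := hFE t ht.1.le
      gcongr
    have s3 : κ * ε * |dampDefect mu lam t| ≤ ε * (κ + 1) * f' t / E t := by
      rw [le_div_iff₀ hEt]
      have h1 := hfE t ht.1.le
      have h2 : 0 ≤ E t * |dampDefect mu lam t| := by positivity
      have h3 : ε * (κ + 1) * (E t * |dampDefect mu lam t|) ≤ ε * (κ + 1) * f' t := by gcongr
      nlinarith
    have s4 : ((ε * (κ + 1) * f' t + k₂ * ε ^ 2 * F' t) * E t - w t * E' t) / E t ^ 2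
        + damp mu lam t / 2 * (w t / E t)
        = ε * (κ + 1) * f' t / E t + k₂ * ε ^ 2 * F' t / E t
          + w t * (damp mu lam t / 2 * E t - E' t) / E t ^ 2 := by
      field_simp
      ring
    have s5 : 0 ≤ w t * (damp mu lam t / 2 * E t - E' t) / E t ^ 2 :=
      div_nonneg (mul_nonneg (hwpos t ht.1.le).le (sub_nonneg.2 (hEa t ht.1.le))) (sq_nonneg _)
    rw [s4]
    linarith
  · refine lt_of_le_of_lt (mul_le_mul_of_nonneg_left (hsum t ht) hκ.le) ?_
    have h1 : ε * J / E t ≤ ε * J := div_le_self (by positivity) (hE1 t ht.1)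
    rw [le_div_iff₀ (by positivity)] at hεb
    nlinarith [mul_le_mul_of_nonneg_left h1 hκ.le]

/-- A decaying supersolution of order `ε` yields global solutions. -/
theorem exists_lifespan_eq_top_of_decay (hγ : 1 < γ) (hmu : 0 ≤ mu) (hlam : 0 ≤ lam)
    (hφ : IsC1b φ) (hψ : IsC1b ψ) {h h' : ℝ → ℝ} {c σ : ℝ} (hc : 0 ≤ c) (hσ : 0 < σ)
    (hh : ∀ t, 0 ≤ t → HasDerivAt h (h' t) t) (hpos : ∀ t, 0 ≤ t → 0 < h t)
    (hle : ∀ t, 0 ≤ t → h t ≤ 1)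
    (hsup : ∀ t, 0 ≤ t → σ * h t ^ 2 ≤ h' t + damp mu lam t / 2 * h t)
    (ha : ∀ t, 0 ≤ t → damp mu lam t ≤ c * h t)
    (hR : ∀ t, 0 ≤ t → |dampDefect mu lam t| ≤ c * h t ^ 2) :
    ∃ ε₀ : ℝ, 0 < ε₀ ∧ ∀ ε, 0 < ε → ε ≤ ε₀ →
      lifespan γ mu lam (fun x => 1 + ε * φ x) (fun x => ε * ψ x) = ⊤ := by
  obtain ⟨κ, ε₁, hκ, hε₁, hcrit⟩ := exists_lifespan_criterion hγ hmu hlam hφ hψ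
  have hh0 := hpos 0 le_rfl
  -- The supersolution is `k ε h`. The first summand makes the gain `k σ` cover the defect `κ c`
  -- with a spare `1` for the quadratic term; the second puts the initial value above `κ ε`.
  obtain ⟨k, hk⟩ : ∃ k, k = (κ * c + 1) / σ + (κ + 1) / h 0 := ⟨_, rfl⟩
  have hk0 : 0 < k := by rw [hk]; positivity
  have hkσ : κ * c + 1 ≤ k * σ := by
    have : 0 < (κ + 1) / h 0 * σ := by positivity
    rw [hk, add_mul, div_mul_cancel₀ _ hσ.ne']
    linarith
  have hkh : κ < k * h 0 := by
    have : 0 < (κ * c + 1) / σ * h 0 := by positivity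
    rw [hk, add_mul, div_mul_cancel₀ _ hh0.ne']
    linarith
  obtain ⟨J, hJ⟩ : ∃ J, J = k + κ * c := ⟨_, rfl⟩
  have hJ0 : 0 < J := by rw [hJ]; positivity
  -- The second bound keeps `κ ε J` at most `1 / 2`, for the smallness condition; the third makes `κ
  -- (ε J h)² ≤ ε h²`, using up the spare `1`.
  refine ⟨min ε₁ (min (1 / (2 * (κ * J))) (1 / (κ * J ^ 2))), by positivity,
    fun ε hε hεle => ?_⟩
  obtain ⟨hεa, hεb⟩ := le_min_iff.1 hεle
  obtain ⟨hεb, hεc⟩ := le_min_iff.1 hεb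
  rw [le_div_iff₀ (by positivity)] at hεb hεc
  have hsum : ∀ t, 0 ≤ t → k * ε * h t + κ * ε * damp mu lam t ≤ ε * J * h t := fun t ht => by
    have h1 : κ * ε * damp mu lam t ≤ κ * ε * (c * h t) := by
      have := ha t ht
      gcongr
    rw [hJ]
    linarith
  have hnn : ∀ t, 0 ≤ t → 0 ≤ k * ε * h t + κ * ε * damp mu lam t := fun t ht => by
    have h1 := hpos t ht
    have h2 := damp_nonneg (mu := mu) hlam ht
    positivity
  have key : ∀ T : ℝ, 0 < T →
      (T : EReal) ≤ lifespan γ mu lam (fun x => 1 + ε * φ x) (fun x => ε * ψ x) := by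
    intro T hT
    refine hcrit ε hε hεa T hT (fun t => k * ε * h t) (fun t => k * ε * h' t)
      (fun t ht => (hh t ht).const_mul _) ?_ (fun t ht => ?_) (fun t ht => ?_) (fun t ht => ?_)
    · nlinarith
    · have := hpos t ht.1
      positivity
    · have ht0 := ht.1.le
      have hp := hpos t ht0
      have s1 : κ * (k * ε * h t + κ * ε * damp mu lam t) ^ 2 ≤ κ * (ε * J * h t) ^ 2 := by
        have := pow_le_pow_left₀ (hnn t ht0) (hsum t ht0) 2
        gcongr
      have s2 : κ * (ε * J * h t) ^ 2 ≤ ε * h t ^ 2 := by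
        have : 0 ≤ ε * h t ^ 2 := by positivity
        nlinarith
      have s3 : κ * ε * |dampDefect mu lam t| ≤ κ * ε * (c * h t ^ 2) := by
        have := hR t ht0
        gcongr
      have s4 : k * ε * (σ * h t ^ 2) ≤ k * ε * (h' t + damp mu lam t / 2 * h t) := by
        have := hsup t ht0
        gcongr
      have s5 : (κ * c + 1) * (ε * h t ^ 2) ≤ k * σ * (ε * h t ^ 2) := by gcongr
      linarith
    · refine lt_of_le_of_lt (mul_le_mul_of_nonneg_left (hsum t ht.1) hκ.le) ?_
      have h1 : ε * J * h t ≤ ε * J := mul_le_of_le_one_right (by positivity) (hle t ht.1)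
      nlinarith [mul_le_mul_of_nonneg_left h1 hκ.le]
  refine (EReal.eq_top_iff_forall_lt _).2 fun y => ?_
  refine lt_of_lt_of_le ?_ (key (max y 0 + 1) (by positivity))
  exact EReal.coe_lt_coe_iff.2 (lt_of_le_of_lt (le_max_left y 0) (lt_add_one _))

/-! ### Comparison functions for the individual damping regimes. -/

theorem hasDerivAt_one_add_rpow {r t : ℝ} (ht : 0 ≤ t) :
    HasDerivAt (fun t : ℝ => (1 + t) ^ r) (r * (1 + t) ^ (r - 1)) t := by
  refine (((hasDerivAt_id t).const_add 1).rpow_const (p := r)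
    (Or.inl (by simp only [id]; positivity))).congr_deriv ?_
  simp only [id]
  ring

/-- For `mu ≤ 1` and `t ≥ 0` both terms of the defect decay like `(1 + t) ^ (-2 mu)`. -/
theorem abs_dampDefect_le (hmu : 0 ≤ mu) (hlam : 0 ≤ lam) {r t : ℝ} (ht : 0 ≤ t)
    (h1 : -(2 * mu) ≤ r) (h2 : -mu - 1 ≤ r) :
    |dampDefect mu lam t| ≤ (lam ^ 2 / 4 + lam * mu / 2) * (1 + t) ^ r := by
  have h0 : (0:ℝ) ≤ 1 + t := by linarith
  have hb : (1:ℝ) ≤ 1 + t := by linarith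
  have e : damp mu lam t ^ 2 / 4 = lam ^ 2 / 4 * (1 + t) ^ (-(2 * mu)) := by
    rw [damp, mul_pow, ← Real.rpow_mul_natCast h0]
    push_cast
    rw [show -mu * 2 = -(2 * mu) by ring]
    ring
  rw [dampDefect, e]
  refine (abs_add_le _ _).trans ?_
  have p1 : (0:ℝ) ≤ (1 + t) ^ (-(2 * mu)) := Real.rpow_nonneg h0 _
  have p2 : (0:ℝ) ≤ (1 + t) ^ (-mu - 1) := Real.rpow_nonneg h0 _
  rw [abs_of_nonneg (by positivity), abs_div, abs_neg, abs_of_nonneg (by positivity),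
    abs_of_pos two_pos, add_mul, mul_div_right_comm]
  have q1 := Real.rpow_le_rpow_of_exponent_le hb h1
  have q2 := Real.rpow_le_rpow_of_exponent_le hb h2
  gcongr

/-- The damping is integrable in time and its integrating factor bounded, so `E = 1` loses nothing
and `∫ 1 / E = t`. The defect decays at least like `(1 + t) ^ (-mu)`, hence is integrable. -/
theorem lifespan_of_one_lt (hγ : 1 < γ) (hmu : 1 < mu) (hlam : 0 ≤ lam) (hφ : IsC1b φ)
    (hψ : IsC1b ψ) : ∃ ε₀ C : ℝ, 0 < ε₀ ∧ 0 < C ∧ ∀ ε, 0 < ε → ε ≤ ε₀ →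
      ((C * ε⁻¹ : ℝ) : EReal) ≤
        lifespan γ mu lam (fun x => 1 + ε * φ x) (fun x => ε * ψ x) := by
  have hδ : 0 < mu - 1 := by linarith
  obtain ⟨G, hG⟩ : ∃ G, G = lam ^ 2 / 4 + lam * mu / 2 := ⟨_, rfl⟩
  have hG0 : 0 ≤ G := by rw [hG]; positivity
  obtain ⟨ε₀, C, hε₀, hC, h⟩ := exists_lifespan_of_factor hγ (by linarith : 0 ≤ mu) hlam hφ hψ
    (E := fun _ => 1) (E' := fun _ => 0) (F := fun t => t) (F' := fun _ => 1)
    (f := fun t => G / (mu - 1) * (1 - (1 + t) ^ (1 - mu)))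
    (f' := fun t => G * (1 + t) ^ (-mu)) hlam (div_nonneg hG0 hδ.le)
    (fun t _ => hasDerivAt_const t _) (fun t _ => hasDerivAt_id t)
    (fun t ht => by
      refine (((hasDerivAt_one_add_rpow ht).const_sub 1).const_mul _).congr_deriv ?_
      rw [show 1 - mu - 1 = -mu by ring]
      field_simp
      ring)
    rfl (fun _ _ => le_rfl)
    (fun t ht => by
      have := damp_nonneg (mu := mu) hlam ht
      positivity)
    (fun t ht => by
      rw [mul_one]
      exact mul_le_of_le_one_right hlam (one_add_rpow_neg_le_one (by linarith) ht))
    (fun _ ht => ht) (fun _ _ => by simp)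
    (fun t ht => by
      have h1 := one_add_rpow_neg_le_one hδ.le ht
      rw [neg_sub] at h1
      have h2 : (0:ℝ) ≤ (1 + t) ^ (1 - mu) := Real.rpow_nonneg (by linarith) _
      have h3 : 0 ≤ G / (mu - 1) := div_nonneg hG0 hδ.le
      exact ⟨mul_nonneg h3 (by linarith), mul_le_of_le_one_right h3 (by linarith)⟩)
    (fun t ht => by
      rw [one_mul, hG]
      exact abs_dampDefect_le (by linarith) hlam ht (by linarith) (by linarith))
  refine ⟨ε₀, C, hε₀, hC, fun ε hε hεle => h ε hε hεle _ (by positivity) fun t ht => ?_⟩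
  calc ε * t ≤ ε * (C * ε⁻¹) := by
        have := ht.2
        gcongr
    _ = C := by field_simp

/-- The contributions of `a²` and `a'` have the same decay for `mu = 1`, and they cancel exactly
when `lam = 2`. -/
theorem dampDefect_one {t : ℝ} (ht : 0 ≤ t) :
    dampDefect 1 lam t = (lam ^ 2 / 4 - lam / 2) * (1 + t) ^ (-2 : ℝ) := by
  have h0 : (0:ℝ) ≤ 1 + t := by linarith
  rw [dampDefect, damp, mul_pow, ← Real.rpow_mul_natCast h0]
  norm_num
  ring

/-- Here `E` is the exact integrating factor `(1 + t) ^ (lam / 2)`, and `F`, a primitive of `1 / E`,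
is `(1 + t) ^ δ / δ` with `δ = 1 - lam / 2 > 0`. It reaches order `1 / ε` at time `ε ^ (-1 / δ)`,
and `1 / δ = 2 / (2 - lam)`. The product of `E` and the defect is of order `(1 + t) ^ (-1 - δ)`,
hence integrable. -/
theorem lifespan_of_eq_one_of_lt_two (hγ : 1 < γ) (hlam : 0 ≤ lam) (hlam2 : lam < 2) (hφ : IsC1b φ)
    (hψ : IsC1b ψ) : ∃ ε₀ C : ℝ, 0 < ε₀ ∧ 0 < C ∧ ∀ ε, 0 < ε → ε ≤ ε₀ →
      ((C * ε ^ (-(2 / (2 - lam))) : ℝ) : EReal) ≤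
        lifespan γ 1 lam (fun x => 1 + ε * φ x) (fun x => ε * ψ x) := by
  obtain ⟨δ, hδ⟩ : ∃ δ, δ = 1 - lam / 2 := ⟨_, rfl⟩
  have hδ0 : 0 < δ := by linarith
  obtain ⟨G, hG⟩ : ∃ G, G = |lam ^ 2 / 4 - lam / 2| := ⟨_, rfl⟩
  have hG0 : 0 ≤ G := by rw [hG]; positivity
  have hadd : ∀ {t : ℝ} (r s : ℝ), 0 ≤ t → (1 + t) ^ r * (1 + t) ^ s = (1 + t) ^ (r + s) :=
    fun r s ht => (Real.rpow_add (by linarith) r s).symm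
  obtain ⟨ε₀, C, hε₀, hC, h⟩ := exists_lifespan_of_factor hγ zero_le_one hlam hφ hψ
    (E := fun t => (1 + t) ^ (lam / 2)) (E' := fun t => lam / 2 * (1 + t) ^ (lam / 2 - 1))
    (F := fun t => (1 + t) ^ δ / δ) (F' := fun t => (1 + t) ^ (δ - 1))
    (f := fun t => G / δ * (1 - (1 + t) ^ (-δ)))
    (f' := fun t => G * (1 + t) ^ (-δ - 1)) hlam (div_nonneg hG0 hδ0.le)
    (fun t ht => hasDerivAt_one_add_rpow ht)
    (fun t ht => by
      refine ((hasDerivAt_one_add_rpow ht).div_const _).congr_deriv ?_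
      field_simp)
    (fun t ht => by
      refine (((hasDerivAt_one_add_rpow ht).const_sub 1).const_mul _).congr_deriv ?_
      field_simp)
    (by simp) (fun t ht => Real.one_le_rpow (by linarith) (by linarith))
    (fun t ht => by
      rw [damp, mul_div_right_comm, mul_assoc, hadd _ _ ht, neg_add_eq_sub])
    (fun t ht => by
      rw [damp, mul_assoc, hadd _ _ ht, show -1 + lam / 2 = -δ by rw [hδ]; ring]
      exact mul_le_of_le_one_right hlam (one_add_rpow_neg_le_one hδ0.le ht))
    (fun t ht => div_nonneg (Real.rpow_nonneg (by linarith) _) hδ0.le)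
    (fun t ht => by
      rw [← Real.rpow_neg (by linarith), hδ]
      exact le_of_eq (congrArg _ (by ring)))
    (fun t ht => by
      have h1 := one_add_rpow_neg_le_one hδ0.le ht
      have h2 : (0:ℝ) ≤ (1 + t) ^ (-δ) := Real.rpow_nonneg (by linarith) _
      have h3 : 0 ≤ G / δ := div_nonneg hG0 hδ0.le
      exact ⟨mul_nonneg h3 (by linarith), mul_le_of_le_one_right h3 (by linarith)⟩)
    (fun t ht => by
      rw [dampDefect_one ht, abs_mul, ← hG, abs_of_nonneg (Real.rpow_nonneg (by linarith) _),
        mul_left_comm, hadd _ _ ht]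
      exact le_of_eq (congrArg _ (congrArg _ (by rw [hδ]; ring))))
  -- Half of the budget `C δ` serves `ε T ^ δ = c`; the other half absorbs the `ε` left by `(1 + t)
  -- ^ δ ≤ 1 + t ^ δ`.
  obtain ⟨c, hc⟩ : ∃ c, c = C * δ / 2 := ⟨_, rfl⟩
  have hc0 : 0 < c := by rw [hc]; positivity
  refine ⟨min ε₀ c, c ^ (1 / δ), lt_min hε₀ hc0, by positivity, fun ε hε hεle => ?_⟩
  obtain ⟨h1, h2⟩ := le_min_iff.1 hεle
  have hT : 0 < c ^ (1 / δ) * ε ^ (-(2 / (2 - lam))) := by positivity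
  refine h ε hε h1 _ hT fun t ht => ?_
  have e : (c ^ (1 / δ) * ε ^ (-(2 / (2 - lam)))) ^ δ = c * ε⁻¹ := by
    rw [Real.mul_rpow (by positivity) (by positivity), ← Real.rpow_mul hc0.le,
      ← Real.rpow_mul hε.le, one_div_mul_cancel hδ0.ne', Real.rpow_one, ← Real.rpow_neg_one]
    congr 2
    have : 2 - lam ≠ 0 := by linarith
    rw [hδ]
    field_simp
  have h3 : (1 + t) ^ δ ≤ 1 + c * ε⁻¹ := by
    refine (Real.rpow_add_le_add_rpow zero_le_one ht.1 hδ0.le (by linarith)).trans ?_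
    rw [Real.one_rpow, ← e]
    have := Real.rpow_le_rpow ht.1 ht.2 hδ0.le
    linarith
  rw [← mul_div_assoc, div_le_iff₀ hδ0]
  calc ε * (1 + t) ^ δ ≤ ε * (1 + c * ε⁻¹) := by gcongr
    _ = ε + c := by field_simp
    _ ≤ C * δ := by linarith

/-- In the critical case `E = 1 + t` and `∫ 1 / E` is logarithmic. The defect multiplied by `E`
would be of the nonintegrable order `1 / (1 + t)`, but it vanishes identically here. -/
theorem lifespan_of_eq_one_of_eq_two (hγ : 1 < γ) (hφ : IsC1b φ)
    (hψ : IsC1b ψ) : ∃ ε₀ C : ℝ, 0 < ε₀ ∧ 0 < C ∧ ∀ ε, 0 < ε → ε ≤ ε₀ →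
      ((Real.exp (C / ε) : ℝ) : EReal) ≤
        lifespan γ 1 2 (fun x => 1 + ε * φ x) (fun x => ε * ψ x) := by
  have hd : ∀ t : ℝ, damp 1 2 t = 2 * (1 + t)⁻¹ := fun t => by rw [damp, Real.rpow_neg_one]
  obtain ⟨ε₀, C, hε₀, hC, h⟩ := exists_lifespan_of_factor hγ zero_le_one zero_le_two hφ hψ
    (E := fun t => 1 + t) (E' := fun _ => 1) (F := fun t => Real.log (1 + t))
    (F' := fun t => (1 + t)⁻¹) (f := fun _ => 0) (f' := fun _ => 0) zero_le_two le_rfl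
    (fun t _ => (hasDerivAt_id t).const_add 1)
    (fun t ht => by
      have := ((hasDerivAt_id t).const_add 1).log (by simp only [id]; positivity)
      simpa using this)
    (fun t _ => hasDerivAt_const t _) (by simp) (fun t ht => by simpa using ht)
    (fun t ht => by
      rw [hd]
      have : 1 + t ≠ 0 := by positivity
      field_simp
      exact le_rfl)
    (fun t ht => by
      rw [hd]
      have : 1 + t ≠ 0 := by positivity
      field_simp
      exact le_rfl)
    (fun t ht => Real.log_nonneg (by linarith)) (fun _ _ => le_rfl) (fun _ _ => ⟨le_rfl, le_rfl⟩)
    (fun t ht => by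
      rw [dampDefect_one ht]
      norm_num)
  -- Halving `C` leaves room for the additive `1` in `log (1 + t) ≤ 1 + C / (2 ε)`.
  refine ⟨min ε₀ (C / 2), C / 2, by positivity, by positivity, fun ε hε hεle => ?_⟩
  obtain ⟨h1, h2⟩ := le_min_iff.1 hεle
  refine h ε hε h1 _ (Real.exp_pos _) fun t ht => ?_
  have h3 : Real.log (1 + t) ≤ 1 + C / 2 / ε := by
    rw [Real.log_le_iff_le_exp (by linarith [ht.1]), Real.exp_add]
    have e1 : 2 ≤ Real.exp 1 := by linarith [Real.add_one_le_exp (1:ℝ)]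
    have e2 : 1 ≤ Real.exp (C / 2 / ε) := Real.one_le_exp (by positivity)
    nlinarith [ht.2]
  calc ε * Real.log (1 + t) ≤ ε * (1 + C / 2 / ε) := by gcongr
    _ = ε + C / 2 := by field_simp
    _ ≤ C := by linarith

/-- For `h = (b + t) ^ (-mu)` the derivative is `-mu (b + t) ^ (mu - 1) h²`, at least `-mu b ^ (mu -
1) h²`, while damping contributes at least `(lam / 2) h²`. The condition on `b` is that the balance
is positive. Since `mu ≤ 1`, the defect is also of order `h²`. -/
theorem exists_lifespan_eq_top (hγ : 1 < γ) (hmu : 0 ≤ mu) (hmu1 : mu ≤ 1) (hlam : 0 < lam)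
    (hφ : IsC1b φ) (hψ : IsC1b ψ) {b : ℝ} (hb : 1 ≤ b) (hbl : mu * b ^ (mu - 1) < lam / 2) :
    ∃ ε₀ : ℝ, 0 < ε₀ ∧ ∀ ε, 0 < ε → ε ≤ ε₀ →
      lifespan γ mu lam (fun x => 1 + ε * φ x) (fun x => ε * ψ x) = ⊤ := by
  obtain ⟨G, hG⟩ : ∃ G, G = lam ^ 2 / 4 + lam * mu / 2 := ⟨_, rfl⟩
  have hG0 : 0 ≤ G := by rw [hG]; positivity
  have hb1 : 1 ≤ b ^ mu := Real.one_le_rpow hb hmu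
  -- The inequality amounts to `b + t ≤ b (1 + t)`, valid for `b ≥ 1`; the shift costs only the
  -- constant `b ^ mu`.
  have hcomp : ∀ t : ℝ, 0 ≤ t → (1 + t) ^ (-mu) ≤ b ^ mu * (b + t) ^ (-mu) := fun t ht => by
    have h1 : 0 < 1 + t := by linarith
    have h2 : 0 < b + t := by linarith
    rw [Real.rpow_neg h1.le, Real.rpow_neg h2.le, ← div_eq_mul_inv, inv_le_comm₀ (by positivity)
      (by positivity), inv_div, div_le_iff₀ (by positivity), ← Real.mul_rpow h1.le (by linarith)]
    exact Real.rpow_le_rpow h2.le (by nlinarith) hmu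
  have hle : ∀ t : ℝ, 0 ≤ t → (b + t) ^ (-mu) ≤ (1 + t) ^ (-mu) := fun t ht =>
    Real.rpow_le_rpow_of_nonpos (by linarith) (by linarith) (by linarith)
  have hbt : ∀ t : ℝ, 0 ≤ t → 0 < (b + t) ^ (-mu) := fun t ht =>
    Real.rpow_pos_of_pos (by linarith) _
  refine exists_lifespan_eq_top_of_decay hγ hmu hlam.le hφ hψ (h := fun t => (b + t) ^ (-mu))
    (h' := fun t => -mu * (b + t) ^ (-mu - 1)) (c := lam * b ^ mu + G * (b ^ mu) ^ 2)
    (σ := lam / 2 - mu * b ^ (mu - 1)) (by positivity) (by linarith) (fun t ht => ?_) hbt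
    (fun t ht => (hle t ht).trans (one_add_rpow_neg_le_one hmu ht)) (fun t ht => ?_)
    (fun t ht => ?_) (fun t ht => ?_)
  · refine (((hasDerivAt_id t).const_add b).rpow_const (p := -mu)
      (Or.inl (by simp only [id]; positivity))).congr_deriv ?_
    simp only [id]
    ring
  · have e : (b + t) ^ (-mu - 1) = (b + t) ^ (mu - 1) * ((b + t) ^ (-mu)) ^ 2 := by
      rw [← Real.rpow_mul_natCast (by linarith), ← Real.rpow_add (by linarith)]
      congr 1
      push_cast
      ring
    have h1 : (b + t) ^ (mu - 1) ≤ b ^ (mu - 1) :=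
      Real.rpow_le_rpow_of_nonpos (by linarith) (by linarith) (by linarith)
    have h2 : mu * ((b + t) ^ (mu - 1) * ((b + t) ^ (-mu)) ^ 2)
        ≤ mu * (b ^ (mu - 1) * ((b + t) ^ (-mu)) ^ 2) := by gcongr
    have h3 : lam / 2 * (b + t) ^ (-mu) * (b + t) ^ (-mu)
        ≤ lam / 2 * (1 + t) ^ (-mu) * (b + t) ^ (-mu) := by
      have := hle t ht
      have := (hbt t ht).le
      gcongr
    simp only [damp]
    rw [e]
    linarith
  · have h1 := mul_le_mul_of_nonneg_left (hcomp t ht) hlam.le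
    have h2 : 0 ≤ G * (b ^ mu) ^ 2 * (b + t) ^ (-mu) := mul_nonneg (by positivity) (hbt t ht).le
    simp only [damp]
    linarith
  · have h0 := abs_dampDefect_le hmu hlam.le ht le_rfl (by linarith : -mu - 1 ≤ -(2 * mu))
    rw [← hG, show -(2 * mu) = -mu * (2 : ℕ) by push_cast; ring,
      Real.rpow_mul_natCast (by linarith)] at h0
    have h1 : ((1 + t) ^ (-mu)) ^ 2 ≤ (b ^ mu * (b + t) ^ (-mu)) ^ 2 :=
      pow_le_pow_left₀ (Real.rpow_nonneg (by linarith) _) (hcomp t ht) 2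
    have h2 := mul_le_mul_of_nonneg_left h1 hG0
    have h3 : 0 ≤ lam * b ^ mu * ((b + t) ^ (-mu)) ^ 2 := by positivity
    rw [mul_pow] at h2
    linarith

end

end DampedEuler

theorem theorem2p4 (γ mu lam : ℝ) (hγ : 1 < γ) (hmu : 0 ≤ mu) (hlam : 0 ≤ lam)
    (φ ψ : ℝ → ℝ) (hφ : DampedEuler.IsC1b φ) (hψ : DampedEuler.IsC1b ψ)
    (φm ψm : ℝ) (hφm : Tendsto φ atBot (𝓝 φm)) (hψm : Tendsto ψ atBot (𝓝 ψm)) :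
    ∃ ε₀ : ℝ, 0 < ε₀ ∧ ∃ C : ℝ, 0 < C ∧ ∀ ε : ℝ, 0 < ε → ε ≤ ε₀ →
      (1 < mu →
        ((C * ε⁻¹ : ℝ) : EReal) ≤
          DampedEuler.lifespan γ mu lam (fun x => 1 + ε * φ x) (fun x => ε * ψ x)) ∧
      (mu = 1 → lam < 2 →
        ((C * ε ^ (-(2 / (2 - lam))) : ℝ) : EReal) ≤
          DampedEuler.lifespan γ mu lam (fun x => 1 + ε * φ x) (fun x => ε * ψ x)) ∧
      (mu = 1 → lam = 2 →
        ((Real.exp (C / ε) : ℝ) : EReal) ≤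
          DampedEuler.lifespan γ mu lam (fun x => 1 + ε * φ x) (fun x => ε * ψ x)) ∧
      ((mu < 1 ∧ 0 < lam) ∨ (mu = 1 ∧ 2 < lam) →
        DampedEuler.lifespan γ mu lam (fun x => 1 + ε * φ x) (fun x => ε * ψ x) = ⊤) := by
  by_cases hglobal : (mu < 1 ∧ 0 < lam) ∨ (mu = 1 ∧ 2 < lam)
  · obtain ⟨b, hb, hbl⟩ : ∃ b : ℝ, 1 ≤ b ∧ mu * b ^ (mu - 1) < lam / 2 := by
      rcases hglobal with ⟨h1, h2⟩ | ⟨h1, h2⟩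
      -- For `mu < 1` a large shift `b` makes the derivative of `h` negligible, so any positive
      -- `lam` suffices. For `mu = 1` the shift has no effect, and the requirement is exactly `lam >
      -- 2`.
      · have ht : Tendsto (fun b : ℝ => mu * b ^ (-(1 - mu))) atTop (𝓝 (mu * 0)) :=
          (tendsto_rpow_neg_atTop (by linarith)).const_mul mu
        rw [mul_zero] at ht
        obtain ⟨b, hb1, hb2⟩ := ((eventually_ge_atTop 1).and
          (ht.eventually (gt_mem_nhds (half_pos h2)))).exists
        exact ⟨b, hb1, by rwa [neg_sub] at hb2⟩
      · refine ⟨1, le_rfl, ?_⟩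
        rw [Real.one_rpow, h1]
        linarith
    have hmu1 : mu ≤ 1 := by rcases hglobal with h | h <;> linarith [h.1]
    have hlam0 : 0 < lam := by rcases hglobal with h | h <;> linarith [h.2]
    obtain ⟨ε₀, hε₀, h⟩ := DampedEuler.exists_lifespan_eq_top hγ hmu hmu1 hlam0 hφ hψ hb hbl
    refine ⟨ε₀, hε₀, 1, one_pos, fun ε hε hεle => ?_⟩
    rw [h ε hε hεle]
    simp
  · rcases lt_trichotomy mu 1 with h1 | rfl | h1
    -- With `mu < 1` outside the global case all four claims are vacuous, so any constants do.
    · refine ⟨1, one_pos, 1, one_pos, fun ε _ _ => ⟨fun h => ?_, fun h => ?_, fun h => ?_,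
        fun h => absurd h hglobal⟩⟩ <;> linarith
    · rcases lt_trichotomy lam 2 with h2 | rfl | h2
      · obtain ⟨ε₀, C, hε₀, hC, h⟩ := DampedEuler.lifespan_of_eq_one_of_lt_two hγ hlam h2 hφ hψ
        exact ⟨ε₀, hε₀, C, hC, fun ε hε hεle => ⟨fun h => absurd h (lt_irrefl _),
          fun _ _ => h ε hε hεle, fun _ h => absurd h h2.ne, fun h => absurd h hglobal⟩⟩
      · obtain ⟨ε₀, C, hε₀, hC, h⟩ := DampedEuler.lifespan_of_eq_one_of_eq_two hγ hφ hψ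
        exact ⟨ε₀, hε₀, C, hC, fun ε hε hεle => ⟨fun h => absurd h (lt_irrefl _),
          fun _ h => absurd h (lt_irrefl _), fun _ _ => h ε hε hεle, fun h => absurd h hglobal⟩⟩
      · exact absurd (Or.inr ⟨rfl, h2⟩) hglobal
    · obtain ⟨ε₀, C, hε₀, hC, h⟩ := DampedEuler.lifespan_of_one_lt hγ h1 hlam hφ hψ
      exact ⟨ε₀, hε₀, C, hC, fun ε hε hεle => ⟨fun _ => h ε hε hεle,
        fun h => absurd h h1.ne', fun h => absurd h h1.ne', fun h => absurd h hglobal⟩⟩
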